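/- Let $(\beta_n)_{n\ge 1}$ be a sequence of nonnegative real numbers. For each $n\ge 2$ let $K_n$ be the complete graph on $n$ vertices, let $s=s_n\in V(K_n)$ be an arbitrary starting vertex, and let $\mathbf U=\{U_e\}_{e\in E(K_n)}$ be i.i.d. random variables, uniform on $[0,1]$. Given $\mathbf U$, let $(X_t)_{t\ge 0}$ be the random walk on $V(K_n)$ with $X_0=s$ and transition probabilities $$p(x,y)=\frac{\exp(-\beta_n U_{(x,y)})}{\sum_{v\ne x}\exp(-\beta_n U_{(x,v)})}\qquad (x\neq y).$$ *Aldous–Broder algorithm:* put $V_0=\{s\}$; for $0\le k\le n-2$ let $f_{k+1}$ be the first edge between $V_k$ and $V(K_n)\setminus V_k$ crossed by the walk $(X_t)$, and let $V_{k+1}$ be $V_k$ together with the endpoint of $f_{k+1}$ outside $V_k$. *Prim's invasion algorithm:* put $W_0=\{s\}$; for $0\le k\le n-2$ let $g_{k+1}$ be the edge $e$ with minimal label $U_e$ among the edges between $W_k$ and $V(K_n)\setminus W_k$, and let $W_{k+1}$ be $W_k$ together with the endpoint of $g_{k+1}$ outside $W_k$. (Almost surely all $f_i,g_i$, $1\le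 i\le n-1$, are well defined.) Let $\mathbb P_s$ be the joint law of $\mathbf U$ and $(X_t)$, so that both algorithms use the same labels. Then: a) If $\beta_n\gg n^3\log n$, i.e. $n^3\log n/\beta_n\to 0$, then $$\lim_{n\to\infty}\mathbb P_s\bigl(f_i=g_i\ \text{ for all } i\in\{1,\dots,n-1\}\bigr)=1 .$$ b) If $\beta_n\ll n^3$, i.e. $\beta_n/n^3\to 0$, then $$\lim_{n\to\infty}\mathbb P_s\bigl(f_i=g_i\ \text{ for all } i\in\{1,\dots,n-1\}\bigr)=0 ,$$ that is, with probability tending to $1$ the two algorithms add different edges in some step. -/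

import Mathlib

open MeasureTheory ProbabilityTheory Filter Asymptotics

noncomputable section

namespace SpanningTreeAlgorithms

variable {V : Type*} [Fintype V] [DecidableEq V]

/-- Real labels on the edges of the complete graph with vertex set `V`. -/
abbrev EdgeLabels (V : Type*) := (⊤ : SimpleGraph V).edgeSet → ℝ

/-- The label of the edge joining two distinct vertices `a`, `b` (the value at `a = b` is never
used). -/
def pairLabel (u : EdgeLabels V) (a b : V) : ℝ :=
  if h : a ≠ b then u ⟨s(a, b), by simpa using h⟩ else 0

/-- The electric network on the complete graph with conductances `exp (-β u_e)`; there are no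
loops, so the conductance is `0` on the diagonal. -/
def expConductance (β : ℝ) (u : EdgeLabels V) (a b : V) : ℝ :=
  if a = b then 0 else Real.exp (-β * pairLabel u a b)

/-- Transition probabilities of the random walk on the network with conductances `c`. -/
def transitionProb (c : V → V → ℝ) (x y : V) : ℝ :=
  c x y / ∑ z, c x z

/-- Probability that the random walk on the network `c` started at `s` follows, in its first `k`
steps, the path `x 0, x 1, …, x k`. -/
def walkPathProb (c : V → V → ℝ) (s : V) (k : ℕ) (x : ℕ → V) : ℝ :=
  if x 0 = s then ∏ i ∈ Finset.range k, transitionProb c (x i) (x (i + 1)) else 0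

/-- Steps leading from inside to outside of `S`: the edge boundary of `S`, each edge being
directed from its endpoint in `S` to its endpoint outside of `S`. -/
def exitSteps (S : Finset V) : Finset (V × V) :=
  Finset.univ.filter fun e => e.1 ∈ S ∧ e.2 ∉ S

open Classical in
/-- The first step along which the trajectory `x` leaves `S` (`none` if there is no such step).
For a trajectory started in `S` this is its first crossing of the edge boundary of `S`. -/
def firstExit (x : ℕ → V) (S : Finset V) : Option (V × V) :=
  if h : ∃ t, (x t, x (t + 1)) ∈ exitSteps S then
    some (x (Nat.find h), x (Nat.find h + 1))
  else none

open Classical in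
/-- The step leaving `S` along an edge of minimal label (`none` if no edge leaves `S`). A minimizer
is picked arbitrarily when several exist; for i.i.d. uniform labels this has probability `0`. -/
def minExit (u : EdgeLabels V) (S : Finset V) : Option (V × V) :=
  if h : (exitSteps S).Nonempty then
    some (Finset.exists_min_image (exitSteps S) (fun e => pairLabel u e.1 e.2) h).choose
  else none

/-- Add the far endpoint of a step, if there is one, to the vertex set of the current tree. -/
def addEndpoint (S : Finset V) : Option (V × V) → Finset V
  | some e => insert e.2 S
  | none => S

/-- Aldous–Broder: the vertex set `V_k = {v_0, …, v_k}` after `k` edges have been added, when the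
trajectory of the walk started at `s` is `x`. -/
def abVertices (s : V) (x : ℕ → V) : ℕ → Finset V
  | 0 => {s}
  | k + 1 => addEndpoint (abVertices s x k) (firstExit x (abVertices s x k))

/-- Aldous–Broder: `abEdge s x k` is the edge `f_{k+1}`, the first edge between `V_k` and its
complement that is crossed by the walk. -/
def abEdge (s : V) (x : ℕ → V) (k : ℕ) : Option (Sym2 V) :=
  (firstExit x (abVertices s x k)).map fun e => s(e.1, e.2)

/-- Prim's invasion: the vertex set `W_k = {w_0, …, w_k}` after `k` edges have been added. -/
def primVertices (s : V) (u : EdgeLabels V) : ℕ → Finset V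
  | 0 => {s}
  | k + 1 => addEndpoint (primVertices s u k) (minExit u (primVertices s u k))

/-- Prim's invasion: `primEdge s u k` is the edge `g_{k+1}`, the edge of minimal label between
`W_k` and its complement. -/
def primEdge (s : V) (u : EdgeLabels V) (k : ℕ) : Option (Sym2 V) :=
  (minExit u (primVertices s u k)).map fun e => s(e.1, e.2)

/-- `U` is a family of i.i.d. labels, uniform on `[0, 1]`, on the edges of the complete graph on
`V`, and, given `U`, the process `X` is the random walk started at `s` on the electric network
with conductances `exp (-β U_e)`. Prim's algorithm is run on `U` and the Aldous–Broder algorithm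
on `X`, so this is the coupling of the two algorithms through the same labels. -/
structure IsLabelledWalk {Ω : Type*} [MeasurableSpace Ω] (P : Measure Ω) (β : ℝ) (s : V)
    (U : (⊤ : SimpleGraph V).edgeSet → Ω → ℝ) (X : ℕ → Ω → V) : Prop where
  isProbabilityMeasure : IsProbabilityMeasure P
  measurable_label : ∀ e, Measurable (U e)
  indep_label : iIndepFun U P
  uniform_label : ∀ e, pdf.IsUniform (U e) (Set.Icc 0 1) P volume
  measurable_walk : ∀ t v, MeasurableSet {ω | X t ω = v}
  /-- The conditional law of the walk given the labels. -/
  walk_law : ∀ (B : Set (EdgeLabels V)), MeasurableSet B → ∀ (k : ℕ) (x : ℕ → V),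
    P {ω | (fun e => U e ω) ∈ B ∧ ∀ i ≤ k, X i ω = x i} =
      ∫⁻ ω in {ω | (fun e => U e ω) ∈ B},
        ENNReal.ofReal (walkPathProb (expConductance β fun e => U e ω) s k x) ∂P

/-- The event that the two algorithms add the same edge in every step: `f_i = g_i` for all
`i = k + 1` in `{1, …, n - 1}`, where `n` is the number of vertices. -/
def agreementEvent {Ω : Type*} (s : V) (U : (⊤ : SimpleGraph V).edgeSet → Ω → ℝ)
    (X : ℕ → Ω → V) : Set Ω :=
  {ω | ∀ k, k + 1 < Fintype.card V →
    abEdge s (fun t => X t ω) k = primEdge s (fun e => U e ω) k}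

end SpanningTreeAlgorithms

end

set_option linter.unusedSectionVars false

noncomputable section

namespace SpanningTreeAlgorithms

variable {V : Type*} [Fintype V] [DecidableEq V]

/-! Part a). Suppose that in every step of Prim's invasion the minimal boundary label beats all
other boundary labels by `δ`. The vertex `v` that Prim added last is joined to the outer end of the
minimal boundary edge `d` by a path whose labels do not exceed that of `d` (`WellConnected`), hence
by edges of conductance at least that of `d`. As a function of the starting point, the probability
of leaving through `d` is harmonic except for losses at the other boundary edges, whose conductances
are smaller by a factor `e^{-βδ}`. Bounding the Dirichlet energy by these losses and telescoping
along the path (`conductance_mul_sq_sub_le`, `eventualProb_cons_ge`) shows that each step costs a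
probability of at most `n · n e^{-βδ/2}`, so all steps together cost `n³ e^{-βδ/2}`
(`eventualProb_primList_ge`). Some gap is smaller than `δ` with probability at most `n³ δ`: there
are `n` steps and at most `n²` competing edges, and the label of a competing edge can be revealed
last (`labelMeasure_not_hasGaps_le`). With `δ = 8 log n / β` both errors vanish.

Part b). Call `a` and `b` rivals if both leave the cluster of `s` formed by the labels below the
smaller one of their two labels. Prim crosses the rival with the smaller label. Exchanging the two
labels preserves their law, does not change Prim's earlier steps, and makes Prim cross the other
rival (`IsRivalPair.prim_step`). If the labels differ by `O(n⁻³)` and `β ≪ n³`, the walk hardly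
notices the exchange (`followProb_comparison`). So agreement in the presence of a rival pair has
nearly the same probability as a deviation at that pair: the walk follows Prim up to this step and
then crosses the rival with the larger label. A walk deviates from Prim for the first time only
once, so the deviation events of different pairs are disjoint, and the expected number of rival
pairs on the agreement event is at most about `1` (`sum_measure_agreement_le`). If there are
typically many rival pairs, Markov's inequality makes agreement unlikely.

Rival pairs are produced as follows. Reserve two sets of `γn` vertices and let the core be the
remaining `q` vertices. At level `C/q` most core vertices lie in one cluster with more than half of
the core (`measureReal_inter_small_coreCluster_le`). A reserved vertex whose only edge to the core
with label at most `2C/q` has its label above `C/q` is a pendant vertex to be added later. Two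
pendant edges with labels in the same bin of width of order `n⁻³` are rivals unless something
exceptional occurs. A second moment bound (`measureReal_count_le`) controls their number, whose mean
is a constant as large as desired; `agreementEvent_le` combines the estimates. -/

/-! ### Trajectories that leave growing sets through prescribed steps -/

/-- Within its first `T` steps the trajectory `x` leaves `S` through the first step of the list, then
leaves the enlarged set through the second step, and so on until the list is exhausted. -/
def Follows : ℕ → (ℕ → V) → Finset V → List (V × V) → Prop
  | _, _, _, [] => True
  | 0, _, _, _ :: _ => False
  | T + 1, x, S, d :: l =>
      (x 1 ∈ S ∧ Follows T (fun j => x (1 + j)) S (d :: l)) ∨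
      (x 1 ∉ S ∧ (x 0, x 1) = d ∧ Follows T (fun j => x (1 + j)) (insert (x 1) S) l)

/-- The probability that the walk on the network `c`, started at `z`, follows the list `l` within
`T` steps. -/
def followProb (c : V → V → ℝ) : ℕ → Finset V → List (V × V) → V → ℝ
  | _, _, [], _ => 1
  | 0, _, _ :: _, _ => 0
  | T + 1, S, d :: l, z => ∑ w, transitionProb c z w *
      (if w ∈ S then followProb c T S (d :: l) w
        else if (z, w) = d then followProb c T (insert w S) l w else 0)

theorem follows_nil (T : ℕ) (x : ℕ → V) (S : Finset V) : Follows T x S [] := by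
  cases T <;> simp [Follows]

theorem not_follows_zero_cons (x : ℕ → V) (S : Finset V) (d : V × V) (l : List (V × V)) :
    ¬ Follows 0 x S (d :: l) := by
  simp [Follows]

theorem followProb_nil (c : V → V → ℝ) (T : ℕ) (S : Finset V) (z : V) :
    followProb c T S [] z = 1 := by
  cases T <;> simp [followProb]

theorem followProb_zero_cons (c : V → V → ℝ) (S : Finset V) (d : V × V) (l : List (V × V)) (z : V) :
    followProb c 0 S (d :: l) z = 0 := by
  simp [followProb]

theorem followProb_succ_cons (c : V → V → ℝ) (T : ℕ) (S : Finset V) (d : V × V)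
    (l : List (V × V)) (z : V) :
    followProb c (T + 1) S (d :: l) z = ∑ w, transitionProb c z w *
      (if w ∈ S then followProb c T S (d :: l) w
        else if (z, w) = d then followProb c T (insert w S) l w else 0) := by
  simp [followProb]

theorem transitionProb_nonneg {c : V → V → ℝ} (hc : ∀ a b, 0 ≤ c a b) (z w : V) :
    0 ≤ transitionProb c z w :=
  div_nonneg (hc _ _) (Finset.sum_nonneg fun _ _ => hc _ _)

theorem sum_transitionProb {c : V → V → ℝ} {z : V} (hz : 0 < ∑ w, c z w) :
    ∑ w, transitionProb c z w = 1 := by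
  unfold transitionProb
  rw [← Finset.sum_div, div_self hz.ne']

theorem sum_transitionProb_le_one {c : V → V → ℝ} (z : V) :
    ∑ w, transitionProb c z w ≤ 1 := by
  unfold transitionProb
  rw [← Finset.sum_div]
  exact div_self_le_one _

theorem followProb_nonneg {c : V → V → ℝ} (hc : ∀ a b, 0 ≤ c a b) (T : ℕ) (S : Finset V)
    (l : List (V × V)) (z : V) : 0 ≤ followProb c T S l z := by
  induction T generalizing S l z with
  | zero => cases l <;> simp [followProb]
  | succ T ih =>
    cases l with
    | nil => simp [followProb]
    | cons d l =>
      rw [followProb_succ_cons]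
      refine Finset.sum_nonneg fun w _ => mul_nonneg (transitionProb_nonneg hc _ _) ?_
      split_ifs
      · exact ih _ _ _
      · exact ih _ _ _
      · exact le_rfl

theorem followProb_le_one {c : V → V → ℝ} (hc : ∀ a b, 0 ≤ c a b) (T : ℕ) (S : Finset V)
    (l : List (V × V)) (z : V) : followProb c T S l z ≤ 1 := by
  induction T generalizing S l z with
  | zero => cases l <;> simp [followProb]
  | succ T ih =>
    cases l with
    | nil => simp [followProb]
    | cons d l =>
      rw [followProb_succ_cons]
      calc _ ≤ ∑ w, transitionProb c z w := by
            refine Finset.sum_le_sum fun w _ =>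
              mul_le_of_le_one_right (transitionProb_nonneg hc _ _) ?_
            split_ifs
            · exact ih _ _ _
            · exact ih _ _ _
            · exact zero_le_one
        _ ≤ 1 := sum_transitionProb_le_one z

theorem followProb_le_succ {c : V → V → ℝ} (hc : ∀ a b, 0 ≤ c a b) (T : ℕ) (S : Finset V)
    (l : List (V × V)) (z : V) : followProb c T S l z ≤ followProb c (T + 1) S l z := by
  induction T generalizing S l z with
  | zero =>
    cases l with
    | nil => simp [followProb]
    | cons d l => rw [followProb_zero_cons]; exact followProb_nonneg hc _ _ _ _
  | succ T ih =>
    cases l with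
    | nil => simp [followProb]
    | cons d l =>
      rw [followProb_succ_cons, followProb_succ_cons]
      refine Finset.sum_le_sum fun w _ =>
        mul_le_mul_of_nonneg_left ?_ (transitionProb_nonneg hc _ _)
      split_ifs
      · exact ih _ _ _
      · exact ih _ _ _
      · exact le_rfl

theorem monotone_followProb {c : V → V → ℝ} (hc : ∀ a b, 0 ≤ c a b) (S : Finset V)
    (l : List (V × V)) (z : V) : Monotone fun T => followProb c T S l z :=
  monotone_nat_of_le_succ fun T => followProb_le_succ hc T S l z

/-! ### Agreement with a list of steps -/

/-- The successive first exits of the trajectory `x` from `S` and its enlargements are the steps in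
the list. -/
def Agrees (x : ℕ → V) : Finset V → List (V × V) → Prop
  | _, [] => True
  | S, d :: l => firstExit x S = some d ∧ Agrees x (insert d.2 S) l

theorem mem_exitSteps {S : Finset V} {e : V × V} : e ∈ exitSteps S ↔ e.1 ∈ S ∧ e.2 ∉ S := by
  simp [exitSteps]

theorem mem_exitSteps_of_firstExit {x : ℕ → V} {S : Finset V} {e : V × V}
    (h : firstExit x S = some e) : e ∈ exitSteps S := by
  classical
  unfold firstExit at h
  split_ifs at h with h'
  have := Nat.find_spec h'
  cases h
  exact this

theorem firstExit_eq_some_of_stay {x : ℕ → V} {S : Finset V} {t : ℕ} (hx : ∀ i ≤ t, x i ∈ S)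
    (ht : x (t + 1) ∉ S) : firstExit x S = some (x t, x (t + 1)) := by
  classical
  have h : ∃ t, (x t, x (t + 1)) ∈ exitSteps S := ⟨t, mem_exitSteps.2 ⟨hx t le_rfl, ht⟩⟩
  have hf : Nat.find h = t := by
    rw [Nat.find_eq_iff]
    refine ⟨mem_exitSteps.2 ⟨hx t le_rfl, ht⟩, fun m hm hm' => ?_⟩
    exact (mem_exitSteps.1 hm').2 (hx (m + 1) hm)
  unfold firstExit
  rw [dif_pos h, hf]

theorem exists_time_of_firstExit {x : ℕ → V} {S : Finset V} {e : V × V} (h0 : x 0 ∈ S)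
    (h : firstExit x S = some e) : ∃ t, (∀ i ≤ t, x i ∈ S) ∧ x (t + 1) ∉ S ∧
      e = (x t, x (t + 1)) := by
  classical
  unfold firstExit at h
  split_ifs at h with h'
  have hs := Nat.find_spec h'
  refine ⟨Nat.find h', fun i hi => ?_, (mem_exitSteps.1 hs).2, by cases h; rfl⟩
  induction i with
  | zero => exact h0
  | succ i ih =>
    by_contra hc
    exact Nat.find_min h' (Nat.lt_of_succ_le hi)
      (mem_exitSteps.2 ⟨ih (by omega), hc⟩)

theorem agrees_of_follows {T : ℕ} {x : ℕ → V} {t : ℕ} {S : Finset V} {l : List (V × V)}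
    (hx : ∀ i ≤ t, x i ∈ S) (h : Follows T (fun j => x (t + j)) S l) : Agrees x S l := by
  induction T generalizing t S l with
  | zero =>
    cases l with
    | nil => trivial
    | cons d l => exact absurd h (not_follows_zero_cons _ _ _ _)
  | succ T ih =>
    cases l with
    | nil => trivial
    | cons d l =>
      simp only [Follows, ← add_assoc, add_zero] at h
      rcases h with ⟨h1, h2⟩ | ⟨h1, h2, h3⟩
      · refine ih (t := t + 1) (fun i hi => ?_) h2
        rcases Nat.le_succ_iff.1 hi with hi | rfl
        · exact hx i hi
        · exact h1
      · refine ⟨by rw [firstExit_eq_some_of_stay hx h1, h2], ?_⟩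
        subst h2
        refine ih (t := t + 1) (fun i hi => ?_) h3
        rcases Nat.le_succ_iff.1 hi with hi | rfl
        · exact Finset.mem_insert_of_mem (hx i hi)
        · exact Finset.mem_insert_self _ _

theorem follows_of_stay {T : ℕ} {x : ℕ → V} {S : Finset V} {l : List (V × V)} (k t : ℕ)
    (hx : ∀ i, t < i → i ≤ t + k → x i ∈ S) (h : Follows T (fun j => x (t + k + j)) S l) :
    Follows (T + k) (fun j => x (t + j)) S l := by
  cases l with
  | nil => exact follows_nil _ _ _
  | cons d l =>
  induction k generalizing t with
  | zero => simpa using h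
  | succ k ih =>
    rw [← add_assoc]
    refine Or.inl ⟨hx _ (by omega) (by omega), ?_⟩
    have := ih (t + 1) (fun i h1 h2 => hx i (by omega) (by omega))
      (by rwa [show t + 1 + k = t + (k + 1) by omega])
    simpa only [add_assoc] using this

theorem exists_follows_of_agrees {x : ℕ → V} {t : ℕ} {S : Finset V} {l : List (V × V)}
    (hx : ∀ i ≤ t, x i ∈ S) (h : Agrees x S l) : ∃ T, Follows T (fun j => x (t + j)) S l := by
  induction l generalizing t S with
  | nil => exact ⟨0, follows_nil _ _ _⟩
  | cons d l ih =>
    obtain ⟨h1, h2⟩ := h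
    obtain ⟨t', ht', hn, rfl⟩ := exists_time_of_firstExit (hx 0 (Nat.zero_le _)) h1
    have htt : t ≤ t' := by
      by_contra hlt
      exact hn (hx _ (by omega))
    obtain ⟨k, rfl⟩ := Nat.exists_eq_add_of_le htt
    obtain ⟨T, hT⟩ := ih (t := t + k + 1) (S := insert (x (t + k + 1)) S) (fun i hi => by
      rcases Nat.le_succ_iff.1 hi with hi | rfl
      · exact Finset.mem_insert_of_mem (ht' i hi)
      · exact Finset.mem_insert_self _ _) h2
    refine ⟨T + 1 + k, follows_of_stay k t (fun i _ hi => ht' i hi) ?_⟩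
    refine Or.inr ⟨hn, rfl, ?_⟩
    simpa only [add_assoc] using hT

/-- The link between the algorithm and computable probabilities: `Agrees` speaks of first exits,
while `Follows T` is determined by finitely many steps, obeys a recursion in time and increases with
`T`. -/
theorem agrees_iff_exists_follows {x : ℕ → V} {S : Finset V} {l : List (V × V)} (h0 : x 0 ∈ S) :
    Agrees x S l ↔ ∃ T, Follows T x S l := by
  have hx : ∀ i ≤ 0, x i ∈ S := fun i hi => by rwa [Nat.le_zero.1 hi]
  constructor
  · intro h
    simpa using exists_follows_of_agrees (t := 0) hx h
  · rintro ⟨T, h⟩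
    exact agrees_of_follows (t := 0) hx (by simpa using h)

theorem Follows.mono {T T' : ℕ} (hT : T ≤ T') {x : ℕ → V} {S : Finset V} {l : List (V × V)}
    (h : Follows T x S l) : Follows T' x S l := by
  induction T generalizing T' x S l with
  | zero =>
    cases l with
    | nil => exact follows_nil _ _ _
    | cons d l => exact absurd h (not_follows_zero_cons _ _ _ _)
  | succ T ih =>
    cases l with
    | nil => exact follows_nil _ _ _
    | cons d l =>
      cases T' with
      | zero => omega
      | succ T' =>
        rcases h with ⟨h1, h2⟩ | ⟨h1, h2, h3⟩
        · exact Or.inl ⟨h1, ih (by omega) h2⟩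
        · exact Or.inr ⟨h1, h2, ih (by omega) h3⟩

theorem Agrees.of_append {x : ℕ → V} {S : Finset V} {l l' : List (V × V)}
    (h : Agrees x S (l ++ l')) : Agrees x S l := by
  induction l generalizing S with
  | nil => trivial
  | cons d l ih => exact ⟨h.1, ih h.2⟩

/-- Two lists that agree with the same trajectory and have a common prefix have the same next
step. -/
theorem Agrees.next_eq {x : ℕ → V} {S : Finset V} {l l₁ l₂ : List (V × V)} {d₁ d₂ : V × V}
    (h₁ : Agrees x S (l ++ d₁ :: l₁)) (h₂ : Agrees x S (l ++ d₂ :: l₂)) : d₁ = d₂ := by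
  induction l generalizing S with
  | nil => exact Option.some.inj (h₁.1.symm.trans h₂.1)
  | cons d l ih => exact ih h₁.2 h₂.2

/-! ### The law of the walk and the probability of following a list -/

theorem measurable_pairLabel (a b : V) : Measurable fun u : EdgeLabels V => pairLabel u a b := by
  unfold pairLabel
  split_ifs
  · exact measurable_pi_apply _
  · exact measurable_const

theorem measurable_expConductance (β : ℝ) (a b : V) :
    Measurable fun u : EdgeLabels V => expConductance β u a b := by
  unfold expConductance
  split_ifs
  · exact measurable_const
  · exact ((measurable_pairLabel a b).const_mul _).exp

theorem measurable_transitionProb (β : ℝ) (a b : V) :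
    Measurable fun u : EdgeLabels V => transitionProb (expConductance β u) a b := by
  unfold transitionProb
  exact (measurable_expConductance β a b).div
    (Finset.measurable_fun_sum _ fun z _ => measurable_expConductance β a z)

theorem measurable_walkPathProb (β : ℝ) (s : V) (k : ℕ) (x : ℕ → V) :
    Measurable fun u : EdgeLabels V => walkPathProb (expConductance β u) s k x := by
  unfold walkPathProb
  split_ifs
  · exact Finset.measurable_fun_prod _ fun z _ => measurable_transitionProb β _ _
  · exact measurable_const

theorem measurable_followProb (β : ℝ) (T : ℕ) (S : Finset V) (l : List (V × V)) (z : V) :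
    Measurable fun u : EdgeLabels V => followProb (expConductance β u) T S l z := by
  induction T generalizing S l z with
  | zero => cases l <;> simp only [followProb] <;> exact measurable_const
  | succ T ih =>
    cases l with
    | nil => simp only [followProb]; exact measurable_const
    | cons d l =>
      simp only [followProb_succ_cons]
      refine Finset.measurable_fun_sum _ fun w _ => (measurable_transitionProb β _ _).mul ?_
      split_ifs
      · exact ih _ _ _
      · exact ih _ _ _
      · exact measurable_const

theorem expConductance_nonneg (β : ℝ) (u : EdgeLabels V) (a b : V) : 0 ≤ expConductance β u a b := by
  unfold expConductance
  split_ifs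
  · exact le_rfl
  · exact (Real.exp_pos _).le

theorem walkPathProb_nonneg {c : V → V → ℝ} (hc : ∀ a b, 0 ≤ c a b) (s : V) (k : ℕ) (x : ℕ → V) :
    0 ≤ walkPathProb c s k x := by
  unfold walkPathProb
  split_ifs
  · exact Finset.prod_nonneg fun _ _ => transitionProb_nonneg hc _ _
  · exact le_rfl

theorem walkPathProb_succ_update (c : V → V → ℝ) (s : V) (k : ℕ) (x : ℕ → V) (w : V) :
    walkPathProb c s (k + 1) (Function.update x (k + 1) w) =
      walkPathProb c s k x * transitionProb c (x k) w := by
  unfold walkPathProb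
  have h0 : Function.update x (k + 1) w 0 = x 0 := Function.update_of_ne (by omega) _ _
  rw [h0]
  split_ifs
  · rw [Finset.prod_range_succ, Function.update_self, Function.update_of_ne (by omega)]
    congr 1
    refine Finset.prod_congr rfl fun i hi => ?_
    rw [Finset.mem_range] at hi
    rw [Function.update_of_ne (by omega), Function.update_of_ne (by omega)]
  · simp

namespace IsLabelledWalk

variable {Ω : Type*} [MeasurableSpace Ω] {P : Measure Ω} {β : ℝ} {s : V}
  {U : (⊤ : SimpleGraph V).edgeSet → Ω → ℝ} {X : ℕ → Ω → V}

theorem measurable_labels (h : IsLabelledWalk P β s U X) : Measurable fun ω e => U e ω :=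
  measurable_pi_lambda _ h.measurable_label

theorem measurableSet_follows (h : IsLabelledWalk P β s U X) (T k : ℕ) (S : Finset V)
    (l : List (V × V)) : MeasurableSet {ω | Follows T (fun j => X (k + j) ω) S l} := by
  have hX : ∀ (t : ℕ) (p : V → Prop), MeasurableSet {ω | p (X t ω)} := fun t p => by
    have : {ω | p (X t ω)} = ⋃ v ∈ {v | p v}, {ω | X t ω = v} := by ext; simp
    rw [this]
    exact MeasurableSet.biUnion (Set.to_countable _) fun v _ => h.measurable_walk t v
  induction T generalizing k S l with
  | zero => cases l <;> simp [Follows]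
  | succ T ih =>
    cases l with
    | nil => simp [Follows]
    | cons d l =>
      have : {ω | Follows (T + 1) (fun j => X (k + j) ω) S (d :: l)} =
          ({ω | X (k + 1) ω ∈ S} ∩ {ω | Follows T (fun j => X (k + 1 + j) ω) S (d :: l)}) ∪
          ({ω | X (k + 1) ω ∉ S} ∩ ({ω | X k ω = d.1} ∩ {ω | X (k + 1) ω = d.2} ∩
            {ω | Follows T (fun j => X (k + 1 + j) ω) (insert d.2 S) l})) := by
        ext ω
        simp only [Follows, ← add_assoc, add_zero, Set.mem_ofPred_eq, Set.mem_union,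
          Set.mem_inter_iff, Prod.ext_iff]
        refine or_congr Iff.rfl (and_congr Iff.rfl ?_)
        constructor
        · rintro ⟨⟨h1, h2⟩, h3⟩
          exact ⟨⟨h1, h2⟩, by rwa [← h2]⟩
        · rintro ⟨⟨h1, h2⟩, h3⟩
          exact ⟨⟨h1, h2⟩, by rwa [h2]⟩
      rw [this]
      exact ((hX _ (· ∈ S)).inter (ih _ _ _)).union ((hX _ (· ∉ S)).inter
        (((h.measurable_walk _ _).inter (h.measurable_walk _ _)).inter (ih _ _ _)))

theorem measurableSet_path (h : IsLabelledWalk P β s U X) (k : ℕ) (x : ℕ → V) :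
    MeasurableSet {ω | ∀ i ≤ k, X i ω = x i} := by
  have : {ω | ∀ i ≤ k, X i ω = x i} = ⋂ i ∈ Set.Iic k, {ω | X i ω = x i} := by ext; simp
  rw [this]
  exact MeasurableSet.biInter (Set.to_countable _) fun i _ => h.measurable_walk _ _

/-- The Markov property. The induction splits according to the next vertex `w` and appends it to the
observed path, so it must run over all `k` and `x` at once; `walk_law` enters only when the list is
exhausted and nothing but a path event remains. -/
theorem measure_path_follows (h : IsLabelledWalk P β s U X) {B : Set (EdgeLabels V)}
    (hB : MeasurableSet B) (T : ℕ) (S : Finset V) (l : List (V × V)) (k : ℕ) (x : ℕ → V) :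
    P {ω | (fun e => U e ω) ∈ B ∧ (∀ i ≤ k, X i ω = x i) ∧ Follows T (fun j => X (k + j) ω) S l} =
      ∫⁻ ω in {ω | (fun e => U e ω) ∈ B},
        ENNReal.ofReal (walkPathProb (expConductance β fun e => U e ω) s k x *
          followProb (expConductance β fun e => U e ω) T S l (x k)) ∂P := by
  have hnil : ∀ (T : ℕ) (S : Finset V) (k : ℕ) (x : ℕ → V), P {ω | (fun e => U e ω) ∈ B ∧ (∀ i ≤ k, X i ω = x i) ∧
      Follows T (fun j => X (k + j) ω) S []} =
      ∫⁻ ω in {ω | (fun e => U e ω) ∈ B},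
        ENNReal.ofReal (walkPathProb (expConductance β fun e => U e ω) s k x *
          followProb (expConductance β fun e => U e ω) T S [] (x k)) ∂P := fun T S k x => by
    simp only [follows_nil, and_true, followProb_nil, mul_one]
    exact h.walk_law B hB k x
  induction T generalizing S l k x with
  | zero =>
    cases l with
    | nil => exact hnil 0 S k x
    | cons d l => simp [not_follows_zero_cons, followProb_zero_cons]
  | succ T ih =>
    cases l with
    | nil => exact hnil (T + 1) S k x
    | cons d l =>
      have hBm : MeasurableSet {ω | (fun e => U e ω) ∈ B} := h.measurable_labels hB
      have hset : {ω | (fun e => U e ω) ∈ B ∧ (∀ i ≤ k, X i ω = x i) ∧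
            Follows (T + 1) (fun j => X (k + j) ω) S (d :: l)} =
          ⋃ w ∈ (Finset.univ : Finset V), {ω | (fun e => U e ω) ∈ B ∧
            (∀ i ≤ k + 1, X i ω = Function.update x (k + 1) w i) ∧
            ((w ∈ S ∧ Follows T (fun j => X (k + 1 + j) ω) S (d :: l)) ∨
             (w ∉ S ∧ (x k, w) = d ∧
              Follows T (fun j => X (k + 1 + j) ω) (insert w S) l))} := by
        ext ω
        simp only [Follows, ← add_assoc, add_zero, Set.mem_ofPred_eq, Set.mem_iUnion,
          Finset.mem_univ, exists_const]
        constructor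
        · rintro ⟨h1, h2, h3⟩
          refine ⟨X (k + 1) ω, h1, fun i hi => ?_, by rwa [h2 k le_rfl] at h3⟩
          rcases Nat.le_succ_iff.1 hi with hi | rfl
          · rw [Function.update_of_ne (by omega), h2 i hi]
          · rw [Function.update_self]
        · rintro ⟨w, h1, h2, h3⟩
          have hw : X (k + 1) ω = w := by rw [h2 _ le_rfl, Function.update_self]
          have h2' : ∀ i ≤ k, X i ω = x i := fun i hi => by
            rw [h2 i (by omega), Function.update_of_ne (by omega)]
          exact ⟨h1, h2', by rwa [hw, h2' k le_rfl]⟩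
      have hmeas : ∀ w : V, MeasurableSet {ω | (fun e => U e ω) ∈ B ∧
            (∀ i ≤ k + 1, X i ω = Function.update x (k + 1) w i) ∧
            ((w ∈ S ∧ Follows T (fun j => X (k + 1 + j) ω) S (d :: l)) ∨
             (w ∉ S ∧ (x k, w) = d ∧
              Follows T (fun j => X (k + 1 + j) ω) (insert w S) l))} := fun w =>
        hBm.inter ((h.measurableSet_path _ _).inter
          (((MeasurableSet.const _).inter (h.measurableSet_follows _ _ _ _)).union
            ((MeasurableSet.const _).inter
              ((MeasurableSet.const _).inter (h.measurableSet_follows _ _ _ _)))))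
      rw [hset, measure_biUnion_finset _ fun w _ => hmeas w]
      · have hsum : ∀ ω, ENNReal.ofReal (walkPathProb (expConductance β fun e => U e ω) s k x *
            followProb (expConductance β fun e => U e ω) (T + 1) S (d :: l) (x k)) =
            ∑ w, ENNReal.ofReal (walkPathProb (expConductance β fun e => U e ω) s (k + 1)
              (Function.update x (k + 1) w) *
              (if w ∈ S then followProb (expConductance β fun e => U e ω) T S (d :: l) w
                else if (x k, w) = d then
                  followProb (expConductance β fun e => U e ω) T (insert w S) l w else 0)) := by
          intro ω
          have hc := expConductance_nonneg β fun e => U e ω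
          rw [← ENNReal.ofReal_sum_of_nonneg]
          · rw [followProb_succ_cons, Finset.mul_sum]
            simp only [walkPathProb_succ_update, mul_assoc]
          · intro w _
            refine mul_nonneg (walkPathProb_nonneg hc _ _ _) ?_
            split_ifs
            · exact followProb_nonneg hc _ _ _ _
            · exact followProb_nonneg hc _ _ _ _
            · exact le_rfl
        simp only [hsum]
        rw [lintegral_finsetSum']
        · refine Finset.sum_congr rfl fun w _ => ?_
          by_cases hw : w ∈ S
          · simpa [hw] using ih S (d :: l) (k + 1) (Function.update x (k + 1) w)
          · by_cases hd : (x k, w) = d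
            · simpa [hw, hd] using ih (insert w S) l (k + 1) (Function.update x (k + 1) w)
            · simp [hw, hd]
        · intro w _
          have hw := (measurable_walkPathProb β s (k + 1)
            (Function.update x (k + 1) w)).comp h.measurable_labels
          refine (ENNReal.measurable_ofReal.comp (hw.mul ?_)).aemeasurable
          split_ifs
          · exact (measurable_followProb _ _ _ _ _).comp h.measurable_labels
          · exact (measurable_followProb _ _ _ _ _).comp h.measurable_labels
          · exact measurable_const
      · intro w _ w' _ hww
        refine Set.disjoint_left.2 fun ω h1 h2 => hww ?_
        have e1 := h1.2.1 (k + 1) le_rfl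
        have e2 := h2.2.1 (k + 1) le_rfl
        rw [Function.update_self] at e1 e2
        rw [← e1, ← e2]

/-- The starting point is encoded in the law of paths of length zero, which gives no mass to a path
beginning at `v ≠ s`. -/
theorem ae_start (h : IsLabelledWalk P β s U X) : ∀ᵐ ω ∂P, X 0 ω = s := by
  rw [ae_iff]
  have : {ω | ¬ X 0 ω = s} = ⋃ v ∈ {v | v ≠ s}, {ω | (fun e => U e ω) ∈ Set.univ ∧
      ∀ i ≤ 0, X i ω = (fun _ => v) i} := by
    ext; simp
  rw [this, measure_biUnion_null_iff (Set.to_countable _)]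
  intro v hv
  have := h.walk_law Set.univ MeasurableSet.univ 0 (fun _ => v)
  rw [this]
  simp only [Set.mem_ofPred_eq] at hv
  simp [walkPathProb, hv]

theorem measure_follows_const (h : IsLabelledWalk P β s U X) {B : Set (EdgeLabels V)}
    (hB : MeasurableSet B) (T : ℕ) (S : Finset V) (l : List (V × V)) :
    P {ω | (fun e => U e ω) ∈ B ∧ Follows T (fun j => X j ω) S l} =
      ∫⁻ u in B, ENNReal.ofReal (followProb (expConductance β u) T S l s)
        ∂(P.map fun ω e => U e ω) := by
  have h1 := h.measure_path_follows hB T S l 0 (fun _ => s)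
  rw [setLIntegral_map hB (measurable_followProb β T S l s).ennreal_ofReal h.measurable_labels]
  have h2 : P {ω | (fun e => U e ω) ∈ B ∧ Follows T (fun j => X j ω) S l} =
      P {ω | (fun e => U e ω) ∈ B ∧ (∀ i ≤ 0, X i ω = (fun _ => s) i) ∧
        Follows T (fun j => X (0 + j) ω) S l} := by
    refine measure_congr ?_
    filter_upwards [h.ae_start] with ω hω
    apply propext
    change (_ ∧ _) ↔ (_ ∧ _ ∧ _)
    simp [hω]
  rw [h2, h1]
  simp [walkPathProb]
  rfl

/-- The probability that the walk follows a list of steps that is a function of the labels. -/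
theorem measure_follows (h : IsLabelledWalk P β s U X) {B : Set (EdgeLabels V)}
    (hB : MeasurableSet B) (T : ℕ) (S : Finset V) (l : EdgeLabels V → List (V × V))
    (hl : ∀ l₀, MeasurableSet {u | l u = l₀}) :
    P {ω | (fun e => U e ω) ∈ B ∧ Follows T (fun j => X j ω) S (l fun e => U e ω)} =
      ∫⁻ u in B, ENNReal.ofReal (followProb (expConductance β u) T S (l u) s)
        ∂(P.map fun ω e => U e ω) := by
  -- There are only countably many lists, so `B` splits into countably many pieces on which the list
  -- is constant.
  have hBl : ∀ l₀, MeasurableSet (B ∩ {u | l u = l₀}) := fun l₀ => hB.inter (hl l₀)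
  have hBu : B = ⋃ l₀, B ∩ {u | l u = l₀} := by ext; simp
  have hdis : Pairwise (Function.onFun Disjoint fun l₀ => B ∩ {u | l u = l₀}) := by
    intro l₁ l₂ hne
    refine Set.disjoint_left.2 fun u h1 h2 => hne ?_
    rw [← h1.2, ← h2.2]
  have hset : {ω | (fun e => U e ω) ∈ B ∧ Follows T (fun j => X j ω) S (l fun e => U e ω)} =
      ⋃ l₀, {ω | (fun e => U e ω) ∈ B ∩ {u | l u = l₀} ∧ Follows T (fun j => X j ω) S l₀} := by
    ext ω
    simp only [Set.mem_ofPred_eq, Set.mem_iUnion, Set.mem_inter_iff]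
    constructor
    · rintro ⟨h1, h2⟩; exact ⟨_, ⟨h1, rfl⟩, h2⟩
    · rintro ⟨_, ⟨h1, rfl⟩, h2⟩; exact ⟨h1, h2⟩
  rw [hset, measure_iUnion]
  · conv_rhs => rw [hBu]
    rw [lintegral_iUnion hBl hdis]
    refine tsum_congr fun l₀ => ?_
    rw [h.measure_follows_const (hBl l₀)]
    refine setLIntegral_congr_fun (hBl l₀) fun u hu => ?_
    rw [show l u = l₀ from hu.2]
  · intro l₁ l₂ hne
    refine Set.disjoint_left.2 fun u h1 h2 => hne ?_
    rw [← h1.1.2, ← h2.1.2]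
  · intro l₀
    have := h.measurableSet_follows T 0 S l₀
    simp only [zero_add] at this
    exact (h.measurable_labels (hBl l₀)).inter this

end IsLabelledWalk

/-! ### Comparison of two networks that differ in two boundary edges -/

/-- Only the step `a` may have more conductance in `c` than in `c'`. Hence the total conductance at
`z` grows by a factor of at most `1 + κ`, where `κ` is `θ` times the `c'`-probability of jumping
along `a`, and the change of normalization costs at most a factor `1 - κ`. -/
theorem transitionProb_comparison {c c' : V → V → ℝ} (hc' : ∀ a b, 0 ≤ c' a b) {a : V × V}
    {θ : ℝ} (hθ : 0 ≤ θ) {z : V} (hpos : 0 < ∑ w, c z w) (hpos' : 0 < ∑ w, c' z w)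
    (hle : ∀ w, c z w ≤ c' z w + if (z, w) = a then θ * c' z w else 0) {w : V} {K : ℝ}
    (hK : 0 ≤ K) (hw : K * c' z w ≤ c z w) :
    K * transitionProb c' z w * (1 - θ * ∑ v, if (z, v) = a then transitionProb c' z v else 0) ≤
      transitionProb c z w := by
  set κ := θ * ∑ v, if (z, v) = a then transitionProb c' z v else 0 with hκ
  have hκ0 : 0 ≤ κ := by
    refine mul_nonneg hθ (Finset.sum_nonneg fun v _ => ?_)
    split_ifs
    · exact transitionProb_nonneg hc' _ _
    · exact le_rfl
  have hπ : ∑ w, c z w ≤ (∑ w, c' z w) * (1 + κ) := by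
    calc ∑ w, c z w ≤ ∑ w, (c' z w + if (z, w) = a then θ * c' z w else 0) :=
          Finset.sum_le_sum fun w _ => hle w
      _ = (∑ w, c' z w) * (1 + κ) := by
          rw [Finset.sum_add_distrib, mul_add, mul_one, hκ, mul_left_comm, Finset.mul_sum,
            Finset.mul_sum]
          congr 1
          refine Finset.sum_congr rfl fun v _ => ?_
          split_ifs
          · unfold transitionProb
            field_simp
          · simp
  have h1 : 1 - κ ≤ (∑ w, c' z w) / ∑ w, c z w := by
    rw [le_div_iff₀ hpos]
    by_cases hκ1 : κ ≤ 1
    · calc (1 - κ) * ∑ w, c z w ≤ (1 - κ) * ((∑ w, c' z w) * (1 + κ)) :=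
            mul_le_mul_of_nonneg_left hπ (by linarith)
        _ = (∑ w, c' z w) * (1 - κ ^ 2) := by ring
        _ ≤ ∑ w, c' z w := mul_le_of_le_one_right hpos'.le (by nlinarith)
    · exact (mul_nonpos_of_nonpos_of_nonneg (by linarith) hpos.le).trans hpos'.le
  calc K * transitionProb c' z w * (1 - κ)
      ≤ K * transitionProb c' z w * ((∑ w, c' z w) / ∑ w, c z w) :=
        mul_le_mul_of_nonneg_left h1 (mul_nonneg hK (transitionProb_nonneg hc' _ _))
    _ = (K * c' z w) / ∑ w, c z w := by
        unfold transitionProb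
        field_simp
    _ ≤ transitionProb c z w := div_le_div_of_nonneg_right hw hpos.le

/-- If the networks `c` and `c'` have the same conductances on all edges at `S` but the boundary
edges `a` and `b`, then the probabilities of following a list that ends with `b` and stays in `S`
before are comparable. -/
theorem followProb_comparison {c c' : V → V → ℝ} (hc : ∀ a b, 0 ≤ c a b)
    (hc' : ∀ a b, 0 ≤ c' a b) {S : Finset V} {a b : V × V} (ha : a ∈ exitSteps S)
    (hb : b ∈ exitSteps S) {θ K : ℝ} (hθ : 0 ≤ θ) (hK : 0 ≤ K) (hK1 : K ≤ 1)
    (heq : ∀ z ∈ S, ∀ w, (z, w) ≠ a → (z, w) ≠ b → c z w = c' z w)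
    (hca : c a.1 a.2 ≤ (1 + θ) * c' a.1 a.2) (hcb : c b.1 b.2 ≤ c' b.1 b.2)
    (hcb' : K * c' b.1 b.2 ≤ c b.1 b.2) (hpos : ∀ z ∈ S, 0 < ∑ w, c z w)
    (hpos' : ∀ z ∈ S, 0 < ∑ w, c' z w) (T : ℕ) {R : Finset V} (hR : R ⊆ S) {l : List (V × V)}
    (hl : ∀ d ∈ l, d.2 ∈ S) {z : V} (hz : z ∈ S) :
    K * followProb c' T R (l ++ [b]) z - θ * followProb c' T S [a] z ≤
      followProb c T R (l ++ [b]) z := by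
  induction T generalizing R l z with
  | zero =>
    have h1 : followProb c' 0 R (l ++ [b]) z = 0 := by
      cases l <;> exact followProb_zero_cons _ _ _ _ _
    rw [h1, followProb_zero_cons]
    simpa using followProb_nonneg hc _ _ _ _
  | succ T ih =>
    set κ := θ * ∑ v, if (z, v) = a then transitionProb c' z v else 0 with hκ
    have hκ0 : 0 ≤ κ := by
      refine mul_nonneg hθ (Finset.sum_nonneg fun v _ => ?_)
      split_ifs
      · exact transitionProb_nonneg hc' _ _
      · exact le_rfl
    have haz : ∀ w ∈ S, (z, w) ≠ a := by
      rintro w hw rfl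
      exact (mem_exitSteps.1 ha).2 hw
    have hbz : ∀ w ∈ S, (z, w) ≠ b := by
      rintro w hw rfl
      exact (mem_exitSteps.1 hb).2 hw
    have hle : ∀ w, c z w ≤ c' z w + if (z, w) = a then θ * c' z w else 0 := by
      intro w
      split_ifs with h
      · subst h; linarith
      · by_cases h' : (z, w) = b
        · subst h'; simpa using hcb
        · rw [heq z hz w h h']; simp
    -- The one-step losses `κ` are `θ` times the chance of leaving through `a` now. Accumulated
    -- along the walk they add up to `θ` times the probability that the first exit from `S` is `a`,
    -- so the error does not grow with `T`.
    have hexit : followProb c' (T + 1) S [a] z =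
        (∑ w, transitionProb c' z w * if w ∈ S then followProb c' T S [a] w else 0) +
          ∑ v, if (z, v) = a then transitionProb c' z v else 0 := by
      rw [followProb_succ_cons, ← Finset.sum_add_distrib]
      refine Finset.sum_congr rfl fun w _ => ?_
      by_cases hw : w ∈ S
      · simp [hw, haz w hw]
      · by_cases hwa : (z, w) = a <;> simp [hw, hwa, followProb_nil]
    obtain ⟨d, l', hdl⟩ : ∃ d l', l ++ [b] = d :: l' := by cases l <;> simp
    -- The loss `κ * transitionProb c' z w` is subtracted for every `w`, also where the walk has
    -- left the prescribed course; since the transition probabilities sum to `1`, the total is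
    -- exactly `κ`.
    have key : ∀ w, transitionProb c' z w * (K * (if w ∈ R then followProb c' T R (l ++ [b]) w
        else if (z, w) = d then followProb c' T (insert w R) l' w else 0)
        - θ * (if w ∈ S then followProb c' T S [a] w else 0)) - κ * transitionProb c' z w ≤
        transitionProb c z w * (if w ∈ R then followProb c T R (l ++ [b]) w
        else if (z, w) = d then followProb c T (insert w R) l' w else 0) := by
      intro w
      have hp' := transitionProb_nonneg hc' z w
      have hstep : ∀ {A B : ℝ}, w ∈ S → 0 ≤ A → A ≤ 1 →
          K * B - θ * followProb c' T S [a] w ≤ A →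
          transitionProb c' z w * (K * B - θ * followProb c' T S [a] w)
            - κ * transitionProb c' z w ≤ transitionProb c z w * A := by
        intro A B hw hA hA1 hBA
        have h1 := transitionProb_comparison (w := w) hc' hθ (hpos z hz) (hpos' z hz) hle
          zero_le_one (by rw [one_mul, heq z hz w (haz w hw) (hbz w hw)])
        rw [← hκ, one_mul] at h1
        calc _ ≤ transitionProb c' z w * A - κ * transitionProb c' z w * A := by
              have := mul_le_mul_of_nonneg_left hBA hp'
              have := mul_le_of_le_one_right (mul_nonneg hκ0 hp') hA1
              linarith
          _ = transitionProb c' z w * (1 - κ) * A := by ring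
          _ ≤ _ := mul_le_mul_of_nonneg_right h1 hA
      by_cases hwR : w ∈ R
      · simp only [hwR, hR hwR, if_true]
        exact hstep (hR hwR) (followProb_nonneg hc _ _ _ _) (followProb_le_one hc _ _ _ _)
          (ih hR hl (hR hwR))
      · simp only [hwR, if_false]
        by_cases hwd : (z, w) = d
        · simp only [hwd, if_true]
          cases l with
          | nil =>
            obtain ⟨rfl, rfl⟩ : b = d ∧ [] = l' := by simpa using hdl
            subst hwd
            -- The factor `K` is spent here, at the final step `b`; all steps before stay inside
            -- `S`, where the conductances coincide.
            have hwS : w ∉ S := (mem_exitSteps.1 hb).2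
            have h1 := transitionProb_comparison (w := w) hc' hθ (hpos z hz) (hpos' z hz) hle
              hK hcb'
            rw [← hκ] at h1
            simp only [hwS, if_false, followProb_nil]
            have := mul_le_of_le_one_left (mul_nonneg hκ0 hp') hK1
            linarith
          | cons d' l'' =>
            obtain ⟨rfl, rfl⟩ : d' = d ∧ l'' ++ [b] = l' := by simpa using hdl
            have hwS : w ∈ S := by
              have := hl d' List.mem_cons_self
              rwa [← hwd] at this
            simp only [hwS, if_true]
            exact hstep hwS (followProb_nonneg hc _ _ _ _) (followProb_le_one hc _ _ _ _)
              (ih (Finset.insert_subset hwS hR) (fun e he => hl e (List.mem_cons_of_mem _ he)) hwS)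
        · simp only [hwd, if_false, mul_zero, zero_sub]
          have h2 : 0 ≤ θ * (if w ∈ S then followProb c' T S [a] w else 0) := by
            refine mul_nonneg hθ ?_
            split_ifs
            · exact followProb_nonneg hc' _ _ _ _
            · exact le_rfl
          have h3 := mul_nonneg hp' h2
          have h4 := mul_nonneg hκ0 hp'
          linarith
    have hsum := Finset.sum_le_sum fun w (_ : w ∈ Finset.univ) => key w
    rw [hexit]
    rw [hdl] at hsum ⊢
    rw [followProb_succ_cons, followProb_succ_cons]
    refine le_trans ?_ hsum
    rw [Finset.sum_sub_distrib, ← Finset.mul_sum, sum_transitionProb (hpos' z hz), mul_one, hκ]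
    simp only [mul_sub, Finset.sum_sub_distrib, mul_add]
    have e1 : ∀ f : V → ℝ, ∑ w, transitionProb c' z w * (K * f w) =
        K * ∑ w, transitionProb c' z w * f w := fun f => by
      rw [Finset.mul_sum]; exact Finset.sum_congr rfl fun w _ => by ring
    have e2 : ∀ f : V → ℝ, ∑ w, transitionProb c' z w * (θ * f w) =
        θ * ∑ w, transitionProb c' z w * f w := fun f => by
      rw [Finset.mul_sum]; exact Finset.sum_congr rfl fun w _ => by ring
    rw [e1, e2]
    linarith

theorem followProb_comparison_le {c c' : V → V → ℝ} (hc : ∀ a b, 0 ≤ c a b)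
    (hc' : ∀ a b, 0 ≤ c' a b) {S : Finset V} {a b : V × V} (ha : a ∈ exitSteps S)
    (hb : b ∈ exitSteps S) {θ K : ℝ} (hθ : 0 ≤ θ) (hK : 0 ≤ K) (hK1 : K ≤ 1)
    (heq : ∀ z ∈ S, ∀ w, (z, w) ≠ a → (z, w) ≠ b → c z w = c' z w)
    (hca : c a.1 a.2 ≤ (1 + θ) * c' a.1 a.2) (hcb : c b.1 b.2 ≤ c' b.1 b.2)
    (hcb' : K * c' b.1 b.2 ≤ c b.1 b.2) (hpos : ∀ z ∈ S, 0 < ∑ w, c z w)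
    (hpos' : ∀ z ∈ S, 0 < ∑ w, c' z w) (T : ℕ) {R : Finset V} (hR : R ⊆ S) {l : List (V × V)}
    (hl : ∀ d ∈ l, d.2 ∈ S) {z : V} (hz : z ∈ S) :
    K * followProb c' T R (l ++ [b]) z ≤ followProb c T R (l ++ [b]) z + θ := by
  have h1 := followProb_comparison hc hc' ha hb hθ hK hK1 heq hca hcb hcb' hpos hpos' T hR hl hz
  have h2 := mul_le_of_le_one_right hθ (followProb_le_one hc' T S [a] z)
  linarith

/-! ### The probability of eventually following a list -/

/-- The probability that the walk on the network `c`, started at `z`, eventually follows `l`. -/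
def eventualProb (c : V → V → ℝ) (S : Finset V) (l : List (V × V)) (z : V) : ℝ :=
  ⨆ T, followProb c T S l z

theorem bddAbove_followProb {c : V → V → ℝ} (hc : ∀ a b, 0 ≤ c a b) (S : Finset V)
    (l : List (V × V)) (z : V) : BddAbove (Set.range fun T => followProb c T S l z) :=
  ⟨1, by rintro _ ⟨T, rfl⟩; exact followProb_le_one hc T S l z⟩

theorem tendsto_followProb {c : V → V → ℝ} (hc : ∀ a b, 0 ≤ c a b) (S : Finset V)
    (l : List (V × V)) (z : V) :
    Tendsto (fun T => followProb c T S l z) atTop (nhds (eventualProb c S l z)) :=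
  tendsto_atTop_ciSup (monotone_followProb hc S l z) (bddAbove_followProb hc S l z)

theorem eventualProb_nil (c : V → V → ℝ) (S : Finset V) (z : V) : eventualProb c S [] z = 1 := by
  simp [eventualProb, followProb_nil]

theorem eventualProb_nonneg {c : V → V → ℝ} (hc : ∀ a b, 0 ≤ c a b) (S : Finset V)
    (l : List (V × V)) (z : V) : 0 ≤ eventualProb c S l z :=
  Real.iSup_nonneg fun T => followProb_nonneg hc T S l z

theorem eventualProb_le_one {c : V → V → ℝ} (hc : ∀ a b, 0 ≤ c a b) (S : Finset V)
    (l : List (V × V)) (z : V) : eventualProb c S l z ≤ 1 :=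
  ciSup_le fun T => followProb_le_one hc T S l z

theorem eventualProb_cons {c : V → V → ℝ} (hc : ∀ a b, 0 ≤ c a b) (S : Finset V) (d : V × V)
    (l : List (V × V)) (z : V) :
    eventualProb c S (d :: l) z = ∑ w, transitionProb c z w *
      (if w ∈ S then eventualProb c S (d :: l) w
        else if (z, w) = d then eventualProb c (insert w S) l w else 0) := by
  have h1 : Tendsto (fun T => followProb c (T + 1) S (d :: l) z) atTop
      (nhds (eventualProb c S (d :: l) z)) :=
    (tendsto_followProb hc S (d :: l) z).comp (tendsto_add_atTop_nat 1)
  refine tendsto_nhds_unique h1 ?_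
  simp only [followProb_succ_cons]
  refine tendsto_finsetSum _ fun w _ => Tendsto.const_mul _ ?_
  split_ifs
  · exact tendsto_followProb hc _ _ _
  · exact tendsto_followProb hc _ _ _
  · exact tendsto_const_nhds

/-! ### The energy estimate -/

/-- Summation by parts: the Dirichlet energy of `h` is `2 ∑ h r` over `S`, because `h` vanishes
elsewhere, and hence at most `2 ∑ |r|`. A pair `z ≠ w` occurs in the energy in both orders, which
cancels the factor `2`. -/
theorem conductance_mul_sq_sub_le {c : V → V → ℝ} (hc : ∀ a b, 0 ≤ c a b)
    (hsymm : ∀ a b, c a b = c b a) {S : Finset V} {h r : V → ℝ} (hout : ∀ z ∉ S, h z = 0)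
    (hr : ∀ z ∈ S, h z * r z ≤ |r z|)
    (heq : ∀ z ∈ S, (∑ w, c z w) * h z = ∑ w, c z w * h w + r z) (z w : V) :
    c z w * (h z - h w) ^ 2 ≤ ∑ v ∈ S, |r v| := by
  have hE : ∑ x, ∑ y, c x y * (h x - h y) ^ 2 ≤ 2 * ∑ v ∈ S, |r v| := by
    have e1 : ∑ x, ∑ y, c x y * (h x - h y) ^ 2 =
        2 * ∑ x, h x * ((∑ y, c x y) * h x - ∑ y, c x y * h y) := by
      have e2 : ∑ x, ∑ y, c x y * h y ^ 2 = ∑ x, ∑ y, c x y * h x ^ 2 := by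
        rw [Finset.sum_comm]
        simp only [hsymm]
      calc ∑ x, ∑ y, c x y * (h x - h y) ^ 2
          = ∑ x, ∑ y, c x y * h x ^ 2 + ∑ x, ∑ y, c x y * h y ^ 2 -
              2 * ∑ x, ∑ y, c x y * (h x * h y) := by
            rw [Finset.mul_sum, ← Finset.sum_add_distrib, ← Finset.sum_sub_distrib]
            refine Finset.sum_congr rfl fun x _ => ?_
            rw [Finset.mul_sum, ← Finset.sum_add_distrib, ← Finset.sum_sub_distrib]
            exact Finset.sum_congr rfl fun y _ => by ring
        _ = _ := by
            rw [e2, ← two_mul, ← mul_sub, ← Finset.sum_sub_distrib]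
            congr 1
            refine Finset.sum_congr rfl fun x _ => ?_
            rw [mul_sub, Finset.sum_mul, Finset.mul_sum, Finset.mul_sum]
            congr 1 <;> exact Finset.sum_congr rfl fun y _ => by ring
    rw [e1]
    refine mul_le_mul_of_nonneg_left ?_ zero_le_two
    rw [← Finset.sum_subset (Finset.subset_univ S) (fun x _ hx => by simp [hout x hx])]
    refine Finset.sum_le_sum fun x hx => ?_
    rw [heq x hx, add_sub_cancel_left]
    exact hr x hx
  have hnn : ∀ x y, 0 ≤ c x y * (h x - h y) ^ 2 := fun x y => mul_nonneg (hc _ _) (sq_nonneg _)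
  by_cases hzw : z = w
  · subst hzw
    simpa using Finset.sum_nonneg fun v (_ : v ∈ S) => abs_nonneg (r v)
  · have h2 : ∑ y, c z y * (h z - h y) ^ 2 + ∑ y, c w y * (h w - h y) ^ 2 ≤
        ∑ x, ∑ y, c x y * (h x - h y) ^ 2 :=
      Finset.add_le_sum (f := fun x => ∑ y, c x y * (h x - h y) ^ 2)
        (fun x _ => Finset.sum_nonneg fun y _ => hnn x y)
        (Finset.mem_univ z) (Finset.mem_univ w) hzw
    have h3 := Finset.single_le_sum (f := fun y => c z y * (h z - h y) ^ 2)
      (fun y _ => hnn z y) (Finset.mem_univ w)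
    have h4 := Finset.single_le_sum (f := fun y => c w y * (h w - h y) ^ 2)
      (fun y _ => hnn w y) (Finset.mem_univ z)
    have h5 : c w z * (h w - h z) ^ 2 = c z w * (h z - h w) ^ 2 := by rw [hsymm]; ring
    rw [h5] at h4
    linarith

theorem abs_sub_le_of_walk {G : SimpleGraph V} {h : V → ℝ} {M : ℝ}
    (hM : ∀ a b, G.Adj a b → |h a - h b| ≤ M) {x y : V} (p : G.Walk x y) :
    |h x - h y| ≤ p.length * M := by
  induction p with
  | nil => simp
  | cons hadj p ih =>
    rw [SimpleGraph.Walk.length_cons]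
    push_cast
    calc _ ≤ |h _ - h _| + |h _ - h _| := abs_sub_le _ _ _
      _ ≤ M + p.length * M := add_le_add (hM _ _ hadj) ih
      _ = _ := by ring

theorem abs_sub_le_of_reachable {G : SimpleGraph V} {h : V → ℝ} {M : ℝ} (hM0 : 0 ≤ M)
    (hM : ∀ a b, G.Adj a b → |h a - h b| ≤ M) {x y : V} (hxy : G.Reachable x y) :
    |h x - h y| ≤ Fintype.card V * M := by
  obtain ⟨p, hp⟩ := hxy.exists_isPath
  refine (abs_sub_le_of_walk hM p).trans (mul_le_mul_of_nonneg_right ?_ hM0)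
  exact_mod_cast hp.length_lt.le

/-- If `v` is connected to the endpoint of `d` by edges of conductance at least `c₀`, then the walk
started at `v` leaves `S` through `d` up to an error controlled by the conductance of the other
boundary edges. -/
theorem eventualProb_cons_ge {c : V → V → ℝ} (hc : ∀ a b, 0 ≤ c a b)
    (hsymm : ∀ a b, c a b = c b a) (hpos : ∀ z, 0 < ∑ w, c z w) {S : Finset V} {d : V × V}
    (hd : d ∈ exitSteps S) (l : List (V × V)) {G : SimpleGraph V} {c₀ : ℝ} (hc₀ : 0 < c₀)
    (hG : ∀ a b, G.Adj a b → c₀ ≤ c a b) {v : V} (hv : v ∈ S) (hvd : G.Reachable v d.2) :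
    eventualProb c (insert d.2 S) l d.2 - Fintype.card V *
      √((∑ e ∈ exitSteps S \ {d}, c e.1 e.2) / c₀) ≤ eventualProb c S (d :: l) v := by
  obtain ⟨hd1, hd2⟩ := mem_exitSteps.1 hd
  set a := eventualProb c (insert d.2 S) l d.2 with ha
  have ha0 : 0 ≤ a := eventualProb_nonneg hc _ _ _
  have ha1 : a ≤ 1 := eventualProb_le_one hc _ _ _
  set F := eventualProb c S (d :: l) with hF
  set bad : V → ℝ := fun z => ∑ w, if w ∉ S ∧ (z, w) ≠ d then c z w else 0 with hbad
  have hbad0 : ∀ z, 0 ≤ bad z := fun z => Finset.sum_nonneg fun w _ => by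
    split_ifs
    · exact hc _ _
    · exact le_rfl
  -- `h` is the deficit compared with a walk that certainly leaves through `d`. Leaving through `d`
  -- brings the deficit to `0`, leaving through any other boundary edge brings it to `a`; with the
  -- value `0` outside of `S`, the latter appears as the residual `a * bad z`.
  set h : V → ℝ := fun z => if z ∈ S then a - F z else 0 with hh
  have habs : ∀ z, |h z| ≤ 1 := by
    intro z
    have h0 : 0 ≤ F z := eventualProb_nonneg hc _ _ _
    have h1 : F z ≤ 1 := eventualProb_le_one hc _ _ _
    simp only [hh]
    split_ifs
    · rw [abs_le]; constructor <;> linarith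
    · simp
  have heq : ∀ z ∈ S, (∑ w, c z w) * h z = ∑ w, c z w * h w + a * bad z := by
    intro z hz
    have h1 : (∑ w, c z w) * F z = ∑ w, c z w *
        (if w ∈ S then F w else if (z, w) = d then a else 0) := by
      rw [hF, eventualProb_cons hc, Finset.mul_sum]
      refine Finset.sum_congr rfl fun w _ => ?_
      rw [← mul_assoc]
      congr 1
      · unfold transitionProb
        rw [mul_div_cancel₀ _ (hpos z).ne']
      · split_ifs with h1 h2
        · rfl
        · rw [ha, ← h2]
        · rfl
    simp only [hh, hz, if_true]
    rw [mul_sub, h1, hbad, Finset.mul_sum, Finset.sum_mul, ← Finset.sum_sub_distrib,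
      ← Finset.sum_add_distrib]
    refine Finset.sum_congr rfl fun w _ => ?_
    by_cases hw : w ∈ S
    · simp [hw, mul_sub]
    · by_cases hwd : (z, w) = d
      · simp [hw, hwd]
      · simp [hw, hwd, mul_comm]
  have hE := fun z w => conductance_mul_sq_sub_le hc hsymm (S := S) (h := h)
    (r := fun z => a * bad z) (fun z hz => by simp [hh, hz]) (fun z _ => by
      have := (le_abs_self (h z * (a * bad z)))
      rw [abs_mul] at this
      exact this.trans (mul_le_of_le_one_left (abs_nonneg _) (habs z))) heq z w
  have hsum : ∑ v ∈ S, |a * bad v| ≤ ∑ e ∈ exitSteps S \ {d}, c e.1 e.2 := by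
    calc ∑ v ∈ S, |a * bad v| ≤ ∑ v ∈ S, bad v := by
          refine Finset.sum_le_sum fun z _ => ?_
          rw [abs_of_nonneg (mul_nonneg ha0 (hbad0 z))]
          exact mul_le_of_le_one_left (hbad0 z) ha1
      _ = ∑ e ∈ exitSteps S \ {d}, c e.1 e.2 := by
          have : exitSteps S \ {d} = (S ×ˢ Finset.univ).filter
              fun e : V × V => e.2 ∉ S ∧ (e.1, e.2) ≠ d := by
            ext e
            simp [mem_exitSteps]
            tauto
          rw [this, Finset.sum_filter, Finset.sum_product]
  set B := ∑ e ∈ exitSteps S \ {d}, c e.1 e.2 with hB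
  have hadj : ∀ x y, G.Adj x y → |h x - h y| ≤ √(B / c₀) := by
    intro x y hxy
    refine Real.abs_le_sqrt ?_
    rw [le_div_iff₀ hc₀]
    calc (h x - h y) ^ 2 * c₀ ≤ (h x - h y) ^ 2 * c x y :=
          mul_le_mul_of_nonneg_left (hG _ _ hxy) (sq_nonneg _)
      _ = c x y * (h x - h y) ^ 2 := mul_comm _ _
      _ ≤ B := (hE x y).trans hsum
  -- Telescope from `v` to `d.2`, where the deficit is `0`. The path may leave `S` on the way, which
  -- is harmless as the edge bound holds for all pairs of vertices.
  have hfin := abs_sub_le_of_reachable (Real.sqrt_nonneg _) hadj hvd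
  have e1 : h v = a - F v := by simp [hh, hv]
  have e2 : h d.2 = 0 := by simp [hh, hd2]
  rw [e1, e2, sub_zero] at hfin
  have := (abs_le.1 hfin).2
  linarith

/-! ### Prim's invasion -/

theorem mem_exitSteps_of_minExit {u : EdgeLabels V} {S : Finset V} {d : V × V}
    (h : minExit u S = some d) : d ∈ exitSteps S := by
  classical
  unfold minExit at h
  split_ifs at h with h'
  rw [← Option.some.inj h]
  exact (Finset.exists_min_image (exitSteps S) (fun e => pairLabel u e.1 e.2) h').choose_spec.1

theorem minExit_le {u : EdgeLabels V} {S : Finset V} {d e : V × V}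
    (h : minExit u S = some d) (he : e ∈ exitSteps S) :
    pairLabel u d.1 d.2 ≤ pairLabel u e.1 e.2 := by
  classical
  unfold minExit at h
  split_ifs at h with h'
  rw [← Option.some.inj h]
  exact (Finset.exists_min_image (exitSteps S)
    (fun e => pairLabel u e.1 e.2) h').choose_spec.2 e he

theorem exists_minExit {u : EdgeLabels V} {S : Finset V} (h : (exitSteps S).Nonempty) :
    ∃ d, minExit u S = some d := by
  classical
  unfold minExit
  rw [dif_pos h]
  exact ⟨_, rfl⟩

theorem exitSteps_nonempty {S : Finset V} (h : S.Nonempty) (h' : S ≠ Finset.univ) :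
    (exitSteps S).Nonempty := by
  obtain ⟨x, hx⟩ := h
  obtain ⟨y, hy⟩ : ∃ y, y ∉ S := by
    by_contra hc
    push Not at hc
    exact h' (Finset.eq_univ_iff_forall.2 hc)
  exact ⟨(x, y), mem_exitSteps.2 ⟨hx, hy⟩⟩

/-- The step chosen by Prim's invasion depends only on the set of minimizers. -/
theorem minExit_congr {u u' : EdgeLabels V} {S : Finset V}
    (h : ∀ d ∈ exitSteps S, (∀ e ∈ exitSteps S, pairLabel u d.1 d.2 ≤ pairLabel u e.1 e.2) ↔
      ∀ e ∈ exitSteps S, pairLabel u' d.1 d.2 ≤ pairLabel u' e.1 e.2) :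
    minExit u S = minExit u' S := by
  classical
  -- Ties are broken by choice, which sees nothing but the predicate.
  have choose_congr : ∀ {p q : V × V → Prop} (hp : ∃ d, p d) (hq : ∃ d, q d), p = q →
      hp.choose = hq.choose := by
    rintro p q hp hq rfl
    rfl
  unfold minExit
  split_ifs with hS
  · congr 1
    refine choose_congr _ _ ?_
    funext d
    exact propext (and_congr_right fun hd => h d hd)
  · rfl

/-- The first `m` steps of Prim's invasion started from the set `S`. -/
def primList (u : EdgeLabels V) : Finset V → ℕ → List (V × V)
  | _, 0 => []
  | S, m + 1 =>
    match minExit u S with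
    | some d => d :: primList u (insert d.2 S) m
    | none => []

theorem primList_succ {u : EdgeLabels V} {S : Finset V} {d : V × V} (h : minExit u S = some d)
    (m : ℕ) : primList u S (m + 1) = d :: primList u (insert d.2 S) m := by
  simp [primList, h]

theorem primVertices_succ {u : EdgeLabels V} {s : V} {k : ℕ} {d : V × V}
    (h : minExit u (primVertices s u k) = some d) :
    primVertices s u (k + 1) = insert d.2 (primVertices s u k) := by
  simp [primVertices, h, addEndpoint]

theorem start_mem_primVertices (u : EdgeLabels V) (s : V) (k : ℕ) : s ∈ primVertices s u k := by
  induction k with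
  | zero => simp [primVertices]
  | succ k ih =>
    cases h : minExit u (primVertices s u k) with
    | none => simpa [primVertices, h, addEndpoint] using ih
    | some d => rw [primVertices_succ h]; exact Finset.mem_insert_of_mem ih

theorem card_primVertices (u : EdgeLabels V) (s : V) {k : ℕ} (hk : k < Fintype.card V) :
    (primVertices s u k).card = k + 1 := by
  induction k with
  | zero => simp [primVertices]
  | succ k ih =>
    have ih := ih (by omega)
    obtain ⟨d, hd⟩ := exists_minExit (u := u) (exitSteps_nonempty (S := primVertices s u k)
      ⟨s, start_mem_primVertices u s k⟩ (by
        intro h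
        rw [h, Finset.card_univ] at ih
        omega))
    rw [primVertices_succ hd, Finset.card_insert_of_notMem
      (mem_exitSteps.1 (mem_exitSteps_of_minExit hd)).2, ih]

theorem exists_minExit_primVertices (u : EdgeLabels V) (s : V) {k : ℕ}
    (hk : k + 1 < Fintype.card V) : ∃ d, minExit u (primVertices s u k) = some d := by
  refine exists_minExit (exitSteps_nonempty ⟨s, start_mem_primVertices u s k⟩ fun h => ?_)
  have := card_primVertices u s (k := k) (by omega)
  rw [h, Finset.card_univ] at this
  omega

theorem pairLabel_symm (u : EdgeLabels V) (a b : V) : pairLabel u a b = pairLabel u b a := by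
  unfold pairLabel
  by_cases h : a = b
  · subst h; rfl
  · rw [dif_pos h, dif_pos (Ne.symm h)]
    congr 2
    exact Sym2.eq_swap

theorem expConductance_symm (β : ℝ) (u : EdgeLabels V) (a b : V) :
    expConductance β u a b = expConductance β u b a := by
  unfold expConductance
  by_cases h : a = b
  · subst h; rfl
  · rw [if_neg h, if_neg (Ne.symm h), pairLabel_symm]

theorem sum_expConductance_pos (hV : 2 ≤ Fintype.card V) (β : ℝ) (u : EdgeLabels V) (z : V) :
    0 < ∑ w, expConductance β u z w := by
  obtain ⟨w, hw⟩ : ∃ w, w ≠ z := Fintype.exists_ne_of_one_lt_card (by omega) z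
  refine Finset.sum_pos' (fun w _ => expConductance_nonneg β u z w) ⟨w, Finset.mem_univ _, ?_⟩
  unfold expConductance
  rw [if_neg (Ne.symm hw)]
  exact Real.exp_pos _

/-! ### Low-label paths from Prim's newest vertex and the probability of following Prim -/

/-- The graph of the edges whose label satisfies `p`. -/
def labelGraph (u : EdgeLabels V) (p : ℝ → Prop) : SimpleGraph V where
  Adj a b := a ≠ b ∧ p (pairLabel u a b)
  symm := ⟨fun a b h => ⟨h.1.symm, by rw [pairLabel_symm]; exact h.2⟩⟩
  loopless := ⟨fun a h => h.1 rfl⟩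

theorem labelGraph_mono {u : EdgeLabels V} {p q : ℝ → Prop} (h : ∀ t, p t → q t) :
    labelGraph u p ≤ labelGraph u q := fun _ _ hab => ⟨hab.1, h _ hab.2⟩

/-- The vertex added last is connected to the far end of each boundary edge by edges whose labels
do not exceed the label of this boundary edge. -/
def WellConnected (u : EdgeLabels V) (S : Finset V) (v : V) : Prop :=
  v ∈ S ∧ ∀ e ∈ exitSteps S, (labelGraph u (· ≤ pairLabel u e.1 e.2)).Reachable v e.2

theorem labelGraph_adj_of_exit {u : EdgeLabels V} {S : Finset V} {e : V × V}
    (he : e ∈ exitSteps S) : (labelGraph u (· ≤ pairLabel u e.1 e.2)).Adj e.1 e.2 := by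
  refine ⟨?_, le_rfl⟩
  rintro h
  exact (mem_exitSteps.1 he).2 (h ▸ (mem_exitSteps.1 he).1)

theorem wellConnected_singleton (u : EdgeLabels V) (s : V) : WellConnected u {s} s := by
  refine ⟨Finset.mem_singleton_self s, fun e he => ?_⟩
  have h1 : e.1 = s := by simpa using (mem_exitSteps.1 he).1
  have := (labelGraph_adj_of_exit (u := u) he).reachable
  rwa [h1] at this ⊢

/-- For an old boundary edge `e`, go from `d.2` back to the previous vertex `v` and from there to
`e.2`: the first piece has labels at most that of `d`, hence at most that of `e` by minimality. An
edge starting at `d.2` is itself the path. -/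
theorem WellConnected.insert {u : EdgeLabels V} {S : Finset V} {v : V} {d : V × V}
    (h : WellConnected u S v) (hd : minExit u S = some d) :
    WellConnected u (insert d.2 S) d.2 := by
  refine ⟨Finset.mem_insert_self _ _, fun e he => ?_⟩
  obtain ⟨he1, he2⟩ := mem_exitSteps.1 he
  rcases Finset.mem_insert.1 he1 with h1 | h1
  · rw [← h1]
    exact (labelGraph_adj_of_exit he).reachable
  · have he' : e ∈ exitSteps S :=
      mem_exitSteps.2 ⟨h1, fun h' => he2 (Finset.mem_insert_of_mem h')⟩
    have hle := minExit_le hd he'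
    have r1 := (h.2 d (mem_exitSteps_of_minExit hd)).mono
      (labelGraph_mono fun t (ht : t ≤ _) => ht.trans hle)
    exact r1.symm.trans (h.2 e he')

theorem exp_le_expConductance {β : ℝ} (hβ : 0 ≤ β) {u : EdgeLabels V} {t : ℝ} {a b : V}
    (h : (labelGraph u (· ≤ t)).Adj a b) : Real.exp (-β * t) ≤ expConductance β u a b := by
  unfold expConductance
  rw [if_neg h.1]
  refine Real.exp_le_exp.2 ?_
  have := mul_le_mul_of_nonneg_left h.2 hβ
  linarith

/-- There are at most `n²` other boundary steps, each with conductance at most `e^{-βδ}` times that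
of `d`. -/
theorem sqrt_exit_ratio_le {β δ : ℝ} (hβ : 0 ≤ β) {u : EdgeLabels V} {S : Finset V} {d : V × V}
    (hgap : ∀ e ∈ exitSteps S, e ≠ d → pairLabel u d.1 d.2 + δ ≤ pairLabel u e.1 e.2) :
    √((∑ e ∈ exitSteps S \ {d}, expConductance β u e.1 e.2) / Real.exp (-β * pairLabel u d.1 d.2))
      ≤ Fintype.card V * Real.exp (-β * δ / 2) := by
  rw [Real.sqrt_le_left (by positivity), div_le_iff₀ (Real.exp_pos _)]
  calc ∑ e ∈ exitSteps S \ {d}, expConductance β u e.1 e.2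
      ≤ ∑ _e ∈ exitSteps S \ {d}, Real.exp (-β * (pairLabel u d.1 d.2 + δ)) := by
        refine Finset.sum_le_sum fun e he => ?_
        rw [Finset.mem_sdiff, Finset.mem_singleton] at he
        have hg := mul_le_mul_of_nonneg_left (hgap e he.1 he.2) hβ
        unfold expConductance
        split_ifs
        · exact (Real.exp_pos _).le
        · exact Real.exp_le_exp.2 (by linarith)
    _ ≤ (Fintype.card V * Fintype.card V : ℝ) * Real.exp (-β * (pairLabel u d.1 d.2 + δ)) := by
        rw [Finset.sum_const, nsmul_eq_mul]
        refine mul_le_mul_of_nonneg_right ?_ (Real.exp_pos _).le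
        have := Finset.card_le_univ (exitSteps S \ {d})
        rw [Fintype.card_prod] at this
        exact_mod_cast this
    _ = _ := by
        rw [mul_pow, ← Real.exp_nat_mul, mul_assoc (_ ^ 2), ← Real.exp_add, sq]
        congr 2
        push_cast
        ring

/-- If at each step of Prim's invasion the minimal label is smaller by `δ` than all other boundary
labels, then the walk follows Prim's invasion with high probability. -/
theorem eventualProb_primList_ge (hV : 2 ≤ Fintype.card V) {β δ : ℝ} (hβ : 0 ≤ β)
    {u : EdgeLabels V} {s : V}
    (hgap : ∀ k d, k + 1 < Fintype.card V → minExit u (primVertices s u k) = some d →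
      ∀ e ∈ exitSteps (primVertices s u k), e ≠ d →
        pairLabel u d.1 d.2 + δ ≤ pairLabel u e.1 e.2) (m k : ℕ)
    (hkm : k + m < Fintype.card V) {v : V} (hv : WellConnected u (primVertices s u k) v) :
    1 - m * (Fintype.card V ^ 2 * Real.exp (-β * δ / 2)) ≤
      eventualProb (expConductance β u) (primVertices s u k)
        (primList u (primVertices s u k) m) v := by
  induction m generalizing k v with
  | zero => simp [primList, eventualProb_nil]
  | succ m ih =>
    cases h : minExit u (primVertices s u k) with
    | none =>
      simp only [primList, h, eventualProb_nil]
      have : (0 : ℝ) ≤ (m + 1 : ℕ) * (Fintype.card V ^ 2 * Real.exp (-β * δ / 2)) := by positivity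
      linarith
    | some d =>
      rw [primList_succ h]
      -- Here `c₀` is the conductance of `d` itself, attained along a path by `WellConnected`. The
      -- walk then restarts at `d.2`, the newest vertex of the enlarged set, which is what the
      -- induction hypothesis needs.
      have h1 := eventualProb_cons_ge (expConductance_nonneg β u) (expConductance_symm β u)
        (sum_expConductance_pos hV β u) (mem_exitSteps_of_minExit h)
        (primList u (insert d.2 (primVertices s u k)) m) (Real.exp_pos _)
        (fun a b hab => exp_le_expConductance hβ hab) hv.1
        (hv.2 d (mem_exitSteps_of_minExit h))
      have h2 := ih (k + 1) (by omega) (v := d.2) (by rw [primVertices_succ h]; exact hv.insert h)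
      rw [primVertices_succ h] at h2
      have h3 := mul_le_mul_of_nonneg_left (sqrt_exit_ratio_le hβ (hgap k d (by omega) h))
        (Nat.cast_nonneg (α := ℝ) (Fintype.card V))
      push_cast
      have h4 : (Fintype.card V : ℝ) * (Fintype.card V * Real.exp (-β * δ / 2)) =
        Fintype.card V ^ 2 * Real.exp (-β * δ / 2) := by ring
      linarith

/-! ### Measurability of Prim's invasion -/

/-- Since `minExit` involves an arbitrary choice, measurability is obtained by factoring through a
quantity with countably many values and measurable fibers. -/
theorem measurableSet_fiber_of_factor {α β γ : Type*} [MeasurableSpace α] [Countable β]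
    {f : α → γ} {g : α → β} (hg : ∀ b, MeasurableSet {x | g x = b})
    (hfg : ∀ x y, g x = g y → f x = f y) (c : γ) : MeasurableSet {x | f x = c} := by
  have : {x | f x = c} = ⋃ b ∈ {b | ∃ x, g x = b ∧ f x = c}, {x | g x = b} := by
    ext x
    simp only [Set.mem_ofPred_eq, Set.mem_iUnion, exists_prop]
    constructor
    · exact fun h => ⟨g x, ⟨x, rfl, h⟩, rfl⟩
    · rintro ⟨b, ⟨y, hy, hc⟩, hb⟩
      rw [← hc]
      exact hfg x y (hb.trans hy.symm)
  rw [this]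
  exact MeasurableSet.biUnion (Set.to_countable _) fun b _ => hg b

theorem measurableSet_minExit (S : Finset V) (o : Option (V × V)) :
    MeasurableSet {u : EdgeLabels V | minExit u S = o} := by
  classical
  -- The factor is the set of minimizers, which determines `minExit` by `minExit_congr`.
  refine measurableSet_fiber_of_factor
    (g := fun u : EdgeLabels V => (exitSteps S).filter fun d => ∀ e ∈ exitSteps S,
      pairLabel u d.1 d.2 ≤ pairLabel u e.1 e.2) (fun M => ?_) (fun u u' h => ?_) o
  · have hset : {u : EdgeLabels V | ((exitSteps S).filter fun d => ∀ e ∈ exitSteps S,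
        pairLabel u d.1 d.2 ≤ pairLabel u e.1 e.2) = M} = ⋂ d : V × V,
        {u : EdgeLabels V | (d ∈ exitSteps S ∧ ∀ e ∈ exitSteps S,
          pairLabel u d.1 d.2 ≤ pairLabel u e.1 e.2) ↔ d ∈ M} := by
      ext u
      simp only [Finset.ext_iff, Finset.mem_filter, Set.mem_ofPred_eq, Set.mem_iInter]
    rw [hset]
    refine MeasurableSet.iInter fun d => ?_
    have hm : MeasurableSet {u : EdgeLabels V | d ∈ exitSteps S ∧ ∀ e ∈ exitSteps S,
        pairLabel u d.1 d.2 ≤ pairLabel u e.1 e.2} := by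
      have : {u : EdgeLabels V | ∀ e ∈ exitSteps S, pairLabel u d.1 d.2 ≤ pairLabel u e.1 e.2} =
          ⋂ e ∈ exitSteps S, {u | pairLabel u d.1 d.2 ≤ pairLabel u e.1 e.2} := by ext; simp
      have hm' : MeasurableSet {u : EdgeLabels V | ∀ e ∈ exitSteps S,
          pairLabel u d.1 d.2 ≤ pairLabel u e.1 e.2} := by
        rw [this]
        exact Finset.measurableSet_biInter _ fun e _ =>
          measurableSet_le (measurable_pairLabel _ _) (measurable_pairLabel _ _)
      exact (MeasurableSet.const _).inter hm'
    by_cases hd : d ∈ M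
    · simpa only [hd, iff_true] using hm
    · simpa only [hd, iff_false] using! hm.compl
  · refine minExit_congr fun d hd => ?_
    have := Finset.ext_iff.1 h d
    simpa [hd] using this

theorem measurableSet_primVertices (s : V) (k : ℕ) (S : Finset V) :
    MeasurableSet {u : EdgeLabels V | primVertices s u k = S} := by
  induction k generalizing S with
  | zero => exact MeasurableSet.const ({s} = S)
  | succ k ih =>
    have : {u : EdgeLabels V | primVertices s u (k + 1) = S} = ⋃ R : Finset V,
        ⋃ o ∈ {o : Option (V × V) | addEndpoint R o = S},
          {u : EdgeLabels V | primVertices s u k = R} ∩ {u | minExit u R = o} := by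
      ext u
      simp [primVertices]
    rw [this]
    exact MeasurableSet.iUnion fun R => MeasurableSet.biUnion (Set.to_countable _) fun o _ =>
      (ih R).inter (measurableSet_minExit R o)

theorem measurableSet_minExit_primVertices (s : V) (k : ℕ) (o : Option (V × V)) :
    MeasurableSet {u : EdgeLabels V | minExit u (primVertices s u k) = o} := by
  have : {u : EdgeLabels V | minExit u (primVertices s u k) = o} = ⋃ R : Finset V,
      {u : EdgeLabels V | primVertices s u k = R} ∩ {u | minExit u R = o} := by
    ext u
    simp
  rw [this]
  exact MeasurableSet.iUnion fun R =>
    (measurableSet_primVertices s k R).inter (measurableSet_minExit R o)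

theorem measurableSet_primList (S : Finset V) (m : ℕ) (l : List (V × V)) :
    MeasurableSet {u : EdgeLabels V | primList u S m = l} := by
  induction m generalizing S l with
  | zero => exact MeasurableSet.const ([] = l)
  | succ m ih =>
    have : {u : EdgeLabels V | primList u S (m + 1) = l} = ({u | minExit u S = none} ∩ {_u | [] = l})
        ∪ ⋃ d : V × V, ⋃ l' ∈ {l' : List (V × V) | d :: l' = l}, {u | minExit u S = some d} ∩
          {u | primList u (insert d.2 S) m = l'} := by
      ext u
      cases h : minExit u S with
      | none => simp [primList, h]
      | some d => simp [primList, h]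
    rw [this]
    exact ((measurableSet_minExit _ _).inter (MeasurableSet.const _)).union
      (MeasurableSet.iUnion fun d => MeasurableSet.biUnion (Set.to_countable _) fun l' _ =>
        (measurableSet_minExit _ _).inter (ih _ _))

theorem measurableSet_primList_append (S : Finset V) (m : ℕ) (l' l : List (V × V)) :
    MeasurableSet {u : EdgeLabels V | primList u S m ++ l' = l} :=
  measurableSet_fiber_of_factor (g := fun u : EdgeLabels V => primList u S m)
    (measurableSet_primList S m) (fun _ _ h => congrArg (· ++ l') h) l

/-! ### The law of the labels -/

/-- Lebesgue measure on `[0, 1]`. -/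
def unitMeasure : Measure ℝ := volume.restrict (Set.Icc 0 1)

instance : IsProbabilityMeasure unitMeasure := ⟨by simp [unitMeasure]⟩

instance : NullSingletonClass unitMeasure := by unfold unitMeasure; infer_instance

/-- The law of independent uniform labels. -/
def labelMeasure (V : Type*) [Fintype V] [DecidableEq V] : Measure (EdgeLabels V) :=
  Measure.pi fun _ => unitMeasure

instance : IsProbabilityMeasure (labelMeasure V) := by unfold labelMeasure; infer_instance

theorem IsLabelledWalk.map_labels {Ω : Type*} [MeasurableSpace Ω] {P : Measure Ω} {β : ℝ} {s : V}
    {U : (⊤ : SimpleGraph V).edgeSet → Ω → ℝ} {X : ℕ → Ω → V} (h : IsLabelledWalk P β s U X) :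
    P.map (fun ω e => U e ω) = labelMeasure V := by
  have := h.isProbabilityMeasure
  rw [(iIndepFun_iff_map_fun_eq_pi_map fun e => (h.measurable_label e).aemeasurable).1
    h.indep_label]
  unfold labelMeasure
  congr 1
  funext e
  have := h.uniform_label e
  unfold pdf.IsUniform ProbabilityTheory.cond at this
  rw [this]
  simp [unitMeasure]

theorem measurePreserving_comp_perm (σ : Equiv.Perm (⊤ : SimpleGraph V).edgeSet) :
    MeasurePreserving (fun (u : EdgeLabels V) e => u (σ e)) (labelMeasure V) (labelMeasure V) := by
  have h := measurePreserving_arrowCongr'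
    (fun _ : (⊤ : SimpleGraph V).edgeSet => unitMeasure) (fun _ => unitMeasure) σ.symm
    (MeasurableEquiv.refl ℝ) (fun _ => MeasurePreserving.id _)
  exact h

theorem iIndepFun_label : iIndepFun (fun (e : (⊤ : SimpleGraph V).edgeSet) (u : EdgeLabels V) => u e)
    (labelMeasure V) :=
  iIndepFun_pi (X := fun _ t => t) fun _ => aemeasurable_id

theorem map_label (e : (⊤ : SimpleGraph V).edgeSet) :
    (labelMeasure V).map (fun u => u e) = unitMeasure :=
  (measurePreserving_eval (fun _ : (⊤ : SimpleGraph V).edgeSet => unitMeasure) e).map_eq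

theorem pairLabel_of_ne (u : EdgeLabels V) {a b : V} (h : a ≠ b) :
    pairLabel u a b = u ⟨s(a, b), by simpa using h⟩ := by
  unfold pairLabel
  rw [dif_pos h]

/-- The probability of a box event. -/
theorem labelMeasure_box {I : Finset (V × V)} (hne : ∀ e ∈ I, e.1 ≠ e.2)
    (hinj : Set.InjOn (fun e : V × V => s(e.1, e.2)) I) (B : V × V → Set ℝ)
    (hB : ∀ e ∈ I, MeasurableSet (B e)) :
    labelMeasure V {u | ∀ e ∈ I, pairLabel u e.1 e.2 ∈ B e} = ∏ e ∈ I, unitMeasure (B e) := by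
  let g : I → (⊤ : SimpleGraph V).edgeSet := fun e =>
    ⟨s(e.1.1, e.1.2), by simpa using hne e.1 e.2⟩
  have hg : Function.Injective g := by
    intro e e' h
    have := congrArg Subtype.val h
    exact Subtype.ext (hinj e.2 e'.2 this)
  have hind := (iIndepFun_label (V := V)).precomp hg
  have h1 := hind.measure_inter_preimage_eq_mul Finset.univ (sets := fun e => B e.1)
    (fun e _ => hB e.1 e.2)
  have h2 : {u : EdgeLabels V | ∀ e ∈ I, pairLabel u e.1 e.2 ∈ B e} =
      ⋂ e ∈ (Finset.univ : Finset I), (fun u : EdgeLabels V => u (g e)) ⁻¹' B e.1 := by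
    ext u
    simp only [Set.mem_ofPred_eq, Finset.mem_univ, Set.iInter_true, Set.mem_iInter,
      Set.mem_preimage, Subtype.forall]
    refine forall₂_congr fun e he => ?_
    rw [pairLabel_of_ne u (hne e he)]
  rw [h2, h1, ← Finset.prod_coe_sort I]
  refine Finset.prod_congr rfl fun e _ => ?_
  rw [← map_label (g e)]
  exact (Measure.map_apply (measurable_pi_apply (g e)) (hB e.1 e.2)).symm

/-- Fubini: integrate over the label of `e` first, all other labels being frozen. -/
theorem labelMeasure_le_of_update {E : Set (EdgeLabels V)} (hE : MeasurableSet E)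
    (e : (⊤ : SimpleGraph V).edgeSet) {δ : ENNReal}
    (h : ∀ u : EdgeLabels V, unitMeasure {t | Function.update u e t ∈ E} ≤ δ) :
    labelMeasure V E ≤ δ := by
  have hf : Measurable (E.indicator (1 : EdgeLabels V → ENNReal)) := measurable_one.indicator hE
  rw [← lintegral_indicator_one hE, labelMeasure,
    lintegral_eq_lmarginal_univ (fun _ => 0), lmarginal_erase' _ hf (Finset.mem_univ e)]
  have h1 : (fun u : EdgeLabels V => ∫⁻ t, E.indicator (1 : EdgeLabels V → ENNReal)
      (Function.update u e t) ∂unitMeasure) ≤ fun _ => δ := by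
    intro u
    have hm : MeasurableSet {t | Function.update u e t ∈ E} := measurable_update u hE
    calc _ = ∫⁻ t, {t | Function.update u e t ∈ E}.indicator (1 : ℝ → ENNReal) t ∂unitMeasure := rfl
      _ = unitMeasure {t | Function.update u e t ∈ E} := lintegral_indicator_one hm
      _ ≤ δ := h u
  refine (lmarginal_mono h1 _).trans ?_
  simp [lmarginal]

theorem ae_label_mem_Icc : ∀ᵐ u ∂labelMeasure V, ∀ e, u e ∈ Set.Icc (0 : ℝ) 1 := by
  rw [ae_all_iff]
  intro e
  have h1 : ∀ᵐ t ∂unitMeasure, t ∈ Set.Icc (0 : ℝ) 1 := ae_restrict_mem measurableSet_Icc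
  rw [← map_label e] at h1
  exact ae_of_ae_map (measurable_pi_apply e).aemeasurable h1

theorem ae_label_injective : ∀ᵐ u ∂labelMeasure V, Function.Injective u := by
  have h : ∀ e e' : (⊤ : SimpleGraph V).edgeSet, e ≠ e' → ∀ᵐ u ∂labelMeasure V, u e ≠ u e' := by
    intro e e' hne
    rw [ae_iff]
    simp only [not_not]
    have hm : MeasurableSet {u : EdgeLabels V | u e = u e'} :=
      measurableSet_eq_fun (measurable_pi_apply e) (measurable_pi_apply e')
    refine le_antisymm (labelMeasure_le_of_update hm e fun u => ?_) bot_le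
    refine (measure_mono (t := {u e'}) fun t ht => ?_).trans (by simp)
    simpa [Function.update_of_ne hne.symm] using ht
  have h' : ∀ᵐ u ∂labelMeasure V, ∀ e e' : (⊤ : SimpleGraph V).edgeSet, e ≠ e' → u e ≠ u e' := by
    simp only [ae_all_iff]
    exact h
  filter_upwards [h'] with u hu e e' hee
  by_contra hne
  exact hu e e' hne hee

/-! ### The agreement event -/

theorem exitSteps_eq_of_sym2 {S : Finset V} {d e : V × V} (hd : d ∈ exitSteps S)
    (he : e ∈ exitSteps S) (h : s(d.1, d.2) = s(e.1, e.2)) : d = e := by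
  rcases Sym2.eq_iff.1 h with ⟨h1, h2⟩ | ⟨h1, h2⟩
  · exact Prod.ext h1 h2
  · exact absurd ((mem_exitSteps.1 hd).1) (h1 ▸ (mem_exitSteps.1 he).2)

theorem exit_ne {S : Finset V} {d : V × V} (hd : d ∈ exitSteps S) : d.1 ≠ d.2 := fun h =>
  (mem_exitSteps.1 hd).2 (h ▸ (mem_exitSteps.1 hd).1)

/-- As long as the edges agree, both algorithms have the same vertex set. Boundary steps are
oriented outwards, so equality of undirected edges is equality of steps. -/
theorem agrees_primList_iff (s : V) (u : EdgeLabels V) (x : ℕ → V) (m k : ℕ)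
    (hk : abVertices s x k = primVertices s u k) (hkm : k + m < Fintype.card V) :
    Agrees x (primVertices s u k) (primList u (primVertices s u k) m) ↔
      ∀ j, k ≤ j → j < k + m → abEdge s x j = primEdge s u j := by
  induction m generalizing k with
  | zero =>
    simp only [primList, Agrees, true_iff]
    intro j h1 h2
    omega
  | succ m ih =>
    obtain ⟨d, hd⟩ := exists_minExit_primVertices u s (k := k) (by omega)
    rw [primList_succ hd, Agrees]
    have hstep : abEdge s x k = primEdge s u k ↔ firstExit x (primVertices s u k) = some d := by
      unfold abEdge primEdge
      rw [hk, hd, Option.map_some, Option.map_eq_some_iff]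
      constructor
      · rintro ⟨e, he, hed⟩
        rw [he, exitSteps_eq_of_sym2 (mem_exitSteps_of_firstExit he)
          (mem_exitSteps_of_minExit hd) hed]
      · intro h
        exact ⟨d, h, rfl⟩
    rw [← hstep, ← primVertices_succ hd]
    constructor
    · rintro ⟨h1, h2⟩ j hj1 hj2
      rcases Nat.eq_or_lt_of_le hj1 with rfl | hlt
      · exact h1
      · refine (ih (k + 1) ?_ (by omega)).1 h2 j hlt (by omega)
        rw [primVertices_succ hd, abVertices, hk, hstep.1 h1, addEndpoint]
    · intro h
      have h1 := h k le_rfl (by omega)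
      refine ⟨h1, (ih (k + 1) ?_ (by omega)).2 fun j hj1 hj2 => h j (by omega) (by omega)⟩
      rw [primVertices_succ hd, abVertices, hk, hstep.1 h1, addEndpoint]

theorem mem_agreementEvent_iff [Nonempty V] {Ω : Type*} (s : V)
    (U : (⊤ : SimpleGraph V).edgeSet → Ω → ℝ) (X : ℕ → Ω → V) (ω : Ω) :
    ω ∈ agreementEvent s U X ↔
      Agrees (fun t => X t ω) {s} (primList (fun e => U e ω) {s} (Fintype.card V - 1)) := by
  have hc : 0 < Fintype.card V := Fintype.card_pos
  have h := agrees_primList_iff s (fun e => U e ω) (fun t => X t ω) (Fintype.card V - 1) 0 rfl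
    (by omega)
  simp only [primVertices, Nat.zero_le, forall_const, zero_add] at h
  rw [h]
  change (∀ k, _ → _) ↔ _
  refine forall_congr' fun k => ?_
  rw [Nat.lt_sub_iff_add_lt]

/-! ### Gaps between the labels seen by Prim's invasion -/

theorem minExit_eq_some_of_lt {u : EdgeLabels V} {S : Finset V} {d : V × V}
    (hd : d ∈ exitSteps S)
    (h : ∀ e ∈ exitSteps S, e ≠ d → pairLabel u d.1 d.2 < pairLabel u e.1 e.2) :
    minExit u S = some d := by
  obtain ⟨d', hd'⟩ := exists_minExit (u := u) ⟨d, hd⟩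
  by_cases hdd : d' = d
  · rw [hd', hdd]
  · exact absurd (minExit_le hd' hd) (not_le.2 (h d' (mem_exitSteps_of_minExit hd') hdd))

theorem minExit_lt_of_injective {u : EdgeLabels V} (hu : Function.Injective u) {S : Finset V}
    {d e : V × V} (hd : minExit u S = some d) (he : e ∈ exitSteps S) (hne : e ≠ d) :
    pairLabel u d.1 d.2 < pairLabel u e.1 e.2 := by
  refine lt_of_le_of_ne (minExit_le hd he) fun h => hne ?_
  have hd' := mem_exitSteps_of_minExit hd
  rw [pairLabel_of_ne u (exit_ne hd'), pairLabel_of_ne u (exit_ne he)] at h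
  exact exitSteps_eq_of_sym2 he hd' (congrArg Subtype.val (hu h)).symm

theorem pairLabel_update (u : EdgeLabels V) (e : (⊤ : SimpleGraph V).edgeSet) (t : ℝ) {a b : V}
    (hab : a ≠ b) : pairLabel (Function.update u e t) a b =
      if s(a, b) = e.1 then t else pairLabel u a b := by
  rw [pairLabel_of_ne _ hab, pairLabel_of_ne _ hab]
  split_ifs with h
  · have : (⟨s(a, b), by simpa using hab⟩ : (⊤ : SimpleGraph V).edgeSet) = e := Subtype.ext h
    rw [this, Function.update_self]
  · rw [Function.update_of_ne]
    exact fun h' => h (congrArg Subtype.val h')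

/-- The label `2` exceeds all others, so the update amounts to deleting `e`; deleting an edge that
is not the minimizer leaves the minimizer unchanged. -/
theorem minExit_update {u : EdgeLabels V} (hu : Function.Injective u) (hu1 : ∀ e, u e ≤ 1)
    {S : Finset V} {d : V × V} (hd : minExit u S = some d) {e : (⊤ : SimpleGraph V).edgeSet}
    (hde : s(d.1, d.2) ≠ e.1) : minExit (Function.update u e 2) S = some d := by
  have hd' := mem_exitSteps_of_minExit hd
  refine minExit_eq_some_of_lt hd' fun e' he' hne => ?_
  rw [pairLabel_update _ _ _ (exit_ne hd'), pairLabel_update _ _ _ (exit_ne he'), if_neg hde]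
  split_ifs
  · rw [pairLabel_of_ne u (exit_ne hd')]
    linarith [hu1 ⟨s(d.1, d.2), by simpa using exit_ne hd'⟩]
  · exact minExit_lt_of_injective hu hd he' hne

theorem primVertices_mono (u : EdgeLabels V) (s : V) : Monotone (primVertices s u) := by
  refine monotone_nat_of_le_succ fun k => ?_
  cases h : minExit u (primVertices s u k) with
  | none => simp [primVertices, h, addEndpoint]
  | some d => rw [primVertices_succ h]; exact Finset.subset_insert _ _

/-- The outer end of `e` is not in `W_k`, so `e` is not chosen in the first `k` steps, and these
steps do not depend on its label beyond the fact that it lost. This is what permits the label of `e`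
to be revealed last. -/
theorem primVertices_update {u : EdgeLabels V} (hu : Function.Injective u) (hu1 : ∀ e, u e ≤ 1)
    {s : V} {k : ℕ} (hk : k < Fintype.card V) {e : V × V}
    (he : e ∈ exitSteps (primVertices s u k)) {j : ℕ} (hj : j ≤ k) :
    primVertices s (Function.update u ⟨s(e.1, e.2), by simpa using exit_ne he⟩ 2) j =
      primVertices s u j := by
  induction j with
  | zero => rfl
  | succ j ih =>
    have ih := ih (by omega)
    obtain ⟨d, hd⟩ := exists_minExit_primVertices u s (k := j) (by omega)
    rw [primVertices_succ hd, primVertices_succ (d := d), ih]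
    rw [ih]
    refine minExit_update hu hu1 hd fun h => ?_
    have he2 := (mem_exitSteps.1 he).2
    have hsub : insert d.2 (primVertices s u j) ⊆ primVertices s u k := by
      rw [← primVertices_succ hd]
      exact primVertices_mono u s hj
    rcases Sym2.eq_iff.1 h with ⟨h1, h2⟩ | ⟨h1, h2⟩
    · exact he2 (hsub (by rw [← h2]; exact Finset.mem_insert_self _ _))
    · exact he2 (hsub (by
        rw [← h1]
        exact Finset.mem_insert_of_mem (mem_exitSteps.1 (mem_exitSteps_of_minExit hd)).1))

/-- At each step of Prim's invasion the minimal label is smaller by `δ` than all other labels on the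
boundary. -/
def HasGaps (s : V) (δ : ℝ) (u : EdgeLabels V) : Prop :=
  ∀ k d, k + 1 < Fintype.card V → minExit u (primVertices s u k) = some d →
    ∀ e ∈ exitSteps (primVertices s u k), e ≠ d → pairLabel u d.1 d.2 + δ ≤ pairLabel u e.1 e.2

/-- The label of `e` lies within `δ` above the label chosen in step `k` of Prim's invasion run
without `e`. -/
def closeSet (s : V) (δ : ℝ) (k : ℕ) (e : (⊤ : SimpleGraph V).edgeSet) : Set (EdgeLabels V) :=
  {u | ∃ d, minExit (Function.update u e 2) (primVertices s (Function.update u e 2) k) = some d ∧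
    u e ∈ Set.Icc (pairLabel (Function.update u e 2) d.1 d.2)
      (pairLabel (Function.update u e 2) d.1 d.2 + δ)}

/-- Once the other labels are fixed, so is the label chosen by Prim without `e`, and the label of
`e` must fall into a fixed interval of length `δ`. -/
theorem labelMeasure_closeSet_le (s : V) (δ : ℝ) (k : ℕ) (e : (⊤ : SimpleGraph V).edgeSet) :
    labelMeasure V (closeSet s δ k e) ≤ ENNReal.ofReal δ := by
  have hup : Measurable fun u : EdgeLabels V => Function.update u e 2 := by
    refine measurable_pi_lambda _ fun e' => ?_
    by_cases h : e' = e
    · subst h; simp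
    · simpa [Function.update_of_ne h] using measurable_pi_apply e'
  have hm : MeasurableSet (closeSet s δ k e) := by
    have : closeSet s δ k e = ⋃ d : V × V, ((fun u : EdgeLabels V => Function.update u e 2) ⁻¹'
        {u | minExit u (primVertices s u k) = some d}) ∩
        ({u | pairLabel (Function.update u e 2) d.1 d.2 ≤ u e} ∩
          {u | u e ≤ pairLabel (Function.update u e 2) d.1 d.2 + δ}) := by
      ext u
      simp [closeSet]
    rw [this]
    have h1 := fun d : V × V => (measurable_pairLabel d.1 d.2).comp hup
    exact MeasurableSet.iUnion fun d => (hup (measurableSet_minExit_primVertices s k _)).inter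
      ((measurableSet_le (h1 d) (measurable_pi_apply e)).inter
        (measurableSet_le (measurable_pi_apply e) ((h1 d).add_const δ)))
  refine labelMeasure_le_of_update hm e fun u => ?_
  cases h : minExit (Function.update u e 2) (primVertices s (Function.update u e 2) k) with
  | none => simp [closeSet, h]
  | some d =>
    refine (measure_mono (t := Set.Icc (pairLabel (Function.update u e 2) d.1 d.2)
      (pairLabel (Function.update u e 2) d.1 d.2 + δ)) fun t ht => ?_).trans ?_
    · obtain ⟨d', hd', ht'⟩ := ht
      rw [Function.update_idem] at hd' ht'
      rw [h] at hd'
      rw [Function.update_self, ← Option.some.inj hd'] at ht'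
      exact ht'
    · refine (Measure.restrict_apply_le _ _).trans ?_
      simp

/-- If `e` violates the gap at step `k`, then raising its label to `2` changes neither `W_k` nor the
minimizer, so the labels lie in `closeSet s δ k e`. The union bound runs over at most `n` steps and
`n²` edges. -/
theorem labelMeasure_not_hasGaps_le (s : V) (δ : ℝ) :
    labelMeasure V {u | ¬ HasGaps s δ u} ≤ ENNReal.ofReal (Fintype.card V ^ 3 * δ) := by
  have hsub : ∀ᵐ u ∂labelMeasure V, ¬ HasGaps s δ u →
      u ∈ ⋃ k ∈ Finset.range (Fintype.card V),
        ⋃ e ∈ (Finset.univ : Finset (⊤ : SimpleGraph V).edgeSet), closeSet s δ k e := by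
    filter_upwards [ae_label_mem_Icc, ae_label_injective] with u hu01 hu hgap
    unfold HasGaps at hgap
    push Not at hgap
    obtain ⟨k, d, hk, hd, e, he, hne, hlt⟩ := hgap
    simp only [Set.mem_iUnion]
    refine ⟨k, Finset.mem_range.2 (by omega), ⟨s(e.1, e.2), by simpa using exit_ne he⟩,
      Finset.mem_univ _, d, ?_, ?_⟩
    · rw [primVertices_update hu (fun e => (hu01 e).2) (by omega) he le_rfl]
      exact minExit_update hu (fun e => (hu01 e).2) hd fun h =>
        hne (exitSteps_eq_of_sym2 (mem_exitSteps_of_minExit hd) he h).symm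
    · have hd' := mem_exitSteps_of_minExit hd
      rw [pairLabel_update _ _ _ (exit_ne hd'), if_neg fun h =>
        hne (exitSteps_eq_of_sym2 hd' he h).symm, ← pairLabel_of_ne u (exit_ne he)]
      exact ⟨minExit_le hd he, hlt.le⟩
  refine (measure_mono_ae hsub).trans ?_
  refine (measure_biUnion_finset_le _ _).trans ?_
  have hcard : Fintype.card (⊤ : SimpleGraph V).edgeSet ≤ Fintype.card V ^ 2 := by
    rw [← SimpleGraph.edgeFinset_card, SimpleGraph.card_edgeFinset_top_eq_card_choose_two]
    exact Nat.choose_le_pow _ _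
  calc _ ≤ ∑ _k ∈ Finset.range (Fintype.card V),
        ∑ _e : (⊤ : SimpleGraph V).edgeSet, ENNReal.ofReal δ := by
        refine Finset.sum_le_sum fun k _ => (measure_biUnion_finset_le _ _).trans ?_
        exact Finset.sum_le_sum fun e _ => labelMeasure_closeSet_le s δ k e
    _ = (Fintype.card V * Fintype.card (⊤ : SimpleGraph V).edgeSet : ℕ) * ENNReal.ofReal δ := by
        simp [mul_assoc]
    _ ≤ (Fintype.card V ^ 3 : ℕ) * ENNReal.ofReal δ := by
        gcongr
        calc _ ≤ Fintype.card V * Fintype.card V ^ 2 := Nat.mul_le_mul_left _ hcard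
          _ = _ := by ring
    _ = ENNReal.ofReal (Fintype.card V ^ 3 * δ) := by
        rw [ENNReal.ofReal_mul (by positivity)]
        congr 1
        rw [← Nat.cast_pow, ENNReal.ofReal_natCast]

/-! ### The strongly disordered regime -/

theorem measurable_of_countable_fibers {α β γ : Type*} [MeasurableSpace α] [MeasurableSpace γ]
    [Countable β] {f : α → β → γ} {g : α → β} (hf : ∀ b, Measurable fun x => f x b)
    (hg : ∀ b, MeasurableSet {x | g x = b}) : Measurable fun x => f x (g x) := by
  intro A hA
  have : (fun x => f x (g x)) ⁻¹' A = ⋃ b, {x | g x = b} ∩ (fun x => f x b) ⁻¹' A := by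
    ext x
    simp
  rw [this]
  exact MeasurableSet.iUnion fun b => (hg b).inter (hf b hA)

theorem measurable_followProb_primList (β : ℝ) (s : V) (T m : ℕ) (l : List (V × V)) :
    Measurable fun u : EdgeLabels V =>
      followProb (expConductance β u) T {s} (primList u {s} m ++ l) s :=
  measurable_of_countable_fibers (f := fun u l => followProb (expConductance β u) T {s} l s)
    (fun l => measurable_followProb β T {s} l s) (measurableSet_primList_append {s} m l)

namespace IsLabelledWalk

variable {Ω : Type*} [MeasurableSpace Ω] {P : Measure Ω} {β : ℝ} {s : V}
  {U : (⊤ : SimpleGraph V).edgeSet → Ω → ℝ} {X : ℕ → Ω → V}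

theorem agreementEvent_ae_eq (h : IsLabelledWalk P β s U X) :
    ∀ᵐ ω ∂P, ω ∈ agreementEvent s U X ↔ ∃ T, Follows T (fun t => X t ω) {s}
      (primList (fun e => U e ω) {s} (Fintype.card V - 1)) := by
  have : Nonempty V := ⟨s⟩
  filter_upwards [h.ae_start] with ω hω
  rw [mem_agreementEvent_iff, agrees_iff_exists_follows (by simp [hω])]

/-- Following Prim's list within time `T` implies agreement for every `T`; monotone convergence
removes the time bound. -/
theorem lintegral_eventualProb_le (h : IsLabelledWalk P β s U X) {B : Set (EdgeLabels V)}
    (hB : MeasurableSet B) :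
    ∫⁻ u in B, ENNReal.ofReal (eventualProb (expConductance β u) {s}
      (primList u {s} (Fintype.card V - 1)) s) ∂labelMeasure V ≤ P (agreementEvent s U X) := by
  have hm : ∀ T, Measurable fun u : EdgeLabels V => followProb (expConductance β u) T {s}
      (primList u {s} (Fintype.card V - 1)) s := by
    intro T
    simpa using measurable_followProb_primList β s T (Fintype.card V - 1) []
  have hT : ∀ T, ∫⁻ u in B, ENNReal.ofReal (followProb (expConductance β u) T {s}
      (primList u {s} (Fintype.card V - 1)) s) ∂labelMeasure V ≤ P (agreementEvent s U X) := by
    intro T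
    rw [← h.map_labels, ← h.measure_follows hB T {s} (fun u => primList u {s} (Fintype.card V - 1))
      (measurableSet_primList _ _)]
    refine measure_mono_ae ?_
    filter_upwards [h.agreementEvent_ae_eq] with ω hω hω'
    exact hω.2 ⟨T, hω'.2⟩
  refine le_of_tendsto' (lintegral_tendsto_of_tendsto_of_monotone (fun T =>
    (hm T).ennreal_ofReal.aemeasurable) (ae_of_all _ fun u => ?_) (ae_of_all _ fun u => ?_)) hT
  · intro T T' hTT
    exact ENNReal.ofReal_le_ofReal (monotone_followProb (expConductance_nonneg β u) _ _ _ hTT)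
  · exact ENNReal.tendsto_ofReal (tendsto_followProb (expConductance_nonneg β u) _ _ _)

/-- The first error is the cost of at most `n` steps at `n² e^{-βδ/2}` each when all gaps are at
least `δ`, the second one bounds the probability that some gap is smaller. -/
theorem agreementEvent_ge (h : IsLabelledWalk P β s U X) (hV : 2 ≤ Fintype.card V) (hβ : 0 ≤ β)
    {δ : ℝ} (hδ : 0 ≤ δ) :
    1 - (Fintype.card V : ℝ) ^ 3 * Real.exp (-β * δ / 2) - Fintype.card V ^ 3 * δ ≤
      P.real (agreementEvent s U X) := by
  have := h.isProbabilityMeasure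
  set n : ℝ := ((Fintype.card V : ℕ) : ℝ) with hn
  set ε := n ^ 3 * Real.exp (-β * δ / 2) with hε
  have hε0 : 0 ≤ ε := by positivity
  by_cases hε1 : 1 < ε
  · have h1 : 0 ≤ n ^ 3 * δ := by positivity
    have h2 : 0 ≤ P.real (agreementEvent s U X) := measureReal_nonneg
    linarith
  -- A measurable hull of the complement replaces a proof that `HasGaps` is measurable; its measure
  -- is the same.
  set B := (toMeasurable (labelMeasure V) {u | ¬ HasGaps s δ u})ᶜ with hB
  have hBm : MeasurableSet B := (measurableSet_toMeasurable _ _).compl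
  have hBg : ∀ u ∈ B, HasGaps s δ u := by
    intro u hu
    by_contra hc
    exact hu (subset_toMeasurable _ _ hc)
  have hBμ : 1 - n ^ 3 * δ ≤ (labelMeasure V).real B := by
    rw [hB, probReal_compl_eq_one_sub (measurableSet_toMeasurable _ _), measureReal_def,
      measure_toMeasurable]
    have := ENNReal.toReal_mono ENNReal.ofReal_ne_top (labelMeasure_not_hasGaps_le s δ)
    rw [ENNReal.toReal_ofReal (by positivity)] at this
    linarith
  have hlow : ∀ u ∈ B, ENNReal.ofReal (1 - ε) ≤ ENNReal.ofReal (eventualProb (expConductance β u) {s}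
      (primList u {s} (Fintype.card V - 1)) s) := by
    intro u hu
    refine ENNReal.ofReal_le_ofReal ?_
    have h1 := eventualProb_primList_ge hV hβ (hBg u hu) (Fintype.card V - 1) 0 (by omega)
      (wellConnected_singleton u s)
    refine le_trans ?_ h1
    have h2 : ((Fintype.card V - 1 : ℕ) : ℝ) ≤ n := by
      rw [hn]; exact_mod_cast Nat.sub_le _ _
    have h3 : ((Fintype.card V - 1 : ℕ) : ℝ) * (n ^ 2 * Real.exp (-β * δ / 2)) ≤
        n * (n ^ 2 * Real.exp (-β * δ / 2)) := by gcongr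
    have h4 : n * (n ^ 2 * Real.exp (-β * δ / 2)) = ε := by rw [hε]; ring
    linarith
  have h1 : ENNReal.ofReal (1 - ε) * labelMeasure V B ≤ P (agreementEvent s U X) := by
    refine le_trans ?_ (h.lintegral_eventualProb_le hBm)
    rw [← setLIntegral_const]
    exact setLIntegral_mono' hBm hlow
  have h2 := ENNReal.toReal_mono (measure_ne_top _ _) h1
  rw [ENNReal.toReal_mul, ENNReal.toReal_ofReal (by linarith)] at h2
  have h3 : (1 - ε) * (1 - n ^ 3 * δ) ≤ (1 - ε) * (labelMeasure V).real B :=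
    mul_le_mul_of_nonneg_left hBμ (by linarith)
  have h4 : 0 ≤ ε * (n ^ 3 * δ) := by positivity
  change _ ≤ P.real _ at h2
  change (1 - ε) * (labelMeasure V).real B ≤ _ at h2
  linarith

end IsLabelledWalk

/-! ### Prim's invasion and connected components below a level -/

theorem primList_add (u : EdgeLabels V) (s : V) (k j m : ℕ) (h : j + k < Fintype.card V) :
    primList u (primVertices s u j) (k + m) =
      primList u (primVertices s u j) k ++ primList u (primVertices s u (j + k)) m := by
  induction k generalizing j with
  | zero => simp [primList]
  | succ k ih =>
    obtain ⟨d, hd⟩ := exists_minExit_primVertices u s (k := j) (by omega)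
    rw [show k + 1 + m = k + m + 1 by omega, primList_succ hd, primList_succ hd,
      ← primVertices_succ hd, ih (j + 1) (by omega), List.cons_append,
      show j + 1 + k = j + (k + 1) by omega]

theorem mem_primVertices_of_mem_primList {u : EdgeLabels V} {s : V} {m j : ℕ} {d : V × V}
    (hd : d ∈ primList u (primVertices s u j) m) : d.2 ∈ primVertices s u (j + m) := by
  induction m generalizing j with
  | zero => simp [primList] at hd
  | succ m ih =>
    cases h : minExit u (primVertices s u j) with
    | none => simp [primList, h] at hd
    | some d' =>
      rw [primList_succ h, List.mem_cons] at hd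
      rcases hd with rfl | hd
      · refine primVertices_mono u s (show j + 1 ≤ j + (m + 1) by omega) ?_
        rw [primVertices_succ h]
        exact Finset.mem_insert_self _ _
      · rw [← primVertices_succ h] at hd
        have := ih hd
        rwa [show j + 1 + m = j + (m + 1) by omega] at this

open Classical in
/-- The vertices connected to `s` by edges with label below `t`. -/
def lowCluster (u : EdgeLabels V) (s : V) (t : ℝ) : Finset V :=
  Finset.univ.filter fun v => (labelGraph u (· < t)).Reachable s v

theorem mem_lowCluster {u : EdgeLabels V} {s v : V} {t : ℝ} :
    v ∈ lowCluster u s t ↔ (labelGraph u (· < t)).Reachable s v := by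
  simp [lowCluster]

theorem le_of_mem_exitSteps_lowCluster {u : EdgeLabels V} {s : V} {t : ℝ} {e : V × V}
    (he : e ∈ exitSteps (lowCluster u s t)) : t ≤ pairLabel u e.1 e.2 := by
  by_contra hlt
  obtain ⟨h1, h2⟩ := mem_exitSteps.1 he
  rw [mem_lowCluster] at h1 h2
  exact h2 (h1.trans (SimpleGraph.Adj.reachable ⟨exit_ne he, not_le.1 hlt⟩))

theorem exists_exit_lt {u : EdgeLabels V} {s : V} {t : ℝ} {W : Finset V} (hs : s ∈ W)
    (hW : ¬ lowCluster u s t ⊆ W) : ∃ e ∈ exitSteps W, pairLabel u e.1 e.2 < t := by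
  obtain ⟨v, hv, hvW⟩ := Finset.not_subset.1 hW
  rw [mem_lowCluster] at hv
  obtain ⟨p⟩ := hv
  obtain ⟨d, _, hd1, hd2⟩ := p.exists_boundary_dart (W : Set V) (by simpa using hs)
    (by simpa using hvW)
  exact ⟨(d.fst, d.snd), mem_exitSteps.2 ⟨by simpa using hd1, by simpa using hd2⟩, d.adj.2⟩

/-- Prim exhausts the cluster of `s` below level `t` before it crosses a label of at least `t`: a
proper part of the cluster has a boundary edge below `t`, and all edges leaving the cluster have
labels at least `t`. -/
theorem primVertices_subset_lowCluster {u : EdgeLabels V} {s : V} {t : ℝ} {j : ℕ}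
    (hj : j < (lowCluster u s t).card) : primVertices s u j ⊆ lowCluster u s t := by
  have hcard := Finset.card_le_univ (lowCluster u s t)
  induction j with
  | zero =>
    simp only [primVertices, Finset.singleton_subset_iff, mem_lowCluster]
    exact SimpleGraph.Reachable.refl s
  | succ j ih =>
    have ih := ih (by omega)
    obtain ⟨d, hd⟩ := exists_minExit_primVertices u s (k := j) (by omega)
    rw [primVertices_succ hd]
    have hd' := mem_exitSteps_of_minExit hd
    refine Finset.insert_subset ?_ ih
    obtain ⟨e, he, het⟩ := exists_exit_lt (u := u) (t := t) (start_mem_primVertices u s j)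
      (fun h => by
        have := Finset.card_le_card h
        rw [card_primVertices u s (by omega)] at this
        omega)
    have hlt := (minExit_le hd he).trans_lt het
    by_contra hn
    exact absurd (le_of_mem_exitSteps_lowCluster
      (mem_exitSteps.2 ⟨ih (mem_exitSteps.1 hd').1, hn⟩)) (not_le.2 hlt)

theorem lowCluster_card_pos (u : EdgeLabels V) (s : V) (t : ℝ) : 0 < (lowCluster u s t).card :=
  Finset.card_pos.2 ⟨s, mem_lowCluster.2 (SimpleGraph.Reachable.refl s)⟩

theorem primVertices_eq_lowCluster (u : EdgeLabels V) (s : V) (t : ℝ) :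
    primVertices s u ((lowCluster u s t).card - 1) = lowCluster u s t := by
  have h0 := lowCluster_card_pos u s t
  have hcard := Finset.card_le_univ (lowCluster u s t)
  refine Finset.eq_of_subset_of_card_le (primVertices_subset_lowCluster (by omega)) ?_
  rw [card_primVertices u s (by omega)]
  omega

/-- If some boundary label is below `t`, every minimizer is below `t`, where `u` and `u'` coincide;
labels above `t` play no role. Thus the minimizer sets, and with them the choices, are the same. -/
theorem minExit_eq_of_agree_below {u u' : EdgeLabels V} {t : ℝ}
    (h : ∀ a b, pairLabel u a b < t ∨ pairLabel u' a b < t → pairLabel u a b = pairLabel u' a b)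
    {W : Finset V} (hW : ∃ e ∈ exitSteps W, pairLabel u e.1 e.2 < t) :
    minExit u W = minExit u' W := by
  have key : ∀ v v' : EdgeLabels V,
      (∀ a b, pairLabel v a b < t ∨ pairLabel v' a b < t → pairLabel v a b = pairLabel v' a b) →
      (∃ e ∈ exitSteps W, pairLabel v e.1 e.2 < t) → ∀ d : V × V,
      (∀ e ∈ exitSteps W, pairLabel v d.1 d.2 ≤ pairLabel v e.1 e.2) →
      ∀ e ∈ exitSteps W, pairLabel v' d.1 d.2 ≤ pairLabel v' e.1 e.2 := by
    rintro v v' hv ⟨e₀, he₀, hlt⟩ d hd e he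
    have hdt : pairLabel v d.1 d.2 < t := (hd e₀ he₀).trans_lt hlt
    rw [← hv _ _ (Or.inl hdt)]
    by_cases het : pairLabel v' e.1 e.2 < t
    · rw [← hv _ _ (Or.inr het)]
      exact hd e he
    · exact hdt.le.trans (not_lt.1 het)
  have h' : ∀ a b, pairLabel u' a b < t ∨ pairLabel u a b < t →
      pairLabel u' a b = pairLabel u a b := fun a b hab => (h a b hab.symm).symm
  have hW' : ∃ e ∈ exitSteps W, pairLabel u' e.1 e.2 < t := by
    obtain ⟨e, he, hlt⟩ := hW
    exact ⟨e, he, by rwa [← h _ _ (Or.inl hlt)]⟩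
  exact minExit_congr fun d _ => ⟨key u u' h hW d, key u' u h' hW' d⟩

theorem lowCluster_eq_of_agree_below {u u' : EdgeLabels V} {t : ℝ}
    (h : ∀ a b, pairLabel u a b < t ∨ pairLabel u' a b < t → pairLabel u a b = pairLabel u' a b)
    (s : V) : lowCluster u' s t = lowCluster u s t := by
  have : labelGraph u (· < t) = labelGraph u' (· < t) := by
    ext a b
    refine and_congr_right fun _ => ⟨fun hlt => ?_, fun hlt => ?_⟩
    · rwa [← h _ _ (Or.inl hlt)]
    · rwa [h _ _ (Or.inr hlt)]
  unfold lowCluster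
  rw [this]

theorem primVertices_eq_of_agree_below {u u' : EdgeLabels V} {t : ℝ}
    (h : ∀ a b, pairLabel u a b < t ∨ pairLabel u' a b < t → pairLabel u a b = pairLabel u' a b)
    {s : V} {j : ℕ} (hj : j < (lowCluster u s t).card) :
    primVertices s u' j = primVertices s u j ∧ primList u' {s} j = primList u {s} j := by
  have hcard := Finset.card_le_univ (lowCluster u s t)
  induction j with
  | zero => simp [primVertices, primList]
  | succ j ih =>
    obtain ⟨ih1, ih2⟩ := ih (by omega)
    have hmin : minExit u (primVertices s u j) = minExit u' (primVertices s u j) :=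
      minExit_eq_of_agree_below h (exists_exit_lt (start_mem_primVertices u s j) fun h => by
        have := Finset.card_le_card h
        rw [card_primVertices u s (by omega)] at this
        omega)
    obtain ⟨d, hd⟩ := exists_minExit_primVertices u s (k := j) (by omega)
    have hd' : minExit u' (primVertices s u' j) = some d := by rw [ih1, ← hmin, hd]
    refine ⟨by rw [primVertices_succ hd, primVertices_succ hd', ih1], ?_⟩
    have h1 := primList_add u s j 0 1 (by omega)
    have h2 := primList_add u' s j 0 1 (by omega)
    rw [zero_add, primList_succ hd] at h1
    rw [zero_add, primList_succ hd'] at h2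
    change primList u {s} (j + 1) = primList u {s} j ++ [d] at h1
    change primList u' {s} (j + 1) = primList u' {s} j ++ [d] at h2
    rw [h1, h2, ih2]

theorem sym2_eq_of_pairLabel_eq {u : EdgeLabels V} (hu : Function.Injective u) {x y x' y' : V}
    (hxy : x ≠ y) (hxy' : x' ≠ y') (h : pairLabel u x y = pairLabel u x' y') :
    s(x, y) = s(x', y') := by
  rw [pairLabel_of_ne _ hxy, pairLabel_of_ne _ hxy'] at h
  exact congrArg Subtype.val (hu h)

/-! ### Exchanging the labels of two edges -/

/-- Exchange the labels of the edges `a` and `b`. -/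
def swapLabels {a b : V × V} (ha : a.1 ≠ a.2) (hb : b.1 ≠ b.2) (u : EdgeLabels V) : EdgeLabels V :=
  fun e => u (Equiv.swap (⟨s(a.1, a.2), by simpa using ha⟩ : (⊤ : SimpleGraph V).edgeSet)
    ⟨s(b.1, b.2), by simpa using hb⟩ e)

section Swap

variable {a b : V × V} (ha : a.1 ≠ a.2) (hb : b.1 ≠ b.2)

theorem measurePreserving_swapLabels :
    MeasurePreserving (swapLabels ha hb) (labelMeasure V) (labelMeasure V) :=
  measurePreserving_comp_perm _

theorem swapLabels_swapLabels (u : EdgeLabels V) : swapLabels ha hb (swapLabels ha hb u) = u := by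
  funext e
  simp [swapLabels]

theorem swapLabels_comm (u : EdgeLabels V) : swapLabels hb ha u = swapLabels ha hb u := by
  funext e
  simp only [swapLabels]
  rw [Equiv.swap_comm]

theorem swapLabels_injective {u : EdgeLabels V} (hu : Function.Injective u) :
    Function.Injective (swapLabels ha hb u) :=
  hu.comp (Equiv.injective _)

theorem pairLabel_swapLabels_left (u : EdgeLabels V) :
    pairLabel (swapLabels ha hb u) a.1 a.2 = pairLabel u b.1 b.2 := by
  rw [pairLabel_of_ne _ ha, pairLabel_of_ne _ hb]
  simp [swapLabels]

theorem pairLabel_swapLabels_right (u : EdgeLabels V) :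
    pairLabel (swapLabels ha hb u) b.1 b.2 = pairLabel u a.1 a.2 := by
  rw [pairLabel_of_ne _ ha, pairLabel_of_ne _ hb]
  simp [swapLabels]

theorem pairLabel_swapLabels_of_ne (u : EdgeLabels V) {x y : V} (h1 : s(x, y) ≠ s(a.1, a.2))
    (h2 : s(x, y) ≠ s(b.1, b.2)) : pairLabel (swapLabels ha hb u) x y = pairLabel u x y := by
  by_cases hxy : x = y
  · subst hxy; simp [pairLabel]
  · rw [pairLabel_of_ne _ hxy, pairLabel_of_ne _ hxy]
    unfold swapLabels
    rw [Equiv.swap_apply_of_ne_of_ne]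
    · exact fun h => h1 (congrArg Subtype.val h)
    · exact fun h => h2 (congrArg Subtype.val h)

theorem pairLabel_eq_of_sym2 (u : EdgeLabels V) {x y x' y' : V} (h : s(x, y) = s(x', y')) :
    pairLabel u x y = pairLabel u x' y' := by
  rcases Sym2.eq_iff.1 h with ⟨rfl, rfl⟩ | ⟨rfl, rfl⟩
  · rfl
  · exact pairLabel_symm _ _ _

theorem pairLabel_swapLabels_cases (u : EdgeLabels V) (x y : V) :
    (pairLabel (swapLabels ha hb u) x y = pairLabel u x y) ∨
    (pairLabel (swapLabels ha hb u) x y = pairLabel u b.1 b.2 ∧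
      pairLabel u x y = pairLabel u a.1 a.2) ∨
    (pairLabel (swapLabels ha hb u) x y = pairLabel u a.1 a.2 ∧
      pairLabel u x y = pairLabel u b.1 b.2) := by
  by_cases h1 : s(x, y) = s(a.1, a.2)
  · exact Or.inr (Or.inl ⟨by rw [pairLabel_eq_of_sym2 _ h1, pairLabel_swapLabels_left],
      pairLabel_eq_of_sym2 _ h1⟩)
  · by_cases h2 : s(x, y) = s(b.1, b.2)
    · exact Or.inr (Or.inr ⟨by rw [pairLabel_eq_of_sym2 _ h2, pairLabel_swapLabels_right],
        pairLabel_eq_of_sym2 _ h2⟩)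
    · exact Or.inl (pairLabel_swapLabels_of_ne ha hb u h1 h2)

/-- The exchange moves only two labels, both at least `t`, so everything that Prim sees below level
`t` is unaffected. -/
theorem swapLabels_agree_below {u : EdgeLabels V} {t : ℝ} (hat : t ≤ pairLabel u a.1 a.2)
    (hbt : t ≤ pairLabel u b.1 b.2) (x y : V)
    (h : pairLabel u x y < t ∨ pairLabel (swapLabels ha hb u) x y < t) :
    pairLabel u x y = pairLabel (swapLabels ha hb u) x y := by
  rcases pairLabel_swapLabels_cases ha hb u x y with h1 | ⟨h1, h2⟩ | ⟨h1, h2⟩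
  · exact h1.symm
  · rw [h1, h2] at h; exact absurd h (by push Not; exact ⟨hat, hbt⟩)
  · rw [h1, h2] at h; exact absurd h (by push Not; exact ⟨hbt, hat⟩)

end Swap

/-! ### Rival pairs -/

/-- The steps `a` and `b` both leave the cluster of `s` below the level of their smaller label. -/
structure IsRivalPair (s : V) (a b : V × V) (u : EdgeLabels V) : Prop where
  injective : Function.Injective u
  ne : a ≠ b
  left_mem : a ∈ exitSteps (lowCluster u s (min (pairLabel u a.1 a.2) (pairLabel u b.1 b.2)))
  right_mem : b ∈ exitSteps (lowCluster u s (min (pairLabel u a.1 a.2) (pairLabel u b.1 b.2)))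

namespace IsRivalPair

variable {s : V} {a b : V × V} {u : EdgeLabels V}

theorem symm (h : IsRivalPair s a b u) : IsRivalPair s b a u :=
  ⟨h.injective, h.ne.symm, by rw [min_comm]; exact h.right_mem, by rw [min_comm]; exact h.left_mem⟩

theorem label_ne (h : IsRivalPair s a b u) : pairLabel u a.1 a.2 ≠ pairLabel u b.1 b.2 := by
  intro heq
  exact h.ne (exitSteps_eq_of_sym2 h.left_mem h.right_mem (sym2_eq_of_pairLabel_eq h.injective
    (exit_ne h.left_mem) (exit_ne h.right_mem) heq))

/-- Prim's invasion uses the rival with the smaller label; after the exchange of the two labels it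
uses the other one in the same step and does the same before. -/
theorem prim_step (h : IsRivalPair s a b u) (ha : a.1 ≠ a.2) (hb : b.1 ≠ b.2)
    (hlt : pairLabel u a.1 a.2 < pairLabel u b.1 b.2) {k : ℕ}
    (hk : k + 1 = (lowCluster u s (pairLabel u a.1 a.2)).card) :
    b ∈ exitSteps (primVertices s u k) ∧ minExit u (primVertices s u k) = some a ∧
    minExit (swapLabels ha hb u) (primVertices s u k) = some b ∧
    primVertices s (swapLabels ha hb u) k = primVertices s u k ∧
    primList (swapLabels ha hb u) {s} k = primList u {s} k := by
  set t := pairLabel u a.1 a.2 with ht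
  have hmin : min t (pairLabel u b.1 b.2) = t := min_eq_left hlt.le
  have hL := h.left_mem
  have hR := h.right_mem
  rw [hmin] at hL hR
  have hagree := swapLabels_agree_below ha hb (u := u) (t := t) le_rfl hlt.le
  have hkS : primVertices s u k = lowCluster u s t := by
    rw [← primVertices_eq_lowCluster u s t]
    congr 1
    omega
  have hC := lowCluster_eq_of_agree_below hagree s
  obtain ⟨h1, h2⟩ := primVertices_eq_of_agree_below hagree (s := s) (j := k) (by omega)
  refine ⟨by rw [hkS]; exact hR, ?_, ?_, h1, h2⟩
  · rw [hkS]
    refine minExit_eq_some_of_lt hL fun e he hne => lt_of_le_of_ne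
      (le_of_mem_exitSteps_lowCluster he) fun heq => hne ?_
    exact exitSteps_eq_of_sym2 he hL
      (sym2_eq_of_pairLabel_eq h.injective (exit_ne hL) (exit_ne he) heq).symm
  · rw [hkS]
    refine minExit_eq_some_of_lt hR fun e he hne => ?_
    rw [pairLabel_swapLabels_right, ← ht]
    refine lt_of_le_of_ne (le_of_mem_exitSteps_lowCluster (by rw [hC]; exact he)) fun heq => hne ?_
    rw [ht, ← pairLabel_swapLabels_right ha hb u] at heq
    exact exitSteps_eq_of_sym2 he hR (sym2_eq_of_pairLabel_eq
      (swapLabels_injective ha hb h.injective) (exit_ne hR) (exit_ne he) heq).symm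

end IsRivalPair

theorem minExit_primVertices_index_unique {u : EdgeLabels V} {s : V} {a : V × V} {k k' : ℕ}
    (h : minExit u (primVertices s u k) = some a) (h' : minExit u (primVertices s u k') = some a) :
    k = k' := by
  have key : ∀ {k k' : ℕ}, minExit u (primVertices s u k) = some a →
      minExit u (primVertices s u k') = some a → ¬ k < k' := by
    intro k k' h h' hlt
    refine (mem_exitSteps.1 (mem_exitSteps_of_minExit h')).2 (primVertices_mono u s hlt ?_)
    rw [primVertices_succ h]
    exact Finset.mem_insert_self _ _
  exact le_antisymm (not_lt.1 (key h' h)) (not_lt.1 (key h h'))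

theorem IsRivalPair.card_lowCluster_lt {s : V} {a b : V × V} {u : EdgeLabels V}
    (h : IsRivalPair s a b u) (hlt : pairLabel u a.1 a.2 < pairLabel u b.1 b.2) :
    (lowCluster u s (pairLabel u a.1 a.2)).card < Fintype.card V := by
  have hL := h.left_mem
  rw [min_eq_left hlt.le] at hL
  exact Finset.card_lt_univ_of_notMem (mem_exitSteps.1 hL).2

theorem IsRivalPair.exists_index {s : V} {a b : V × V} {u : EdgeLabels V}
    (h : IsRivalPair s a b u) (hlt : pairLabel u a.1 a.2 < pairLabel u b.1 b.2) :
    ∃ k, k + 1 < Fintype.card V ∧ minExit u (primVertices s u k) = some a := by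
  have h0 := lowCluster_card_pos u s (pairLabel u a.1 a.2)
  have h1 := h.card_lowCluster_lt hlt
  refine ⟨(lowCluster u s (pairLabel u a.1 a.2)).card - 1, by omega, ?_⟩
  exact (h.prim_step (exit_ne h.left_mem) (exit_ne h.right_mem) hlt (by omega)).2.1

theorem IsRivalPair.index_eq {s : V} {a b : V × V} {u : EdgeLabels V}
    (h : IsRivalPair s a b u) (hlt : pairLabel u a.1 a.2 < pairLabel u b.1 b.2) {k : ℕ}
    (hk : minExit u (primVertices s u k) = some a) :
    k + 1 = (lowCluster u s (pairLabel u a.1 a.2)).card := by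
  have h0 := lowCluster_card_pos u s (pairLabel u a.1 a.2)
  have h2 := (h.prim_step (exit_ne h.left_mem) (exit_ne h.right_mem) hlt
    (k := (lowCluster u s (pairLabel u a.1 a.2)).card - 1) (by omega)).2.1
  have := minExit_primVertices_index_unique hk h2
  omega

/-- Exchanging the labels of two rivals changes the probability to cross the rival with the larger
label by a controlled amount. -/
theorem followProb_swapLabels_le (hV : 2 ≤ Fintype.card V) {β η : ℝ} (hβ : 0 ≤ β) {s : V}
    {a b : V × V} (ha : a.1 ≠ a.2) (hb : b.1 ≠ b.2) {u : EdgeLabels V} (h : IsRivalPair s a b u)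
    (hlt : pairLabel u a.1 a.2 < pairLabel u b.1 b.2)
    (hη : β * (pairLabel u b.1 b.2 - pairLabel u a.1 a.2) ≤ η) {k : ℕ}
    (hk : minExit u (primVertices s u k) = some a) (T : ℕ) :
    followProb (expConductance β (swapLabels ha hb u)) T {s} (primList u {s} k ++ [b]) s ≤
      Real.exp η * (followProb (expConductance β u) T {s} (primList u {s} k ++ [b]) s +
        (Real.exp η - 1)) := by
  obtain ⟨hbS, -, -, -, -⟩ := h.prim_step ha hb hlt (h.index_eq hlt hk)
  have haS := mem_exitSteps_of_minExit hk
  have hβd : 0 ≤ β * (pairLabel u b.1 b.2 - pairLabel u a.1 a.2) :=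
    mul_nonneg hβ (sub_nonneg.2 hlt.le)
  have hη0 : 0 ≤ η := hβd.trans hη
  have hne : ∀ z ∈ primVertices s u k, ∀ w, ∀ d ∈ exitSteps (primVertices s u k),
      (z, w) ≠ d → s(z, w) ≠ s(d.1, d.2) := by
    intro z hz w d hd hzd heq
    rcases Sym2.eq_iff.1 heq with ⟨h1, h2⟩ | ⟨h1, h2⟩
    · exact hzd (Prod.ext h1 h2)
    · exact (mem_exitSteps.1 hd).2 (h1 ▸ hz)
  -- The comparison set is Prim's vertex set just before `a` is used; Prim's first `k` steps stay
  -- inside it. The exchange alters the conductances of `a` and `b` by a factor of at most `e^η`,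
  -- whence `1 + θ = e^η` and `K = e^{-η}`.
  have hcomp := followProb_comparison_le (expConductance_nonneg β u)
    (expConductance_nonneg β (swapLabels ha hb u)) haS hbS (θ := Real.exp η - 1)
    (K := Real.exp (-η)) (by linarith [Real.one_le_exp hη0]) (Real.exp_pos _).le
    (Real.exp_le_one_iff.2 (by linarith))
    (fun z hz w hza hzb => by
      unfold expConductance
      rw [pairLabel_swapLabels_of_ne ha hb u (hne z hz w a haS hza) (hne z hz w b hbS hzb)])
    (by
      unfold expConductance
      rw [if_neg ha, if_neg ha, pairLabel_swapLabels_left, add_sub_cancel, ← Real.exp_add]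
      exact Real.exp_le_exp.2 (by linarith))
    (by
      unfold expConductance
      rw [if_neg hb, if_neg hb, pairLabel_swapLabels_right]
      exact Real.exp_le_exp.2 (by linarith))
    (by
      unfold expConductance
      rw [if_neg hb, if_neg hb, pairLabel_swapLabels_right, ← Real.exp_add]
      exact Real.exp_le_exp.2 (by linarith))
    (fun z _ => sum_expConductance_pos hV β u z)
    (fun z _ => sum_expConductance_pos hV β _ z) T (R := {s}) (l := primList u {s} k)
    (Finset.singleton_subset_iff.2 (start_mem_primVertices u s k))
    (fun d hd => by
      have := mem_primVertices_of_mem_primList (u := u) (s := s) (j := 0) (m := k) (d := d) hd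
      rwa [zero_add] at this) (start_mem_primVertices u s k)
  calc _ = Real.exp η * (Real.exp (-η) * followProb (expConductance β (swapLabels ha hb u)) T {s}
        (primList u {s} k ++ [b]) s) := by
        rw [← mul_assoc, ← Real.exp_add, add_neg_cancel, Real.exp_zero, one_mul]
    _ ≤ _ := mul_le_mul_of_nonneg_left hcomp (Real.exp_pos _).le

/-! ### From agreement to deviation by exchanging labels -/

namespace IsLabelledWalk

variable {Ω : Type*} [MeasurableSpace Ω] {P : Measure Ω} {β : ℝ} {s : V}
  {U : (⊤ : SimpleGraph V).edgeSet → Ω → ℝ} {X : ℕ → Ω → V}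

/-- The walk follows Prim's invasion for `k` steps and then uses the step `b`. -/
def deviationEvent (s : V) (U : (⊤ : SimpleGraph V).edgeSet → Ω → ℝ) (X : ℕ → Ω → V)
    (H : Set (EdgeLabels V)) (k : ℕ) (b : V × V) : Set Ω :=
  {ω | (fun e => U e ω) ∈ H ∧ X 0 ω = s ∧
    ∃ T, Follows T (fun t => X t ω) {s} (primList (fun e => U e ω) {s} k ++ [b])}

theorem measurableSet_follows_primList (h : IsLabelledWalk P β s U X) (T k : ℕ)
    (l : List (V × V)) :
    MeasurableSet {ω | Follows T (fun t => X t ω) {s} (primList (fun e => U e ω) {s} k ++ l)} := by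
  have : {ω | Follows T (fun t => X t ω) {s} (primList (fun e => U e ω) {s} k ++ l)} =
      ⋃ l₀, {ω | (fun e => U e ω) ∈ {u | primList u {s} k ++ l = l₀}} ∩
        {ω | Follows T (fun t => X (0 + t) ω) {s} l₀} := by
    ext ω
    simp
  rw [this]
  exact MeasurableSet.iUnion fun l₀ =>
    (h.measurable_labels (measurableSet_primList_append {s} k l l₀)).inter
      (h.measurableSet_follows T 0 {s} l₀)

theorem measurableSet_deviationEvent (h : IsLabelledWalk P β s U X) {H : Set (EdgeLabels V)}
    (hH : MeasurableSet H) (k : ℕ) (b : V × V) : MeasurableSet (deviationEvent s U X H k b) := by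
  have : deviationEvent s U X H k b = {ω | (fun e => U e ω) ∈ H} ∩ ({ω | X 0 ω = s} ∩
      ⋃ T, {ω | Follows T (fun t => X t ω) {s} (primList (fun e => U e ω) {s} k ++ [b])}) := by
    ext ω
    simp [deviationEvent]
  rw [this]
  exact (h.measurable_labels hH).inter ((h.measurable_walk 0 s).inter
    (MeasurableSet.iUnion fun T => h.measurableSet_follows_primList T k [b]))

/-- If the exchanged labels lie in `H`, then for the actual labels Prim makes the same first `k`
steps and then crosses `b`, and agreement forces the walk to do so too. Transporting the integral by
the exchange turns this into an integral over `H` with exchanged conductances; going back to the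
original conductances costs `η`, and for those labels crossing `b` is a deviation from Prim, who
crosses `a`. -/
theorem measure_agreement_swap_le (h : IsLabelledWalk P β s U X) (hV : 2 ≤ Fintype.card V)
    (hβ : 0 ≤ β) {a b : V × V} (ha : a.1 ≠ a.2) (hb : b.1 ≠ b.2) {η : ℝ} {k : ℕ}
    {H : Set (EdgeLabels V)} (hH : MeasurableSet H)
    (hrival : ∀ u ∈ H, IsRivalPair s a b u ∧ pairLabel u a.1 a.2 < pairLabel u b.1 b.2 ∧
      β * (pairLabel u b.1 b.2 - pairLabel u a.1 a.2) ≤ η ∧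
      minExit u (primVertices s u k) = some a) :
    P (agreementEvent s U X ∩ {ω | swapLabels ha hb (fun e => U e ω) ∈ H}) ≤
      ENNReal.ofReal (Real.exp η) * (P (deviationEvent s U X H k b) +
        ENNReal.ofReal (Real.exp η - 1) * labelMeasure V H) := by
  set A : ℕ → Set Ω := fun T => {ω | (fun e => U e ω) ∈ swapLabels ha hb ⁻¹' H ∧
    Follows T (fun t => X t ω) {s} (primList (fun e => U e ω) {s} k ++ [b])} with hA
  have hσ := measurePreserving_swapLabels ha hb
  have hsub : ∀ᵐ ω ∂P, ω ∈ agreementEvent s U X ∩ {ω | swapLabels ha hb (fun e => U e ω) ∈ H} →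
      ω ∈ ⋃ T, A T := by
    filter_upwards [h.agreementEvent_ae_eq, h.ae_start] with ω hω hs hωA
    obtain ⟨h1, h2⟩ := hωA
    set u : EdgeLabels V := fun e => U e ω with hu
    have h2 : swapLabels ha hb u ∈ H := h2
    obtain ⟨hr, hlt, -, hk⟩ := hrival _ h2
    have hidx := hr.index_eq hlt hk
    have hcard := hr.card_lowCluster_lt hlt
    obtain ⟨-, -, hmin, hV', hL'⟩ := hr.prim_step ha hb hlt hidx
    rw [swapLabels_swapLabels] at hmin hV' hL'
    rw [← hV'] at hmin
    have hT := hω.1 h1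
    rw [← agrees_iff_exists_follows (by simp [hs])] at hT
    -- Cut Prim's full list after `k` steps; the next entry for the actual labels is `b`.
    have hadd := primList_add u s k 0 (Fintype.card V - 1 - k) (by omega)
    rw [show k + (Fintype.card V - 1 - k) = Fintype.card V - 1 by omega, zero_add,
      show Fintype.card V - 1 - k = Fintype.card V - 1 - k - 1 + 1 by omega,
      primList_succ hmin] at hadd
    change primList u {s} _ = primList u {s} k ++ _ at hadd
    rw [hadd, List.append_cons] at hT
    have hT' := hT.of_append
    rw [agrees_iff_exists_follows (by simp [hs])] at hT'
    obtain ⟨T, hT'⟩ := hT'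
    exact Set.mem_iUnion.2 ⟨T, h2, hT'⟩
  refine (measure_mono_ae hsub).trans ?_
  have hmono : Monotone A := fun T T' hTT ω hω => ⟨hω.1, hω.2.mono hTT⟩
  refine le_of_tendsto' (tendsto_measure_iUnion_atTop hmono) fun T => ?_
  have e1 : P (A T) = ∫⁻ u in H, ENNReal.ofReal (followProb (expConductance β (swapLabels ha hb u))
      T {s} (primList (swapLabels ha hb u) {s} k ++ [b]) s) ∂labelMeasure V := by
    have hm : Measurable fun u : EdgeLabels V => ENNReal.ofReal (followProb (expConductance β
        (swapLabels ha hb u)) T {s} (primList (swapLabels ha hb u) {s} k ++ [b]) s) :=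
      ((measurable_followProb_primList β s T k [b]).comp hσ.measurable).ennreal_ofReal
    rw [← hσ.setLIntegral_comp_preimage hH hm, ← h.map_labels,
      h.measure_follows (hσ.measurable hH) T {s} (fun u => primList u {s} k ++ [b])
        (measurableSet_primList_append {s} k [b])]
    simp only [swapLabels_swapLabels]
  have e2 : ∫⁻ u in H, ENNReal.ofReal (followProb (expConductance β u) T {s}
      (primList u {s} k ++ [b]) s) ∂labelMeasure V ≤ P (deviationEvent s U X H k b) := by
    rw [← h.map_labels, ← h.measure_follows hH T {s} (fun u => primList u {s} k ++ [b])
        (measurableSet_primList_append {s} k [b])]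
    refine measure_mono_ae ?_
    filter_upwards [h.ae_start] with ω hω hω'
    exact ⟨hω'.1, hω, T, hω'.2⟩
  rw [Function.comp_apply, e1]
  calc _ ≤ ∫⁻ u in H, ENNReal.ofReal (Real.exp η) * (ENNReal.ofReal (followProb
        (expConductance β u) T {s} (primList u {s} k ++ [b]) s) + ENNReal.ofReal (Real.exp η - 1))
          ∂labelMeasure V := by
        refine setLIntegral_mono' hH fun u hu => ?_
        obtain ⟨hr, hlt, hη, hk⟩ := hrival u hu
        obtain ⟨-, -, -, -, hL'⟩ := hr.prim_step ha hb hlt (hr.index_eq hlt hk)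
        have hβd : 0 ≤ β * (pairLabel u b.1 b.2 - pairLabel u a.1 a.2) :=
          mul_nonneg hβ (sub_nonneg.2 hlt.le)
        rw [hL', ← ENNReal.ofReal_add (followProb_nonneg (expConductance_nonneg β u) _ _ _ _)
          (by linarith [Real.one_le_exp (hβd.trans hη)]), ← ENNReal.ofReal_mul (Real.exp_pos _).le]
        exact ENNReal.ofReal_le_ofReal (followProb_swapLabels_le hV hβ ha hb hr hlt hη hk T)
    _ = ENNReal.ofReal (Real.exp η) * (∫⁻ u in H, ENNReal.ofReal (followProb
        (expConductance β u) T {s} (primList u {s} k ++ [b]) s) ∂labelMeasure V +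
          ENNReal.ofReal (Real.exp η - 1) * labelMeasure V H) := by
        rw [lintegral_const_mul' _ _ ENNReal.ofReal_ne_top, lintegral_add_right _ measurable_const,
          setLIntegral_const]
    _ ≤ _ := by gcongr

/-- The sum of the deviation probabilities is at most `1` because these events are disjoint: a
deviation determines the step in which it happens, the edge that Prim uses there and the edge that
the walk uses instead, and so the pair. No bound on the number of pairs is needed. -/
theorem sum_measure_agreement_le {ι : Type*} (I : Finset ι) (h : IsLabelledWalk P β s U X)
    (hV : 2 ≤ Fintype.card V) (hβ : 0 ≤ β) {η : ℝ} (a b : ι → V × V) (G : ι → Set (EdgeLabels V))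
    (hG : ∀ i ∈ I, MeasurableSet (G i)) (ha : ∀ i, (a i).1 ≠ (a i).2) (hb : ∀ i, (b i).1 ≠ (b i).2)
    (hrival : ∀ i ∈ I, ∀ u ∈ G i, IsRivalPair s (a i) (b i) u ∧
      β * |pairLabel u (a i).1 (a i).2 - pairLabel u (b i).1 (b i).2| ≤ η)
    (hswap : ∀ i ∈ I, ∀ u ∈ G i, swapLabels (ha i) (hb i) u ∈ G i)
    (hab : ∀ i j, a i ≠ b j)
    (hdisj : ∀ i ∈ I, ∀ j ∈ I, ∀ u, u ∈ G i → u ∈ G j → a i = a j → b i = b j → i = j) :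
    ∑ i ∈ I, P (agreementEvent s U X ∩ {ω | (fun e => U e ω) ∈ G i}) ≤
      ENNReal.ofReal (Real.exp η) * (1 + ENNReal.ofReal (Real.exp η - 1) *
        ∑ i ∈ I, labelMeasure V (G i)) := by
  have hPprob := h.isProbabilityMeasure
  set n := Fintype.card V with hn
  -- the rival with the smaller label, and the other one
  let lo : ι → Bool → V × V := fun i o => if o then a i else b i
  let hi : ι → Bool → V × V := fun i o => if o then b i else a i
  have hlo : ∀ i o, (lo i o).1 ≠ (lo i o).2 := fun i o => by
    cases o
    · exact hb i
    · exact ha i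
  have hhi : ∀ i o, (hi i o).1 ≠ (hi i o).2 := fun i o => by
    cases o
    · exact ha i
    · exact hb i
  -- `G i` is divided according to which rival has the smaller label and in which step Prim uses it.
  let H : ι → ℕ × Bool → Set (EdgeLabels V) := fun i q => G i ∩
    ({u | pairLabel u (lo i q.2).1 (lo i q.2).2 < pairLabel u (hi i q.2).1 (hi i q.2).2} ∩
      {u | minExit u (primVertices s u q.1) = some (lo i q.2)})
  have hHm : ∀ i ∈ I, ∀ q, MeasurableSet (H i q) := fun i hi q => (hG i hi).inter
    ((measurableSet_lt (measurable_pairLabel _ _) (measurable_pairLabel _ _)).inter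
      (measurableSet_minExit_primVertices s q.1 _))
  have hHr : ∀ i ∈ I, ∀ q, ∀ u ∈ H i q, IsRivalPair s (lo i q.2) (hi i q.2) u ∧
      pairLabel u (lo i q.2).1 (lo i q.2).2 < pairLabel u (hi i q.2).1 (hi i q.2).2 ∧
      β * (pairLabel u (hi i q.2).1 (hi i q.2).2 - pairLabel u (lo i q.2).1 (lo i q.2).2) ≤ η ∧
      minExit u (primVertices s u q.1) = some (lo i q.2) := by
    rintro i hi' ⟨k, o⟩ u ⟨hu, hlt, hmin⟩
    obtain ⟨hr, hη⟩ := hrival i hi' u hu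
    refine ⟨?_, hlt, ?_, hmin⟩
    · cases o
      · exact hr.symm
      · exact hr
    · refine le_trans (mul_le_mul_of_nonneg_left ?_ hβ) hη
      cases o
      · exact le_abs_self _
      · rw [abs_sub_comm]; exact le_abs_self _
  set K := (Finset.range n) ×ˢ (Finset.univ : Finset Bool) with hK
  -- The exchanged labels are classified, not the actual ones; they are again in `G i` by `hswap`.
  have hcover : ∀ i ∈ I, agreementEvent s U X ∩ {ω | (fun e => U e ω) ∈ G i} ⊆
      ⋃ q ∈ K, agreementEvent s U X ∩
        {ω | swapLabels (hlo i q.2) (hhi i q.2) (fun e => U e ω) ∈ H i q} := by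
    rintro i hi' ω ⟨hωA, hω⟩
    set u : EdgeLabels V := fun e => U e ω with hu
    have hsw : ∀ o, swapLabels (hlo i o) (hhi i o) u = swapLabels (ha i) (hb i) u := by
      intro o
      cases o
      · exact swapLabels_comm _ _ _
      · rfl
    have hv := hswap i hi' u hω
    set v := swapLabels (ha i) (hb i) u with hv'
    obtain ⟨hr, -⟩ := hrival i hi' v hv
    obtain ⟨o, hrlo, hlt⟩ : ∃ o, IsRivalPair s (lo i o) (hi i o) v ∧
        pairLabel v (lo i o).1 (lo i o).2 < pairLabel v (hi i o).1 (hi i o).2 := by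
      rcases lt_or_gt_of_ne hr.label_ne with hlt | hlt
      · exact ⟨true, hr, hlt⟩
      · exact ⟨false, hr.symm, hlt⟩
    obtain ⟨k, hk, hmin⟩ := hrlo.exists_index hlt
    simp only [Set.mem_iUnion]
    refine ⟨(k, o), Finset.mem_product.2 ⟨Finset.mem_range.2 (by omega), Finset.mem_univ _⟩, hωA, ?_⟩
    change swapLabels (hlo i o) (hhi i o) u ∈ H i (k, o)
    rw [hsw]
    exact ⟨hv, hlt, hmin⟩
  have hmain : ∀ i ∈ I, P (agreementEvent s U X ∩ {ω | (fun e => U e ω) ∈ G i}) ≤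
      ∑ q ∈ K, ENNReal.ofReal (Real.exp η) * (P (deviationEvent s U X (H i q) q.1 (hi i q.2)) +
        ENNReal.ofReal (Real.exp η - 1) * labelMeasure V (H i q)) := by
    intro i hi'
    refine (measure_mono (hcover i hi')).trans ((measure_biUnion_finset_le _ _).trans ?_)
    exact Finset.sum_le_sum fun q _ => h.measure_agreement_swap_le hV hβ (hlo i q.2) (hhi i q.2)
      (hHm i hi' q) (hHr i hi' q)
  have hHsum : ∀ i ∈ I, ∑ q ∈ K, labelMeasure V (H i q) ≤ labelMeasure V (G i) := by
    intro i hi'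
    rw [← measure_biUnion_finset _ fun q _ => hHm i hi' q]
    · exact measure_mono (Set.iUnion₂_subset fun q _ => Set.inter_subset_left)
    · rintro ⟨k, o⟩ _ ⟨k', o'⟩ _ hne
      refine Set.disjoint_left.2 ?_
      rintro u ⟨_, hlt, hmin⟩ ⟨_, hlt', hmin'⟩
      apply hne
      rw [Set.mem_ofPred_eq] at hlt hlt'
      have hoo : o = o' := by
        cases o <;> cases o'
        · rfl
        · exact (lt_asymm hlt hlt').elim
        · exact (lt_asymm hlt hlt').elim
        · rfl
      subst hoo
      exact Prod.ext (minExit_primVertices_index_unique hmin hmin') rfl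
  have hDsum : ∑ p ∈ I ×ˢ K, P (deviationEvent s U X (H p.1 p.2) p.2.1 (hi p.1 p.2.2)) ≤ 1 := by
    rw [← measure_biUnion_finset]
    · exact prob_le_one
    · rintro ⟨i, k, o⟩ hp ⟨i', k', o'⟩ hp' hne
      refine Set.disjoint_left.2 ?_
      rintro ω ⟨hω1, hω0, hω2⟩ ⟨hω1', -, hω2'⟩
      apply hne
      have hiI : i ∈ I := (Finset.mem_product.1 hp).1
      have hiI' : i' ∈ I := (Finset.mem_product.1 hp').1
      set u : EdgeLabels V := fun e => U e ω with hu
      have hx0 : (fun t => X t ω) 0 ∈ ({s} : Finset V) := by simp [hω0]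
      rw [← agrees_iff_exists_follows hx0] at hω2 hω2'
      -- A deviation at a later step `k'` means that the walk still used Prim's edge `lo` at step
      -- `k`, whereas a deviation at `k` means that it used `hi`.
      have key : ∀ {i i' : ι} {k k' : ℕ} {o o' : Bool}, i ∈ I → i' ∈ I → u ∈ H i (k, o) →
          u ∈ H i' (k', o') →
          Agrees (fun t => X t ω) {s} (primList u {s} k ++ [hi i o]) →
          Agrees (fun t => X t ω) {s} (primList u {s} k' ++ [hi i' o']) → ¬ k < k' := by
        intro i i' k k' o o' hiI hiI' hu1 hu1' hA hA' hkk
        obtain ⟨hr, hlt, -, hmin⟩ := hHr i hiI (k, o) u hu1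
        obtain ⟨hr', hlt', -, hmin'⟩ := hHr i' hiI' (k', o') u hu1'
        have hidx' := hr'.index_eq hlt' hmin'
        have hcard' := hr'.card_lowCluster_lt hlt'
        have hadd := primList_add u s k 0 (k' - k) (by omega)
        rw [show k + (k' - k) = k' by omega, zero_add,
          show k' - k = k' - k - 1 + 1 by omega, primList_succ hmin] at hadd
        change primList u {s} k' = primList u {s} k ++ _ at hadd
        rw [hadd, List.append_assoc, List.cons_append] at hA'
        exact hr.ne (hA.next_eq hA').symm
      have hkk : k = k' := le_antisymm (not_lt.1 (key hiI' hiI hω1' hω1 hω2' hω2))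
        (not_lt.1 (key hiI hiI' hω1 hω1' hω2 hω2'))
      subst hkk
      have hhi' : hi i o = hi i' o' := hω2.next_eq hω2'
      have hlo' : lo i o = lo i' o' := Option.some.inj (hω1.2.2.symm.trans hω1'.2.2)
      -- By `hab` the edges `a` and `b` of different indices are never confused, so the two events
      -- also agree on which rival is smaller.
      have hoo : o = o' := by
        cases o <;> cases o'
        · rfl
        · exact absurd hhi' (hab i i')
        · exact absurd hlo' (hab i i')
        · rfl
      subst hoo
      have hii : i = i' := by
        cases o
        · exact hdisj i hiI i' hiI' u hω1.1 hω1'.1 hhi' hlo'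
        · exact hdisj i hiI i' hiI' u hω1.1 hω1'.1 hlo' hhi'
      rw [hii]
    · rintro ⟨i, q⟩ hp
      exact h.measurableSet_deviationEvent (hHm i (Finset.mem_product.1 hp).1 q) _ _
  calc _ ≤ ∑ i ∈ I, ∑ q ∈ K, ENNReal.ofReal (Real.exp η) *
        (P (deviationEvent s U X (H i q) q.1 (hi i q.2)) +
          ENNReal.ofReal (Real.exp η - 1) * labelMeasure V (H i q)) := Finset.sum_le_sum hmain
    _ = ENNReal.ofReal (Real.exp η) *
        (∑ p ∈ I ×ˢ K, P (deviationEvent s U X (H p.1 p.2) p.2.1 (hi p.1 p.2.2)) +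
          ENNReal.ofReal (Real.exp η - 1) * ∑ i ∈ I, ∑ q ∈ K, labelMeasure V (H i q)) := by
        rw [Finset.sum_product]
        simp only [Finset.mul_sum, mul_add, Finset.sum_add_distrib]
    _ ≤ _ := by
        gcongr with i hi'
        exact hHsum i hi'

end IsLabelledWalk

/-! ### Box events -/

/-- The labels of the edges in `I` lie in prescribed sets. -/
def box (I : Finset (V × V)) (B : V × V → Set ℝ) : Set (EdgeLabels V) :=
  {u | ∀ e ∈ I, pairLabel u e.1 e.2 ∈ B e}

/-- Different elements of `I` are different edges. -/
def IsSimple (I : Finset (V × V)) : Prop :=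
  (∀ e ∈ I, e.1 ≠ e.2) ∧ Set.InjOn (fun e : V × V => s(e.1, e.2)) I

theorem IsSimple.mono {I J : Finset (V × V)} (h : IsSimple J) (hIJ : I ⊆ J) : IsSimple I :=
  ⟨fun e he => h.1 e (hIJ he), h.2.mono (by exact_mod_cast hIJ)⟩

theorem mem_box {I : Finset (V × V)} {B : V × V → Set ℝ} {u : EdgeLabels V} :
    u ∈ box I B ↔ ∀ e ∈ I, pairLabel u e.1 e.2 ∈ B e := Iff.rfl

theorem measurableSet_box (I : Finset (V × V)) {B : V × V → Set ℝ}
    (hB : ∀ e, MeasurableSet (B e)) : MeasurableSet (box I B) := by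
  have : box I B = ⋂ e ∈ I, (fun u : EdgeLabels V => pairLabel u e.1 e.2) ⁻¹' B e := by
    ext u
    simp [mem_box]
  rw [this]
  exact Finset.measurableSet_biInter _ fun e _ => measurable_pairLabel _ _ (hB e)

theorem measureReal_box {I : Finset (V × V)} (hI : IsSimple I) {B : V × V → Set ℝ}
    (hB : ∀ e, MeasurableSet (B e)) :
    (labelMeasure V).real (box I B) = ∏ e ∈ I, unitMeasure.real (B e) := by
  rw [measureReal_def, box, labelMeasure_box hI.1 hI.2 B fun e _ => hB e, ENNReal.toReal_prod]
  rfl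

theorem measureReal_box_inter {I J : Finset (V × V)} (hIJ : IsSimple (I ∪ J)) (hd : Disjoint I J)
    {B B' : V × V → Set ℝ} (hB : ∀ e, MeasurableSet (B e)) (hB' : ∀ e, MeasurableSet (B' e)) :
    (labelMeasure V).real (box I B ∩ box J B') =
      (labelMeasure V).real (box I B) * (labelMeasure V).real (box J B') := by
  have h1 : box I B ∩ box J B' = box (I ∪ J) fun e => if e ∈ I then B e else B' e := by
    ext u
    simp only [Set.mem_inter_iff, mem_box, Finset.mem_union]
    constructor
    · rintro ⟨h, h'⟩ e he
      split_ifs with heI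
      · exact h e heI
      · exact h' e (he.resolve_left heI)
    · intro h
      refine ⟨fun e he => by simpa [he] using h e (Or.inl he), fun e he => ?_⟩
      have := h e (Or.inr he)
      rwa [if_neg (Finset.disjoint_right.1 hd he)] at this
  rw [h1, measureReal_box hIJ fun e => by split_ifs; exacts [hB e, hB' e],
    measureReal_box (hIJ.mono Finset.subset_union_left) hB,
    measureReal_box (hIJ.mono Finset.subset_union_right) hB', Finset.prod_union hd]
  congr 1
  · exact Finset.prod_congr rfl fun e he => by rw [if_pos he]
  · exact Finset.prod_congr rfl fun e he => by rw [if_neg (Finset.disjoint_right.1 hd he)]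

theorem unitMeasure_real_Iic {p : ℝ} (h0 : 0 ≤ p) (h1 : p ≤ 1) :
    unitMeasure.real (Set.Iic p) = p := by
  rw [measureReal_def, unitMeasure, Measure.restrict_apply measurableSet_Iic]
  have : Set.Iic p ∩ Set.Icc 0 1 = Set.Icc 0 p := by
    ext t
    simp only [Set.mem_inter_iff, Set.mem_Iic, Set.mem_Icc]
    constructor
    · rintro ⟨h, h', -⟩; exact ⟨h', h⟩
    · rintro ⟨h, h'⟩; exact ⟨h', h, h'.trans h1⟩
  rw [this, Real.volume_Icc, sub_zero, ENNReal.toReal_ofReal h0]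

theorem unitMeasure_real_Ioi {p : ℝ} (h0 : 0 ≤ p) (h1 : p ≤ 1) :
    unitMeasure.real (Set.Ioi p) = 1 - p := by
  rw [← Set.compl_Iic, probReal_compl_eq_one_sub measurableSet_Iic, unitMeasure_real_Iic h0 h1]

theorem unitMeasure_real_Ioc {p p' : ℝ} (h0 : 0 ≤ p) (hp : p ≤ p') (h1 : p' ≤ 1) :
    unitMeasure.real (Set.Ioc p p') = p' - p := by
  rw [measureReal_def, unitMeasure, Measure.restrict_apply measurableSet_Ioc]
  have : Set.Ioc p p' ∩ Set.Icc 0 1 = Set.Ioc p p' := by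
    refine Set.inter_eq_left.2 fun t ht => ⟨h0.trans ht.1.le, ht.2.trans h1⟩
  rw [this, Real.volume_Ioc, ENNReal.toReal_ofReal (by linarith)]

/-! ### Small clusters -/

/-- The graph of the edges inside `Q` with label at most `p`. -/
def coreGraph (Q : Finset V) (p : ℝ) (u : EdgeLabels V) : SimpleGraph V where
  Adj a b := a ≠ b ∧ a ∈ Q ∧ b ∈ Q ∧ pairLabel u a b ≤ p
  symm := ⟨fun a b h => ⟨h.1.symm, h.2.2.1, h.2.1, by rw [pairLabel_symm]; exact h.2.2.2⟩⟩
  loopless := ⟨fun a h => h.1 rfl⟩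

open Classical in
/-- The cluster of `v` in `coreGraph`. -/
def coreCluster (Q : Finset V) (p : ℝ) (u : EdgeLabels V) (v : V) : Finset V :=
  Finset.univ.filter fun w => (coreGraph Q p u).Reachable v w

theorem mem_coreCluster {Q : Finset V} {p : ℝ} {u : EdgeLabels V} {v w : V} :
    w ∈ coreCluster Q p u v ↔ (coreGraph Q p u).Reachable v w := by
  simp [coreCluster]

theorem self_mem_coreCluster (Q : Finset V) (p : ℝ) (u : EdgeLabels V) (v : V) :
    v ∈ coreCluster Q p u v :=
  mem_coreCluster.2 (SimpleGraph.Reachable.refl v)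

theorem exists_adj_dist_lt {G : SimpleGraph V} {v w : V} (h : G.Reachable v w) (hne : w ≠ v) :
    ∃ z, G.Adj w z ∧ G.dist v z < G.dist v w := by
  obtain ⟨p, hp⟩ := h.symm.exists_walk_length_eq_dist
  cases p with
  | nil => exact absurd rfl hne
  | cons hadj p =>
    refine ⟨_, hadj, ?_⟩
    rw [SimpleGraph.dist_comm (u := v) (v := w), ← hp, SimpleGraph.Walk.length_cons]
    have := SimpleGraph.dist_le p
    rw [SimpleGraph.dist_comm] at this
    omega

theorem coreCluster_subset {Q : Finset V} {p : ℝ} {u : EdgeLabels V} {v : V} (hv : v ∈ Q) :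
    coreCluster Q p u v ⊆ Q := by
  intro w hw
  by_cases hne : w = v
  · rwa [hne]
  · obtain ⟨z, hz, -⟩ := exists_adj_dist_lt (mem_coreCluster.1 hw) hne
    exact hz.2.1

/-- Candidates for the parent functions of spanning trees of `S` rooted at `v`. -/
def parentFunctions (S : Finset V) (v : V) : Finset (V → V) :=
  Fintype.piFinset fun w => if w ∈ S.erase v then S else {v}

/-- The edges of the tree with parent function `f` and the edges from `S` to the rest of `Q`. -/
def treeEdges (Q S : Finset V) (v : V) (f : V → V) : Finset (V × V) :=
  (S.erase v).image (fun w => (w, f w)) ∪ S ×ˢ (Q \ S)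

/-- Labels at most `p` inside `S`, and larger labels outside. -/
def treeBox (S : Finset V) (p : ℝ) (e : V × V) : Set ℝ :=
  if e.2 ∈ S then Set.Iic p else Set.Ioi p

theorem card_parentFunctions {S : Finset V} {v : V} (hv : v ∈ S) :
    (parentFunctions S v).card = S.card ^ (S.card - 1) := by
  rw [parentFunctions, Fintype.card_piFinset]
  have : ∀ w, (if w ∈ S.erase v then S else {v}).card = if w ∈ S.erase v then S.card else 1 := by
    intro w; split_ifs <;> simp
  simp only [this]
  rw [Finset.prod_ite_mem, Finset.univ_inter, Finset.prod_const, Finset.card_erase_of_mem hv]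

/-- Each vertex of the cluster other than `v` chooses as parent a neighbour closer to `v`. Distances
strictly decrease towards the parent, so no edge is used in both directions. The edges from the
cluster to the rest of the core must have labels above `p`. -/
theorem exists_parentFunction {Q : Finset V} {p : ℝ} {u : EdgeLabels V} {v : V} (hv : v ∈ Q) :
    ∃ f ∈ parentFunctions (coreCluster Q p u v) v,
      IsSimple (treeEdges Q (coreCluster Q p u v) v f) ∧
      u ∈ box (treeEdges Q (coreCluster Q p u v) v f) (treeBox (coreCluster Q p u v) p) := by
  classical
  set S := coreCluster Q p u v with hS
  set G := coreGraph Q p u with hG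
  have hex : ∀ w, ∃ z, w ∈ S.erase v → G.Adj w z ∧ G.dist v z < G.dist v w := by
    intro w
    by_cases hw : w ∈ S.erase v
    · obtain ⟨hne, hwS⟩ := Finset.mem_erase.1 hw
      obtain ⟨z, hz⟩ := exists_adj_dist_lt (mem_coreCluster.1 hwS) hne
      exact ⟨z, fun _ => hz⟩
    · exact ⟨v, fun h => absurd h hw⟩
  choose g hg using hex
  have hgS : ∀ w ∈ S.erase v, g w ∈ S := fun w hw => by
    rw [hS, mem_coreCluster]
    exact (mem_coreCluster.1 (Finset.mem_erase.1 hw).2).trans (hg w hw).1.reachable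
  set f : V → V := fun w => if w ∈ S.erase v then g w else v with hf
  have hfg : ∀ w ∈ S.erase v, f w = g w := fun w hw => by simp only [hf, hw, if_true]
  have hSQ : S ⊆ Q := coreCluster_subset hv
  have htree : ∀ e ∈ (S.erase v).image (fun w => (w, f w)), e.1 ∈ S.erase v ∧ e.2 = g e.1 := by
    intro e he
    obtain ⟨w, hw, rfl⟩ := Finset.mem_image.1 he
    exact ⟨hw, hfg w hw⟩
  refine ⟨f, ?_, ⟨?_, ?_⟩, ?_⟩
  · rw [parentFunctions, Fintype.mem_piFinset]
    intro w
    by_cases hw : w ∈ S.erase v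
    · rw [if_pos hw, hfg w hw]; exact hgS w hw
    · simp only [hf, hw, if_false]; simp
  · intro e he
    rcases Finset.mem_union.1 he with he | he
    · obtain ⟨h1, h2⟩ := htree e he
      rw [h2]
      exact (hg _ h1).1.ne
    · obtain ⟨h1, h2⟩ := Finset.mem_product.1 he
      exact fun h => (Finset.mem_sdiff.1 h2).2 (h ▸ h1)
  · intro e he e' he' heq
    simp only [treeEdges, Finset.coe_union, Set.mem_union, Finset.mem_coe] at he he'
    rcases Sym2.eq_iff.1 heq with ⟨h1, h2⟩ | ⟨h1, h2⟩
    · exact Prod.ext h1 h2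
    · exfalso
      rcases he with he | he
      · obtain ⟨a1, a2⟩ := htree e he
        rcases he' with he' | he'
        · obtain ⟨b1, b2⟩ := htree e' he'
          have c1 := (hg _ a1).2
          have c2 := (hg _ b1).2
          rw [← a2, h2, h1] at c1
          rw [← b2] at c2
          omega
        · exact (Finset.mem_sdiff.1 (Finset.mem_product.1 he').2).2
            (h1 ▸ (Finset.mem_erase.1 a1).2)
      · have h2S := (Finset.mem_sdiff.1 (Finset.mem_product.1 he).2).2
        rcases he' with he' | he'
        · obtain ⟨b1, b2⟩ := htree e' he'
          exact h2S (h2 ▸ (Finset.mem_erase.1 b1).2)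
        · exact h2S (h2 ▸ (Finset.mem_product.1 he').1)
  · rw [mem_box]
    intro e he
    unfold treeBox
    rcases Finset.mem_union.1 he with he | he
    · obtain ⟨h1, h2⟩ := htree e he
      rw [if_pos (h2 ▸ hgS _ h1), h2]
      exact (hg _ h1).1.2.2.2
    · obtain ⟨h1, h2⟩ := Finset.mem_product.1 he
      obtain ⟨h2Q, h2S⟩ := Finset.mem_sdiff.1 h2
      rw [if_neg h2S]
      by_contra hle
      refine h2S ?_
      rw [hS, mem_coreCluster]
      refine (mem_coreCluster.1 h1).trans (SimpleGraph.Adj.reachable ⟨?_, hSQ h1, h2Q, ?_⟩)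
      · exact fun h => h2S (h ▸ h1)
      · simpa using hle

theorem card_image_parent (S : Finset V) (v : V) (f : V → V) :
    ((S.erase v).image (fun w => (w, f w))).card = (S.erase v).card :=
  Finset.card_image_of_injective _ fun _ _ h => (Prod.ext_iff.1 h).1

theorem measureReal_treeBox {Q S : Finset V} {v : V} {f : V → V} {p : ℝ} (h0 : 0 ≤ p) (h1 : p ≤ 1)
    (hv : v ∈ S) (hSQ : S ⊆ Q) (hf : f ∈ parentFunctions S v)
    (hsimple : IsSimple (treeEdges Q S v f)) :
    (labelMeasure V).real (box (treeEdges Q S v f) (treeBox S p)) =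
      p ^ (S.card - 1) * (1 - p) ^ (S.card * (Q.card - S.card)) := by
  have hfS : ∀ w ∈ S.erase v, f w ∈ S := fun w hw => by
    have := Fintype.mem_piFinset.1 hf w
    rwa [if_pos hw] at this
  have hdisj : Disjoint ((S.erase v).image (fun w => (w, f w))) (S ×ˢ (Q \ S)) := by
    refine Finset.disjoint_left.2 fun e he he' => ?_
    obtain ⟨w, hw, rfl⟩ := Finset.mem_image.1 he
    exact (Finset.mem_sdiff.1 (Finset.mem_product.1 he').2).2 (hfS w hw)
  rw [measureReal_box hsimple fun e => by
    unfold treeBox; split_ifs; exacts [measurableSet_Iic, measurableSet_Ioi], treeEdges,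
    Finset.prod_union hdisj]
  congr 1
  · rw [← Finset.card_erase_of_mem hv, ← card_image_parent S v f, ← Finset.prod_const]
    refine Finset.prod_congr rfl fun e he => ?_
    obtain ⟨w, hw, rfl⟩ := Finset.mem_image.1 he
    rw [treeBox, if_pos (hfS w hw), unitMeasure_real_Iic h0 h1]
  · rw [← Finset.card_sdiff_of_subset hSQ, ← Finset.card_product, ← Finset.prod_const]
    refine Finset.prod_congr rfl fun e he => ?_
    rw [treeBox, if_neg (Finset.mem_sdiff.1 (Finset.mem_product.1 he).2).2,
      unitMeasure_real_Ioi h0 h1]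

/-- Use `choose (q-1) (k-1) ≤ q^(k-1) / (k-1)!` to cancel the powers of `q`, and `k (q - k) ≥ k q /
2` to bound the probability of the missing edges by `e^{-Ck/2}`. -/
theorem choose_mul_pow_le {q k : ℕ} {C : ℝ} (hC : 1 ≤ C) (hk : 1 ≤ k) (hkq : 2 * k ≤ q)
    (hq : C ≤ q) :
    ((q - 1).choose (k - 1) : ℝ) * ((k : ℝ) ^ (k - 1) * ((C / q) ^ (k - 1) *
      (1 - C / q) ^ (k * (q - k)))) ≤ (Real.exp 1 * C * Real.exp (-C / 2)) ^ k := by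
  obtain ⟨j, rfl⟩ := Nat.exists_eq_add_of_le' hk
  have hq0 : (0 : ℝ) < q := by linarith
  have hp1 : C / q ≤ 1 := (div_le_one hq0).2 hq
  have h1 : ((q - 1).choose j : ℝ) ≤ (q : ℝ) ^ j / j.factorial := by
    refine (Nat.choose_le_pow_div (α := ℝ) j (q - 1)).trans ?_
    gcongr
    exact Nat.sub_le _ _
  -- With `k = j + 1` the left side equals `k^k / k!`, one term of the series of `e^k`.
  have h2 : ((j + 1 : ℕ) : ℝ) ^ j / j.factorial ≤ Real.exp 1 ^ (j + 1) := by
    have := Real.pow_div_factorial_le_exp ((j + 1 : ℕ) : ℝ) (by positivity) (j + 1)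
    rw [← Real.exp_nat_mul, mul_one]
    refine le_trans (le_of_eq ?_) this
    rw [Nat.factorial_succ, pow_succ]
    push_cast
    field_simp
  have h3 : (1 - C / q) ^ ((j + 1) * (q - (j + 1))) ≤ Real.exp (-C / 2) ^ (j + 1) := by
    have h4 : 1 - C / q ≤ Real.exp (-(C / q)) := by
      linarith [Real.add_one_le_exp (-(C / q))]
    calc (1 - C / q) ^ ((j + 1) * (q - (j + 1)))
        ≤ Real.exp (-(C / q)) ^ ((j + 1) * (q - (j + 1))) :=
          pow_le_pow_left₀ (by linarith) h4 _
      _ ≤ Real.exp (-C / 2) ^ (j + 1) := by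
          rw [mul_comm, pow_mul]
          refine pow_le_pow_left₀ (by positivity) ?_ _
          rw [← Real.exp_nat_mul]
          refine Real.exp_le_exp.2 ?_
          rw [Nat.cast_sub (by omega)]
          have h5 : (2 : ℝ) * (j + 1 : ℕ) ≤ q := by exact_mod_cast hkq
          have h6 : (1 : ℝ) / 2 ≤ ((q : ℝ) - (j + 1 : ℕ)) / q := by
            rw [le_div_iff₀ hq0]; linarith
          have h7 := mul_le_mul_of_nonneg_left h6 (by linarith : (0 : ℝ) ≤ C)
          calc _ = -(C * (((q : ℝ) - (j + 1 : ℕ)) / q)) := by ring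
            _ ≤ _ := by linarith
  rw [Nat.add_sub_cancel]
  calc _ ≤ ((q : ℝ) ^ j / j.factorial) * (((j + 1 : ℕ) : ℝ) ^ j * ((C / q) ^ j *
        Real.exp (-C / 2) ^ (j + 1))) := by
        have : 0 ≤ (1 - C / q) ^ ((j + 1) * (q - (j + 1))) := pow_nonneg (by linarith) _
        gcongr
    _ = (((j + 1 : ℕ) : ℝ) ^ j / j.factorial) * C ^ j * Real.exp (-C / 2) ^ (j + 1) := by
        rw [div_pow]
        field_simp
    _ ≤ Real.exp 1 ^ (j + 1) * C ^ (j + 1) * Real.exp (-C / 2) ^ (j + 1) := by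
        gcongr
        exact Nat.le_succ j
    _ = _ := by rw [mul_pow, mul_pow]

/-- Small clusters are unlikely, also in the presence of an event that depends on other labels. -/
theorem measureReal_inter_small_coreCluster_le {Q : Finset V} {v : V} (hv : v ∈ Q) {C : ℝ}
    (hC : 1 ≤ C) (hq : C ≤ Q.card) (hρ : Real.exp 1 * C * Real.exp (-C / 2) ≤ 1 / 2)
    {E : Set (EdgeLabels V)}
    (hE : ∀ S f, S ⊆ Q → f ∈ parentFunctions S v → IsSimple (treeEdges Q S v f) →
      (labelMeasure V).real (E ∩ box (treeEdges Q S v f) (treeBox S (C / Q.card))) ≤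
        (labelMeasure V).real E *
          (labelMeasure V).real (box (treeEdges Q S v f) (treeBox S (C / Q.card)))) :
    (labelMeasure V).real
      (E ∩ {u | 2 * (coreCluster Q (C / Q.card) u v).card ≤ Q.card}) ≤
      (labelMeasure V).real E * (2 * (Real.exp 1 * C * Real.exp (-C / 2))) := by
  classical
  set q := Q.card with hqdef
  set p := C / q with hp
  set ρ := Real.exp 1 * C * Real.exp (-C / 2) with hρdef
  have hρ0 : 0 ≤ ρ := by positivity
  have hq0 : (0 : ℝ) < q := by linarith
  have hp0 : 0 ≤ p := by positivity
  have hp1 : p ≤ 1 := (div_le_one hq0).2 hq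
  -- Union bound over the possible clusters, `v` with `j` further vertices of the core, and over
  -- their parent functions. The terms are dominated by `ρ^(j+1)`, and `ρ ≤ 1/2` makes the series at
  -- most `2ρ`.
  set SS : ℕ → Finset (Finset V) := fun j => ((Q.erase v).powersetCard j).image (insert v) with hSS
  set FF : Finset V → Finset (V → V) := fun S => (parentFunctions S v).filter
    fun f => IsSimple (treeEdges Q S v f) with hFF
  have hmem : ∀ j, ∀ S ∈ SS j, v ∈ S ∧ S ⊆ Q ∧ S.card = j + 1 := by
    intro j S hS
    obtain ⟨R, hR, rfl⟩ := Finset.mem_image.1 hS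
    obtain ⟨hR1, hR2⟩ := Finset.mem_powersetCard.1 hR
    refine ⟨Finset.mem_insert_self _ _, Finset.insert_subset hv
      (hR1.trans (Finset.erase_subset _ _)), ?_⟩
    rw [Finset.card_insert_of_notMem (fun h => Finset.notMem_erase v Q (hR1 h)), hR2]
  have hcover : E ∩ {u | 2 * (coreCluster Q p u v).card ≤ q} ⊆
      ⋃ j ∈ Finset.range (q / 2), ⋃ S ∈ SS j, ⋃ f ∈ FF S,
        E ∩ box (treeEdges Q S v f) (treeBox S p) := by
    rintro u ⟨huE, hu⟩
    have hu : 2 * (coreCluster Q p u v).card ≤ q := hu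
    obtain ⟨f, hf, hsimple, hbox⟩ := exists_parentFunction (p := p) (u := u) hv
    have hvS := self_mem_coreCluster Q p u v
    have hpos : 0 < (coreCluster Q p u v).card := Finset.card_pos.2 ⟨v, hvS⟩
    simp only [Set.mem_iUnion]
    refine ⟨(coreCluster Q p u v).card - 1, Finset.mem_range.2 (by omega), coreCluster Q p u v,
      Finset.mem_image.2 ⟨(coreCluster Q p u v).erase v, ?_, Finset.insert_erase hvS⟩, f,
      Finset.mem_filter.2 ⟨hf, hsimple⟩, huE, hbox⟩
    exact Finset.mem_powersetCard.2 ⟨Finset.erase_subset_erase _ (coreCluster_subset hv),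
      Finset.card_erase_of_mem hvS⟩
  have hterm : ∀ j ∈ Finset.range (q / 2), ∑ S ∈ SS j, ∑ f ∈ FF S,
      (labelMeasure V).real (E ∩ box (treeEdges Q S v f) (treeBox S p)) ≤
      (labelMeasure V).real E * ρ ^ (j + 1) := by
    intro j hj
    have hj' : 2 * (j + 1) ≤ q := by
      have := Finset.mem_range.1 hj
      omega
    have hw0 : 0 ≤ p ^ j * (1 - p) ^ ((j + 1) * (q - (j + 1))) :=
      mul_nonneg (pow_nonneg hp0 _) (pow_nonneg (by linarith) _)
    calc _ ≤ ∑ S ∈ SS j, ∑ _f ∈ FF S, (labelMeasure V).real E *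
          (p ^ j * (1 - p) ^ ((j + 1) * (q - (j + 1)))) := by
          refine Finset.sum_le_sum fun S hS => Finset.sum_le_sum fun f hf => ?_
          obtain ⟨h1, h2, h3⟩ := hmem j S hS
          obtain ⟨hf1, hf2⟩ := Finset.mem_filter.1 hf
          refine (hE S f h2 hf1 hf2).trans (le_of_eq ?_)
          rw [measureReal_treeBox hp0 hp1 h1 h2 hf1 hf2, h3, Nat.add_sub_cancel]
      _ ≤ ∑ _S ∈ SS j, ((j + 1 : ℕ) : ℝ) ^ j * ((labelMeasure V).real E *
          (p ^ j * (1 - p) ^ ((j + 1) * (q - (j + 1))))) := by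
          refine Finset.sum_le_sum fun S hS => ?_
          obtain ⟨h1, h2, h3⟩ := hmem j S hS
          rw [Finset.sum_const, nsmul_eq_mul]
          refine mul_le_mul_of_nonneg_right ?_ (mul_nonneg measureReal_nonneg hw0)
          have : (FF S).card ≤ _ :=
            (Finset.card_filter_le _ _).trans_eq (card_parentFunctions (S := S) h1)
          rw [h3, Nat.add_sub_cancel] at this
          exact_mod_cast this
      _ ≤ ((q - 1).choose j : ℝ) * (((j + 1 : ℕ) : ℝ) ^ j * ((labelMeasure V).real E *
          (p ^ j * (1 - p) ^ ((j + 1) * (q - (j + 1)))))) := by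
          rw [Finset.sum_const, nsmul_eq_mul]
          refine mul_le_mul_of_nonneg_right ?_
            (mul_nonneg (by positivity) (mul_nonneg measureReal_nonneg hw0))
          have : (SS j).card ≤ (q - 1).choose j := by
            refine Finset.card_image_le.trans ?_
            rw [Finset.card_powersetCard, Finset.card_erase_of_mem hv]
          exact_mod_cast this
      _ = (labelMeasure V).real E * (((q - 1).choose (j + 1 - 1) : ℝ) *
          (((j + 1 : ℕ) : ℝ) ^ (j + 1 - 1) * ((C / q) ^ (j + 1 - 1) *
            (1 - C / q) ^ ((j + 1) * (q - (j + 1)))))) := by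
          rw [Nat.add_sub_cancel]; ring
      _ ≤ _ := mul_le_mul_of_nonneg_left (choose_mul_pow_le hC (by omega) hj' hq) measureReal_nonneg
  calc _ ≤ (labelMeasure V).real (⋃ j ∈ Finset.range (q / 2), ⋃ S ∈ SS j, ⋃ f ∈ FF S,
        E ∩ box (treeEdges Q S v f) (treeBox S p)) :=
        measureReal_mono hcover (measure_ne_top _ _)
    _ ≤ ∑ j ∈ Finset.range (q / 2), ∑ S ∈ SS j, ∑ f ∈ FF S,
        (labelMeasure V).real (E ∩ box (treeEdges Q S v f) (treeBox S p)) := by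
        refine (measureReal_biUnion_finset_le _ _).trans (Finset.sum_le_sum fun j _ => ?_)
        refine (measureReal_biUnion_finset_le _ _).trans (Finset.sum_le_sum fun S _ => ?_)
        exact measureReal_biUnion_finset_le _ _
    _ ≤ ∑ j ∈ Finset.range (q / 2), (labelMeasure V).real E * ρ ^ (j + 1) :=
        Finset.sum_le_sum hterm
    _ = (labelMeasure V).real E * (ρ * ∑ j ∈ Finset.range (q / 2), ρ ^ j) := by
        rw [← Finset.mul_sum, Finset.mul_sum _ _ ρ]
        congr 1
        exact Finset.sum_congr rfl fun j _ => by ring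
    _ ≤ (labelMeasure V).real E * (2 * ρ) := by
        refine mul_le_mul_of_nonneg_left ?_ measureReal_nonneg
        have : ∑ j ∈ Finset.range (q / 2), ρ ^ j ≤ 2 := by
          refine (Finset.sum_le_sum fun j _ => pow_le_pow_left₀ hρ0 hρ j).trans ?_
          exact sum_geometric_two_le _
        nlinarith

theorem IsSimple.union {I J : Finset (V × V)} (hI : IsSimple I) (hJ : IsSimple J)
    (hne : ∀ e ∈ I, ∀ e' ∈ J, s(e.1, e.2) ≠ s(e'.1, e'.2)) : IsSimple (I ∪ J) := by
  refine ⟨fun e he => (Finset.mem_union.1 he).elim (hI.1 e) (hJ.1 e), ?_⟩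
  intro e he e' he' heq
  simp only [Finset.coe_union, Set.mem_union, Finset.mem_coe] at he he'
  rcases he with he | he <;> rcases he' with he' | he'
  · exact hI.2 he he' heq
  · exact absurd heq (hne e he e' he')
  · exact absurd heq.symm (hne e' he' e he)
  · exact hJ.2 he he' heq

theorem disjoint_of_sym2_ne {I J : Finset (V × V)}
    (hne : ∀ e ∈ I, ∀ e' ∈ J, s(e.1, e.2) ≠ s(e'.1, e'.2)) : Disjoint I J :=
  Finset.disjoint_left.2 fun e he he' => hne e he e he' rfl

theorem measureReal_box_inter_of_ne {I J : Finset (V × V)} (hI : IsSimple I) (hJ : IsSimple J)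
    (hne : ∀ e ∈ I, ∀ e' ∈ J, s(e.1, e.2) ≠ s(e'.1, e'.2)) {B B' : V × V → Set ℝ}
    (hB : ∀ e, MeasurableSet (B e)) (hB' : ∀ e, MeasurableSet (B' e)) :
    (labelMeasure V).real (box I B ∩ box J B') =
      (labelMeasure V).real (box I B) * (labelMeasure V).real (box J B') :=
  measureReal_box_inter (hI.union hJ hne) (disjoint_of_sym2_ne hne) hB hB'

theorem exists_box_inter {I J : Finset (V × V)} (hd : Disjoint I J) {B B' : V × V → Set ℝ}
    (hB : ∀ e, MeasurableSet (B e)) (hB' : ∀ e, MeasurableSet (B' e)) :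
    ∃ B'' : V × V → Set ℝ, (∀ e, MeasurableSet (B'' e)) ∧ box I B ∩ box J B' = box (I ∪ J) B'' := by
  refine ⟨fun e => if e ∈ I then B e else B' e, fun e => by
    beta_reduce; split_ifs; exacts [hB e, hB' e], ?_⟩
  ext u
  simp only [Set.mem_inter_iff, mem_box, Finset.mem_union]
  constructor
  · rintro ⟨h, h'⟩ e he
    by_cases heI : e ∈ I
    · simpa [heI] using h e heI
    · simpa [heI] using h' e (he.resolve_left heI)
  · intro h
    refine ⟨fun e he => by simpa [he] using h e (Or.inl he), fun e he => ?_⟩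
    simpa [Finset.disjoint_right.1 hd he] using h e (Or.inr he)

/-! ### Candidates for rival pairs -/

/-- A core `Q`, two disjoint sets of further vertices, and a division of an interval of labels
above `p₁` into `L` bins of length `δ`. -/
structure RivalSetup (V : Type*) [Fintype V] [DecidableEq V] where
  Q : Finset V
  Y₁ : Finset V
  Y₂ : Finset V
  p₁ : ℝ
  δ : ℝ
  L : ℕ
  disj₁ : Disjoint Q Y₁
  disj₂ : Disjoint Q Y₂
  disj : Disjoint Y₁ Y₂
  cover : Q ∪ (Y₁ ∪ Y₂) = Finset.univ
  p₁_nonneg : 0 ≤ p₁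
  δ_pos : 0 < δ
  le_one : p₁ + L * δ ≤ 1

namespace RivalSetup

variable (D : RivalSetup V)

/-- The upper end of the interval of labels. -/
def p₂ : ℝ := D.p₁ + D.L * D.δ

/-- The bin with number `i`. -/
def bin (i : ℕ) : Set ℝ := Set.Ioc (D.p₁ + i * D.δ) (D.p₁ + (i + 1) * D.δ)

/-- The edge `a` is the only edge between its end outside of the core and the core which has a label
at most `p₂`, and this label is in the bin `i`. -/
def column (i : ℕ) (a : V × V) : Set (EdgeLabels V) :=
  box (D.Q ×ˢ {a.2}) fun e => if e = a then D.bin i else Set.Ioi D.p₂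

/-- The indices of the candidates: a bin and two edges. -/
def indices : Finset (ℕ × (V × V) × (V × V)) :=
  Finset.range D.L ×ˢ ((D.Q ×ˢ D.Y₁) ×ˢ (D.Q ×ˢ D.Y₂))

/-- The event that both edges of a candidate have labels in the bin. -/
def candidate (t : ℕ × (V × V) × (V × V)) : Set (EdgeLabels V) :=
  D.column t.1 t.2.1 ∩ D.column t.1 t.2.2

/-- The probability of a candidate. -/
def r₀ : ℝ := (D.δ * (1 - D.p₂) ^ (D.Q.card - 1)) ^ 2

variable {D}

theorem mem_indices {t : ℕ × (V × V) × (V × V)} : t ∈ D.indices ↔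
    t.1 < D.L ∧ (t.2.1.1 ∈ D.Q ∧ t.2.1.2 ∈ D.Y₁) ∧ (t.2.2.1 ∈ D.Q ∧ t.2.2.2 ∈ D.Y₂) := by
  simp [indices, Finset.mem_product]

theorem disjoint_Y (D : RivalSetup V) : Disjoint D.Q (D.Y₁ ∪ D.Y₂) :=
  Finset.disjoint_union_right.2 ⟨D.disj₁, D.disj₂⟩

theorem p₁_le_p₂ (D : RivalSetup V) : D.p₁ ≤ D.p₂ := by
  have := mul_nonneg (Nat.cast_nonneg (α := ℝ) D.L) D.δ_pos.le
  unfold p₂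
  linarith

theorem p₂_nonneg (D : RivalSetup V) : 0 ≤ D.p₂ := D.p₁_nonneg.trans D.p₁_le_p₂

theorem bin_upper_le {i : ℕ} (hi : i < D.L) : D.p₁ + (i + 1) * D.δ ≤ D.p₂ := by
  have : ((i : ℝ) + 1) ≤ D.L := by exact_mod_cast hi
  have := mul_le_mul_of_nonneg_right this D.δ_pos.le
  unfold p₂
  linarith

theorem le_p₂_of_mem_bin {i : ℕ} (hi : i < D.L) {t : ℝ} (ht : t ∈ D.bin i) : t ≤ D.p₂ :=
  ht.2.trans (bin_upper_le hi)

theorem p₁_lt_of_mem_bin {i : ℕ} {t : ℝ} (ht : t ∈ D.bin i) : D.p₁ < t := by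
  have h1 := ht.1
  have := mul_nonneg (Nat.cast_nonneg (α := ℝ) i) D.δ_pos.le
  linarith

theorem bin_inj {i j : ℕ} {t : ℝ} (hi : t ∈ D.bin i) (hj : t ∈ D.bin j) : i = j := by
  have key : ∀ {i j : ℕ}, t ∈ D.bin i → t ∈ D.bin j → ¬ i < j := by
    intro i j hi hj hij
    have h1 : ((i : ℝ) + 1) ≤ j := by exact_mod_cast hij
    have h2 := mul_le_mul_of_nonneg_right h1 D.δ_pos.le
    have h3 := hi.2
    have h4 := hj.1
    linarith
  exact le_antisymm (not_lt.1 (key hj hi)) (not_lt.1 (key hi hj))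

theorem abs_sub_le_of_mem_bin {i : ℕ} {t t' : ℝ} (ht : t ∈ D.bin i) (ht' : t' ∈ D.bin i) :
    |t - t'| ≤ D.δ := by
  obtain ⟨h1, h2⟩ := ht
  obtain ⟨h3, h4⟩ := ht'
  rw [abs_le]
  constructor <;> linarith

theorem measurableSet_bin (i : ℕ) : MeasurableSet (D.bin i) := measurableSet_Ioc

theorem measure_bin {i : ℕ} (hi : i < D.L) : unitMeasure.real (D.bin i) = D.δ := by
  have h0 := mul_nonneg (Nat.cast_nonneg (α := ℝ) i) D.δ_pos.le
  have h1 := D.p₁_nonneg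
  have h2 := D.δ_pos
  rw [bin, unitMeasure_real_Ioc (by linarith) (by linarith) ((bin_upper_le hi).trans D.le_one)]
  ring

theorem measurableSet_columnBox (i : ℕ) (a e : V × V) :
    MeasurableSet (if e = a then D.bin i else Set.Ioi D.p₂) := by
  split_ifs
  · exact measurableSet_bin i
  · exact measurableSet_Ioi

theorem isSimple_of_subset_product {A B : Finset V} (hAB : Disjoint A B) {I : Finset (V × V)}
    (hI : I ⊆ A ×ˢ B) : IsSimple I := by
  refine ⟨fun e he h => ?_, fun e he e' he' heq => ?_⟩
  · obtain ⟨h1, h2⟩ := Finset.mem_product.1 (hI he)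
    exact Finset.disjoint_left.1 hAB h1 (h ▸ h2)
  · rcases Sym2.eq_iff.1 heq with ⟨h1, h2⟩ | ⟨h1, h2⟩
    · exact Prod.ext h1 h2
    · obtain ⟨h3, -⟩ := Finset.mem_product.1 (hI he)
      obtain ⟨-, h4⟩ := Finset.mem_product.1 (hI he')
      exact absurd h4 (Finset.disjoint_left.1 hAB (h1 ▸ h3))

theorem column_subset_product {y : V} (hy : y ∈ D.Y₁ ∪ D.Y₂) :
    D.Q ×ˢ {y} ⊆ D.Q ×ˢ (D.Y₁ ∪ D.Y₂) :=
  Finset.product_subset_product_right (Finset.singleton_subset_iff.2 hy)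

theorem sym2_ne_of_disjoint {A B : Finset V} (hAB : Disjoint A B) {I J : Finset (V × V)}
    (hI : I ⊆ A ×ˢ B) (hJ : J ⊆ A ×ˢ B) (hIJ : Disjoint I J) :
    ∀ e ∈ I, ∀ e' ∈ J, s(e.1, e.2) ≠ s(e'.1, e'.2) := by
  intro e he e' he' heq
  have := (isSimple_of_subset_product hAB (Finset.union_subset hI hJ)).2
    (by simp [he]) (by simp [he']) heq
  exact Finset.disjoint_left.1 hIJ he (this ▸ he')

theorem measureReal_column {i : ℕ} (hi : i < D.L) {a : V × V} (ha1 : a.1 ∈ D.Q)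
    (ha2 : a.2 ∈ D.Y₁ ∪ D.Y₂) :
    (labelMeasure V).real (D.column i a) = D.δ * (1 - D.p₂) ^ (D.Q.card - 1) := by
  rw [column, measureReal_box (isSimple_of_subset_product D.disjoint_Y (column_subset_product ha2))
    (measurableSet_columnBox i a)]
  have hmem : a ∈ D.Q ×ˢ ({a.2} : Finset V) := by simp [ha1]
  rw [← Finset.mul_prod_erase _ _ hmem, if_pos rfl, measure_bin hi]
  congr 1
  have : D.Q.card - 1 = ((D.Q ×ˢ ({a.2} : Finset V)).erase a).card := by
    rw [Finset.card_erase_of_mem hmem, Finset.card_product, Finset.card_singleton, mul_one]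
  rw [this, ← Finset.prod_const]
  refine Finset.prod_congr rfl fun e he => ?_
  rw [if_neg (Finset.ne_of_mem_erase he), unitMeasure_real_Ioi D.p₂_nonneg D.le_one]

theorem disjoint_columns {y y' : V} (h : y ≠ y') :
    Disjoint (D.Q ×ˢ ({y} : Finset V)) (D.Q ×ˢ ({y'} : Finset V)) := by
  refine Finset.disjoint_left.2 fun e he he' => h ?_
  simp only [Finset.mem_product, Finset.mem_singleton] at he he'
  rw [← he.2, he'.2]

theorem ne_of_mem_indices {t t' : ℕ × (V × V) × (V × V)} (ht : t ∈ D.indices)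
    (ht' : t' ∈ D.indices) : t.2.1.2 ≠ t'.2.2.2 := fun h =>
  Finset.disjoint_left.1 D.disj (mem_indices.1 ht).2.1.2 (h ▸ (mem_indices.1 ht').2.2.2)

theorem measureReal_candidate {t : ℕ × (V × V) × (V × V)} (ht : t ∈ D.indices) :
    (labelMeasure V).real (D.candidate t) = D.r₀ := by
  obtain ⟨hi, ⟨ha1, ha2⟩, hb1, hb2⟩ := mem_indices.1 ht
  have ha2' := Finset.mem_union_left D.Y₂ ha2
  have hb2' := Finset.mem_union_right D.Y₁ hb2
  rw [candidate, column, column, measureReal_box_inter_of_ne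
    (isSimple_of_subset_product D.disjoint_Y (column_subset_product ha2'))
    (isSimple_of_subset_product D.disjoint_Y (column_subset_product hb2'))
    (sym2_ne_of_disjoint D.disjoint_Y (column_subset_product ha2') (column_subset_product hb2')
      (disjoint_columns (ne_of_mem_indices ht ht)))
    (measurableSet_columnBox _ _) (measurableSet_columnBox _ _), ← column, ← column,
    measureReal_column hi ha1 ha2', measureReal_column hi hb1 hb2', r₀, sq]

theorem exists_candidate_box {t : ℕ × (V × V) × (V × V)} (ht : t ∈ D.indices) :
    ∃ B : V × V → Set ℝ, (∀ e, MeasurableSet (B e)) ∧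
      D.candidate t = box (D.Q ×ˢ {t.2.1.2} ∪ D.Q ×ˢ {t.2.2.2}) B :=
  exists_box_inter (disjoint_columns (ne_of_mem_indices ht ht))
    (measurableSet_columnBox _ _) (measurableSet_columnBox _ _)

theorem candidate_support_subset {t : ℕ × (V × V) × (V × V)} (ht : t ∈ D.indices) :
    D.Q ×ˢ {t.2.1.2} ∪ D.Q ×ˢ {t.2.2.2} ⊆ D.Q ×ˢ (D.Y₁ ∪ D.Y₂) := by
  obtain ⟨hi, ⟨ha1, ha2⟩, hb1, hb2⟩ := mem_indices.1 ht
  exact Finset.union_subset (column_subset_product (Finset.mem_union_left D.Y₂ ha2))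
    (column_subset_product (Finset.mem_union_right D.Y₁ hb2))

theorem measurableSet_candidate (t : ℕ × (V × V) × (V × V)) : MeasurableSet (D.candidate t) :=
  (measurableSet_box _ (measurableSet_columnBox _ _)).inter
    (measurableSet_box _ (measurableSet_columnBox _ _))

theorem label_mem_bin_of_column {i : ℕ} {a : V × V} (ha : a.1 ∈ D.Q) {u : EdgeLabels V}
    (hu : u ∈ D.column i a) : pairLabel u a.1 a.2 ∈ D.bin i := by
  have := hu a (by simp [ha])
  simpa using this

theorem lt_label_of_column {i : ℕ} {a : V × V} {x : V} (hx : x ∈ D.Q) (hxa : x ≠ a.1)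
    {u : EdgeLabels V} (hu : u ∈ D.column i a) : D.p₂ < pairLabel u x a.2 := by
  have := hu (x, a.2) (by simp [hx])
  have hne : (x, a.2) ≠ a := fun h => hxa (congrArg Prod.fst h)
  simpa [hne] using this

/-- Two column events with the same column are equal or incompatible. -/
theorem column_unique {i i' : ℕ} {a a' : V × V} (hi : i < D.L) (ha : a.1 ∈ D.Q)
    (haa : a.2 = a'.2) {u : EdgeLabels V} (hu : u ∈ D.column i a) (hu' : u ∈ D.column i' a') :
    a = a' ∧ (a'.1 ∈ D.Q → i = i') := by
  have h1 := label_mem_bin_of_column ha hu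
  have haa' : a = a' := by
    by_contra hne
    have h2 := lt_label_of_column ha (fun h => hne (Prod.ext h haa)) hu'
    rw [← haa] at h2
    exact absurd (le_p₂_of_mem_bin hi h1) (not_le.2 h2)
  refine ⟨haa', fun ha' => ?_⟩
  subst haa'
  exact bin_inj h1 (label_mem_bin_of_column ha hu')

theorem measureReal_three_bins_le {i : ℕ} (hi : i < D.L) {a b c : V × V}
    (ha : a ∈ D.Q ×ˢ (D.Y₁ ∪ D.Y₂)) (hb : b ∈ D.Q ×ˢ (D.Y₁ ∪ D.Y₂))
    (hc : c ∈ D.Q ×ˢ (D.Y₁ ∪ D.Y₂)) (hab : a ≠ b) (hac : a ≠ c) (hbc : b ≠ c)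
    {E : Set (EdgeLabels V)} (hE : ∀ u ∈ E, pairLabel u a.1 a.2 ∈ D.bin i ∧
      pairLabel u b.1 b.2 ∈ D.bin i ∧ pairLabel u c.1 c.2 ∈ D.bin i) :
    (labelMeasure V).real E ≤ D.δ ^ 3 := by
  have hsub : E ⊆ box {a, b, c} fun _ => D.bin i := by
    intro u hu e he
    obtain ⟨h1, h2, h3⟩ := hE u hu
    simp only [Finset.mem_insert, Finset.mem_singleton] at he
    rcases he with rfl | rfl | rfl
    exacts [h1, h2, h3]
  refine (measureReal_mono hsub (measure_ne_top _ _)).trans (le_of_eq ?_)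
  rw [measureReal_box (isSimple_of_subset_product D.disjoint_Y (I := {a, b, c}) (by
      intro e he
      simp only [Finset.mem_insert, Finset.mem_singleton] at he
      rcases he with rfl | rfl | rfl
      exacts [ha, hb, hc])) fun _ => measurableSet_bin i]
  rw [Finset.prod_const, measure_bin hi, Finset.card_eq_three.2 ⟨a, b, c, hab, hac, hbc, rfl⟩]

-- Candidates on four different columns are independent, which gives `r₀²`. If they share a column,
-- `column_unique` forces the same edge and bin there, unless the intersection is empty. Then either
-- the candidates coincide or three different edges have labels in one bin, which has probability at
-- most `δ³`.
open Classical in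
theorem measureReal_candidate_inter_le {t t' : ℕ × (V × V) × (V × V)} (ht : t ∈ D.indices)
    (ht' : t' ∈ D.indices) :
    (labelMeasure V).real (D.candidate t ∩ D.candidate t') ≤
      D.r₀ ^ 2 + (if t = t' then D.r₀ else 0) +
      (if t.1 = t'.1 ∧ t.2.1 = t'.2.1 then D.δ ^ 3 else 0) +
      (if t.1 = t'.1 ∧ t.2.2 = t'.2.2 then D.δ ^ 3 else 0) := by
  have hr0 : 0 ≤ D.r₀ := sq_nonneg _
  have hδ3 : 0 ≤ D.δ ^ 3 := pow_nonneg D.δ_pos.le 3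
  have n2 : (0 : ℝ) ≤ if t = t' then D.r₀ else 0 := by split_ifs <;> simp [hr0]
  have n3 : (0 : ℝ) ≤ if t.1 = t'.1 ∧ t.2.1 = t'.2.1 then D.δ ^ 3 else 0 := by
    split_ifs <;> simp [hδ3]
  have n4 : (0 : ℝ) ≤ if t.1 = t'.1 ∧ t.2.2 = t'.2.2 then D.δ ^ 3 else 0 := by
    split_ifs <;> simp [hδ3]
  have n1 : 0 ≤ D.r₀ ^ 2 := sq_nonneg _
  by_cases hempty : D.candidate t ∩ D.candidate t' = ∅
  · rw [hempty, measureReal_empty]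
    linarith
  obtain ⟨u₀, hu₀, hu₀'⟩ := Set.nonempty_iff_ne_empty.2 hempty
  obtain ⟨hi, ⟨ha1, ha2⟩, hb1, hb2⟩ := mem_indices.1 ht
  obtain ⟨hi', ⟨ha1', ha2'⟩, hb1', hb2'⟩ := mem_indices.1 ht'
  have hmem : ∀ {x : V × V}, x.1 ∈ D.Q → (x.2 ∈ D.Y₁ ∨ x.2 ∈ D.Y₂) →
      x ∈ D.Q ×ˢ (D.Y₁ ∪ D.Y₂) := fun h1 h2 =>
    Finset.mem_product.2 ⟨h1, Finset.mem_union.2 h2⟩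
  have hab : t.2.1 ≠ t.2.2 := fun h => ne_of_mem_indices ht ht (by rw [h])
  have hab' : t.2.1 ≠ t'.2.2 := fun h => ne_of_mem_indices ht ht' (by rw [h])
  have ha'b : t'.2.1 ≠ t.2.2 := fun h => ne_of_mem_indices ht' ht (by rw [h])
  by_cases hA : t.2.1.2 = t'.2.1.2
  · obtain ⟨haa, hii⟩ := column_unique hi ha1 hA hu₀.1 hu₀'.1
    have hii := hii ha1'
    have e3 : (if t.1 = t'.1 ∧ t.2.1 = t'.2.1 then D.δ ^ 3 else 0) = D.δ ^ 3 := if_pos ⟨hii, haa⟩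
    by_cases hB : t.2.2.2 = t'.2.2.2
    · obtain ⟨hbb, -⟩ := column_unique hi hb1 hB hu₀.2 hu₀'.2
      have htt : t = t' := Prod.ext hii (Prod.ext haa hbb)
      have e2 : (if t = t' then D.r₀ else 0) = D.r₀ := if_pos htt
      have e1 : (labelMeasure V).real (D.candidate t ∩ D.candidate t') = D.r₀ := by
        rw [htt, Set.inter_self, measureReal_candidate ht']
      linarith
    · have := measureReal_three_bins_le hi (hmem ha1 (Or.inl ha2)) (hmem hb1 (Or.inr hb2))
        (hmem hb1' (Or.inr hb2')) hab hab' (fun h => hB (by rw [h]))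
        (E := D.candidate t ∩ D.candidate t') fun u hu =>
          ⟨label_mem_bin_of_column ha1 hu.1.1, label_mem_bin_of_column hb1 hu.1.2,
            hii ▸ label_mem_bin_of_column hb1' hu.2.2⟩
      linarith
  · by_cases hB : t.2.2.2 = t'.2.2.2
    · obtain ⟨hbb, hii⟩ := column_unique hi hb1 hB hu₀.2 hu₀'.2
      have hii := hii hb1'
      have e4 : (if t.1 = t'.1 ∧ t.2.2 = t'.2.2 then D.δ ^ 3 else 0) = D.δ ^ 3 :=
        if_pos ⟨hii, hbb⟩
      have := measureReal_three_bins_le hi (hmem ha1 (Or.inl ha2)) (hmem ha1' (Or.inl ha2'))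
        (hmem hb1 (Or.inr hb2)) (fun h => hA (by rw [h])) hab ha'b
        (E := D.candidate t ∩ D.candidate t') fun u hu =>
          ⟨label_mem_bin_of_column ha1 hu.1.1, hii ▸ label_mem_bin_of_column ha1' hu.2.1,
            label_mem_bin_of_column hb1 hu.1.2⟩
      linarith
    · obtain ⟨B, hBm, hBeq⟩ := exists_candidate_box ht
      obtain ⟨B', hBm', hBeq'⟩ := exists_candidate_box ht'
      have hS := candidate_support_subset ht
      have hS' := candidate_support_subset ht'
      have hd : Disjoint (D.Q ×ˢ {t.2.1.2} ∪ D.Q ×ˢ {t.2.2.2})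
          (D.Q ×ˢ {t'.2.1.2} ∪ D.Q ×ˢ {t'.2.2.2}) := by
        rw [Finset.disjoint_union_left, Finset.disjoint_union_right, Finset.disjoint_union_right]
        exact ⟨⟨disjoint_columns hA, disjoint_columns (ne_of_mem_indices ht ht')⟩,
          disjoint_columns (ne_of_mem_indices ht' ht).symm, disjoint_columns hB⟩
      have := measureReal_box_inter_of_ne (isSimple_of_subset_product D.disjoint_Y hS)
        (isSimple_of_subset_product D.disjoint_Y hS')
        (sym2_ne_of_disjoint D.disjoint_Y hS hS' hd) hBm hBm'
      rw [← hBeq, ← hBeq', measureReal_candidate ht, measureReal_candidate ht'] at this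
      rw [this]
      nlinarith

/-! ### First and second moments of the number of candidates -/

/-- The number of candidates. -/
def count (D : RivalSetup V) (u : EdgeLabels V) : ℝ :=
  ∑ t ∈ D.indices, (D.candidate t).indicator 1 u

/-- The expected number of candidates. -/
def mean (D : RivalSetup V) : ℝ := D.indices.card * D.r₀

theorem measurable_indicator_candidate (t : ℕ × (V × V) × (V × V)) :
    Measurable ((D.candidate t).indicator (1 : EdgeLabels V → ℝ)) :=
  measurable_one.indicator (measurableSet_candidate t)

theorem integrable_indicator {E : Set (EdgeLabels V)} (hE : MeasurableSet E) :
    Integrable (E.indicator (1 : EdgeLabels V → ℝ)) (labelMeasure V) :=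
  (integrable_const (1 : ℝ)).indicator hE

theorem integral_count (D : RivalSetup V) : ∫ u, D.count u ∂labelMeasure V = D.mean := by
  unfold count mean
  rw [integral_finsetSum _ fun t _ => integrable_indicator (measurableSet_candidate t)]
  rw [Finset.sum_congr rfl fun t ht => by
    rw [integral_indicator_one (measurableSet_candidate t), measureReal_candidate ht],
    Finset.sum_const, nsmul_eq_mul]

theorem card_indices (D : RivalSetup V) : (D.indices.card : ℝ) =
    D.L * ((D.Q.card * D.Y₁.card) * (D.Q.card * D.Y₂.card)) := by
  simp [indices, Finset.card_product]

open Classical in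
theorem integral_count_sq_le (D : RivalSetup V) :
    ∫ u, D.count u ^ 2 ∂labelMeasure V ≤ D.mean ^ 2 + D.mean +
      D.L * D.δ ^ 3 * ((D.Q.card * D.Y₁.card) * (D.Q.card * D.Y₂.card) ^ 2 +
        (D.Q.card * D.Y₁.card) ^ 2 * (D.Q.card * D.Y₂.card)) := by
  have hsq : ∀ u, D.count u ^ 2 = ∑ t ∈ D.indices, ∑ t' ∈ D.indices,
      (D.candidate t ∩ D.candidate t').indicator (1 : EdgeLabels V → ℝ) u := by
    intro u
    rw [count, sq, Finset.sum_mul_sum]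
    refine Finset.sum_congr rfl fun t _ => Finset.sum_congr rfl fun t' _ => ?_
    rw [Set.inter_indicator_one]
    rfl
  have hm : ∀ t t', MeasurableSet (D.candidate t ∩ D.candidate t') := fun t t' =>
    (measurableSet_candidate t).inter (measurableSet_candidate t')
  have hint : ∫ u, D.count u ^ 2 ∂labelMeasure V = ∑ t ∈ D.indices, ∑ t' ∈ D.indices,
      (labelMeasure V).real (D.candidate t ∩ D.candidate t') := by
    simp only [hsq]
    rw [integral_finsetSum _ fun t _ => integrable_finsetSum _ fun t' _ =>
      integrable_indicator (hm t t')]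
    refine Finset.sum_congr rfl fun t _ => ?_
    rw [integral_finsetSum _ fun t' _ => integrable_indicator (hm t t')]
    exact Finset.sum_congr rfl fun t' _ => integral_indicator_one (hm t t')
  rw [hint]
  refine (Finset.sum_le_sum fun t ht => Finset.sum_le_sum fun t' ht' =>
    measureReal_candidate_inter_le ht ht').trans (le_of_eq ?_)
  simp only [Finset.sum_add_distrib]
  have s1 : ∑ _t ∈ D.indices, ∑ _t' ∈ D.indices, D.r₀ ^ 2 = D.mean ^ 2 := by
    simp only [Finset.sum_const, nsmul_eq_mul, mean]
    ring
  have s2 : ∑ t ∈ D.indices, ∑ t' ∈ D.indices, (if t = t' then D.r₀ else 0) = D.mean := by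
    have : ∀ t ∈ D.indices, ∑ t' ∈ D.indices, (if t = t' then D.r₀ else 0) = D.r₀ := fun t ht => by
      rw [Finset.sum_ite_eq, if_pos ht]
    rw [Finset.sum_congr rfl this, Finset.sum_const, nsmul_eq_mul, mean]
  have hcount : ∀ t ∈ D.indices,
      (D.indices.filter fun t' => t.1 = t'.1 ∧ t.2.1 = t'.2.1).card = D.Q.card * D.Y₂.card ∧
      (D.indices.filter fun t' => t.1 = t'.1 ∧ t.2.2 = t'.2.2).card = D.Q.card * D.Y₁.card := by
    intro t ht
    obtain ⟨hi, ha, hb⟩ := mem_indices.1 ht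
    constructor
    · have : (D.indices.filter fun t' => t.1 = t'.1 ∧ t.2.1 = t'.2.1) =
          {t.1} ×ˢ ({t.2.1} ×ˢ (D.Q ×ˢ D.Y₂)) := by
        ext t'
        simp only [Finset.mem_filter, mem_indices, Finset.mem_product, Finset.mem_singleton]
        constructor
        · rintro ⟨⟨-, -, h3⟩, h1, h2⟩
          exact ⟨h1.symm, h2.symm, h3⟩
        · rintro ⟨h1, h2, h3⟩
          exact ⟨⟨h1 ▸ hi, h2 ▸ ha, h3⟩, h1.symm, h2.symm⟩
      rw [this]
      simp [Finset.card_product]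
    · have : (D.indices.filter fun t' => t.1 = t'.1 ∧ t.2.2 = t'.2.2) =
          {t.1} ×ˢ ((D.Q ×ˢ D.Y₁) ×ˢ {t.2.2}) := by
        ext t'
        simp only [Finset.mem_filter, mem_indices, Finset.mem_product, Finset.mem_singleton]
        constructor
        · rintro ⟨⟨-, h3, -⟩, h1, h2⟩
          exact ⟨h1.symm, h3, h2.symm⟩
        · rintro ⟨h1, h3, h2⟩
          exact ⟨⟨h1 ▸ hi, h3, h2 ▸ hb⟩, h1.symm, h2.symm⟩
      rw [this]
      simp [Finset.card_product]
  have s3 : ∑ t ∈ D.indices, ∑ t' ∈ D.indices,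
      (if t.1 = t'.1 ∧ t.2.1 = t'.2.1 then D.δ ^ 3 else 0) =
      D.indices.card * (D.Q.card * D.Y₂.card * D.δ ^ 3) := by
    rw [← nsmul_eq_mul, ← Finset.sum_const]
    refine Finset.sum_congr rfl fun t ht => ?_
    rw [← Finset.sum_filter, Finset.sum_const, (hcount t ht).1, nsmul_eq_mul]
    push_cast
    ring
  have s4 : ∑ t ∈ D.indices, ∑ t' ∈ D.indices,
      (if t.1 = t'.1 ∧ t.2.2 = t'.2.2 then D.δ ^ 3 else 0) =
      D.indices.card * (D.Q.card * D.Y₁.card * D.δ ^ 3) := by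
    rw [← nsmul_eq_mul, ← Finset.sum_const]
    refine Finset.sum_congr rfl fun t ht => ?_
    rw [← Finset.sum_filter, Finset.sum_const, (hcount t ht).2, nsmul_eq_mul]
    push_cast
    ring
  rw [s1, s2, s3, s4, card_indices]
  ring

theorem integrable_count (D : RivalSetup V) : Integrable D.count (labelMeasure V) :=
  integrable_finsetSum _ fun t _ => integrable_indicator (measurableSet_candidate t)

theorem abs_count_le (D : RivalSetup V) (u : EdgeLabels V) : |D.count u| ≤ D.indices.card := by
  unfold count
  refine (Finset.abs_sum_le_sum_abs _ _).trans ?_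
  rw [← nsmul_one, ← Finset.sum_const]
  refine Finset.sum_le_sum fun t _ => ?_
  by_cases h : u ∈ D.candidate t <;> simp [h]

theorem measurable_count (D : RivalSetup V) : Measurable D.count :=
  Finset.measurable_fun_sum _ fun t _ => measurable_indicator_candidate t

theorem integrable_count_sq (D : RivalSetup V) :
    Integrable (fun u => D.count u ^ 2) (labelMeasure V) := by
  refine Integrable.of_bound (D.measurable_count.pow_const 2).aestronglyMeasurable
    ((D.indices.card : ℝ) ^ 2) (ae_of_all _ fun u => ?_)
  rw [Real.norm_eq_abs, abs_pow]
  exact pow_le_pow_left₀ (abs_nonneg _) (D.abs_count_le u) 2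

/-- Chebyshev's inequality for the number of candidates. -/
theorem measureReal_count_le (D : RivalSetup V) (hm : 0 < D.mean) :
    (labelMeasure V).real {u | D.count u ≤ D.mean / 2} ≤ 4 / D.mean ^ 2 * (D.mean +
      D.L * D.δ ^ 3 * ((D.Q.card * D.Y₁.card) * (D.Q.card * D.Y₂.card) ^ 2 +
        (D.Q.card * D.Y₁.card) ^ 2 * (D.Q.card * D.Y₂.card))) := by
  set R := D.L * D.δ ^ 3 * ((D.Q.card * D.Y₁.card) * (D.Q.card * D.Y₂.card) ^ 2 +
        (D.Q.card * D.Y₁.card) ^ 2 * (D.Q.card * D.Y₂.card)) with hR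
  have hexp : (fun u => (D.count u - D.mean) ^ 2) =
      fun u => D.count u ^ 2 - 2 * D.mean * D.count u + D.mean ^ 2 := by
    funext u; ring
  have hi1 : Integrable (fun u => D.count u ^ 2 - 2 * D.mean * D.count u) (labelMeasure V) :=
    D.integrable_count_sq.sub (D.integrable_count.const_mul _)
  have hi : Integrable (fun u => (D.count u - D.mean) ^ 2) (labelMeasure V) := by
    rw [hexp]
    exact hi1.add (integrable_const _)
  have hvar : ∫ u, (D.count u - D.mean) ^ 2 ∂labelMeasure V ≤ D.mean + R := by
    rw [hexp, integral_add hi1 (integrable_const _), integral_sub D.integrable_count_sq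
      (D.integrable_count.const_mul _), integral_const_mul, integral_count, integral_const]
    have := D.integral_count_sq_le
    simp only [probReal_univ, smul_eq_mul, one_mul]
    linarith
  have hmk := mul_meas_ge_le_integral_of_nonneg (μ := labelMeasure V)
    (f := fun u => (D.count u - D.mean) ^ 2) (ae_of_all _ fun u => sq_nonneg _) hi
    ((D.mean / 2) ^ 2)
  have hsub : {u | D.count u ≤ D.mean / 2} ⊆
      {u | (D.mean / 2) ^ 2 ≤ (D.count u - D.mean) ^ 2} := by
    intro u hu
    have hu : D.count u ≤ D.mean / 2 := hu
    change (D.mean / 2) ^ 2 ≤ (D.count u - D.mean) ^ 2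
    nlinarith
  have h1 : (labelMeasure V).real {u | D.count u ≤ D.mean / 2} ≤
      (labelMeasure V).real {u | (D.mean / 2) ^ 2 ≤ (D.count u - D.mean) ^ 2} :=
    measureReal_mono hsub (measure_ne_top _ _)
  have h2 : (D.mean / 2) ^ 2 * (labelMeasure V).real {u | D.count u ≤ D.mean / 2} ≤ D.mean + R :=
    (mul_le_mul_of_nonneg_left h1 (sq_nonneg _)).trans (hmk.trans hvar)
  rw [div_mul_eq_mul_div, le_div_iff₀ (by positivity)]
  nlinarith

end RivalSetup

theorem measurableSet_coreCluster (Q : Finset V) (p : ℝ) (v : V) (S : Finset V) :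
    MeasurableSet {u : EdgeLabels V | coreCluster Q p u v = S} := by
  classical
  refine measurableSet_fiber_of_factor
    (g := fun u : EdgeLabels V => Finset.univ.filter fun e : V × V => pairLabel u e.1 e.2 ≤ p)
    (fun M => ?_) (fun u u' h => ?_) S
  · have hset : {u : EdgeLabels V | (Finset.univ.filter fun e : V × V =>
        pairLabel u e.1 e.2 ≤ p) = M} =
        box Finset.univ fun e => if e ∈ M then Set.Iic p else Set.Ioi p := by
      ext u
      simp only [Set.mem_ofPred_eq, mem_box, Finset.ext_iff, Finset.mem_filter, Finset.mem_univ,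
        true_and, forall_true_left]
      refine forall_congr' fun e => ?_
      by_cases he : e ∈ M <;> simp [he]
    rw [hset]
    refine measurableSet_box _ fun e => ?_
    split_ifs
    exacts [measurableSet_Iic, measurableSet_Ioi]
  · have hle : ∀ a b, pairLabel u a b ≤ p ↔ pairLabel u' a b ≤ p := fun a b => by
      have := Finset.ext_iff.1 h (a, b)
      simpa using this
    have hG : coreGraph Q p u = coreGraph Q p u' := by
      ext a b
      simp only [coreGraph, hle]
    unfold coreCluster
    rw [hG]

theorem measurableSet_injective : MeasurableSet {u : EdgeLabels V | Function.Injective u} := by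
  have : {u : EdgeLabels V | Function.Injective u} =
      ⋂ e, ⋂ e', {u : EdgeLabels V | u e = u e' → e = e'} := by
    ext u
    simp [Function.Injective]
  rw [this]
  refine MeasurableSet.iInter fun e => MeasurableSet.iInter fun e' => ?_
  by_cases h : e = e'
  · simp [h]
  · have : {u : EdgeLabels V | u e = u e' → e = e'} = {u | u e = u e'}ᶜ := by
      ext u
      simp [h]
    rw [this]
    exact (measurableSet_eq_fun (measurable_pi_apply e) (measurable_pi_apply e')).compl

/-! ### Events that spoil a candidate -/

namespace RivalSetup

variable (D : RivalSetup V)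

/-- The cluster of `v` contains at most half of the core. -/
def smallCluster (v : V) : Set (EdgeLabels V) :=
  {u | 2 * (coreCluster D.Q D.p₁ u v).card ≤ D.Q.card}

/-- There is an edge with a small label between `y` and another vertex outside of the core. -/
def dirty (y : V) : Set (EdgeLabels V) :=
  ⋃ z ∈ (D.Y₁ ∪ D.Y₂).erase y, box {(y, z)} fun _ => Set.Iic D.p₂

/-- The events that could prevent the edges of a candidate from being rivals. -/
def bad (s : V) (t : ℕ × (V × V) × (V × V)) : Set (EdgeLabels V) :=
  (D.smallCluster s ∪ D.smallCluster t.2.1.1 ∪ D.smallCluster t.2.2.1) ∪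
    (D.dirty t.2.1.2 ∪ D.dirty t.2.2.2)

/-- A candidate whose edges are rivals. -/
def good (s : V) (t : ℕ × (V × V) × (V × V)) : Set (EdgeLabels V) :=
  (D.candidate t \ D.bad s t) ∩ {u | Function.Injective u}

variable {D}

theorem measurableSet_smallCluster (v : V) : MeasurableSet (D.smallCluster v) := by
  have : D.smallCluster v = ⋃ S ∈ {S : Finset V | 2 * S.card ≤ D.Q.card},
      {u : EdgeLabels V | coreCluster D.Q D.p₁ u v = S} := by
    ext u
    simp [smallCluster]
  rw [this]
  exact MeasurableSet.biUnion (Set.to_countable _) fun S _ => measurableSet_coreCluster _ _ _ _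

theorem measurableSet_dirty (y : V) : MeasurableSet (D.dirty y) :=
  Finset.measurableSet_biUnion _ fun _ _ => measurableSet_box _ fun _ => measurableSet_Iic

theorem measurableSet_bad (s : V) (t : ℕ × (V × V) × (V × V)) : MeasurableSet (D.bad s t) :=
  (((measurableSet_smallCluster _).union (measurableSet_smallCluster _)).union
    (measurableSet_smallCluster _)).union ((measurableSet_dirty _).union (measurableSet_dirty _))

theorem measurableSet_good (s : V) (t : ℕ × (V × V) × (V × V)) : MeasurableSet (D.good s t) :=
  ((measurableSet_candidate t).diff (measurableSet_bad s t)).inter measurableSet_injective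

theorem lt_label_of_notMem_dirty {y z : V} (hz : z ∈ D.Y₁ ∪ D.Y₂) (hzy : z ≠ y)
    {u : EdgeLabels V} (hu : u ∉ D.dirty y) : D.p₂ < pairLabel u y z := by
  by_contra hle
  refine hu ?_
  simp only [dirty, Set.mem_iUnion]
  exact ⟨z, Finset.mem_erase.2 ⟨hzy, hz⟩, by simpa [mem_box] using hle⟩

theorem mem_dirty {y : V} {u : EdgeLabels V} :
    u ∈ D.dirty y ↔ ∃ z ∈ (D.Y₁ ∪ D.Y₂).erase y, pairLabel u y z ≤ D.p₂ := by
  simp [dirty, mem_box]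

theorem sym2_ne_of_mem_disjoint {A B : Finset V} (hAB : Disjoint A B) {e e' : V × V}
    (h1 : e.1 ∈ A) (h2 : e.2 ∈ B) (h : (e'.1 ∈ A ∧ e'.2 ∈ A) ∨ (e'.1 ∈ B ∧ e'.2 ∈ B)) :
    s(e.1, e.2) ≠ s(e'.1, e'.2) := by
  intro heq
  have hd := Finset.disjoint_left.1 hAB
  rcases Sym2.eq_iff.1 heq with ⟨h3, h4⟩ | ⟨h3, h4⟩ <;> rw [h3] at h1 <;> rw [h4] at h2 <;>
    rcases h with ⟨h5, h6⟩ | ⟨h5, h6⟩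
  · exact hd h6 h2
  · exact hd h1 h5
  · exact hd h5 h2
  · exact hd h1 h6

/-- A candidate reads only labels between the core and its complement, the clusters only labels
inside the core. Hence the tree boxes are independent of the candidate. -/
theorem measureReal_candidate_inter_smallCluster_le {t : ℕ × (V × V) × (V × V)}
    (ht : t ∈ D.indices) {v : V} (hv : v ∈ D.Q) {C : ℝ} (hC : 1 ≤ C) (hq : C ≤ D.Q.card)
    (hp : D.p₁ = C / D.Q.card) (hρ : Real.exp 1 * C * Real.exp (-C / 2) ≤ 1 / 2) :
    (labelMeasure V).real (D.candidate t ∩ D.smallCluster v) ≤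
      D.r₀ * (2 * (Real.exp 1 * C * Real.exp (-C / 2))) := by
  rw [smallCluster, hp, ← measureReal_candidate ht]
  refine measureReal_inter_small_coreCluster_le hv hC hq hρ fun S f hSQ hf hsimple => ?_
  obtain ⟨B, hBm, hB⟩ := exists_candidate_box ht
  have hsupp := candidate_support_subset ht
  rw [hB]
  refine (measureReal_box_inter_of_ne (isSimple_of_subset_product D.disjoint_Y hsupp) hsimple
    (fun e he e' he' => ?_) hBm fun e => ?_).le
  · obtain ⟨h1, h2⟩ := Finset.mem_product.1 (hsupp he)
    refine sym2_ne_of_mem_disjoint D.disjoint_Y h1 h2 (Or.inl ?_)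
    rcases Finset.mem_union.1 he' with h | h
    · obtain ⟨w, hw, rfl⟩ := Finset.mem_image.1 h
      have := Fintype.mem_piFinset.1 hf w
      rw [if_pos hw] at this
      exact ⟨hSQ (Finset.mem_of_mem_erase hw), hSQ this⟩
    · obtain ⟨h3, h4⟩ := Finset.mem_product.1 h
      exact ⟨hSQ h3, (Finset.mem_sdiff.1 h4).1⟩
  · unfold treeBox
    split_ifs
    exacts [measurableSet_Iic, measurableSet_Ioi]

/-- The labels that make `y` dirty belong to edges outside of the core, which the candidate does not
read; each of them is at most `p₂` with probability `p₂`. -/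
theorem measureReal_candidate_inter_dirty_le {t : ℕ × (V × V) × (V × V)} (ht : t ∈ D.indices)
    {y : V} (hy : y ∈ D.Y₁ ∪ D.Y₂) :
    (labelMeasure V).real (D.candidate t ∩ D.dirty y) ≤
      D.r₀ * (((D.Y₁.card : ℝ) + D.Y₂.card) * D.p₂) := by
  obtain ⟨B, hBm, hB⟩ := exists_candidate_box ht
  have hsupp := candidate_support_subset ht
  have hr : 0 ≤ D.r₀ := sq_nonneg _
  have hterm : ∀ z ∈ (D.Y₁ ∪ D.Y₂).erase y,
      (labelMeasure V).real (D.candidate t ∩ box {(y, z)} fun _ => Set.Iic D.p₂) =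
        D.r₀ * D.p₂ := by
    intro z hz
    obtain ⟨hzy, hz⟩ := Finset.mem_erase.1 hz
    have hs : IsSimple {(y, z)} := ⟨by simpa using hzy.symm, by simp⟩
    rw [hB, measureReal_box_inter_of_ne (isSimple_of_subset_product D.disjoint_Y hsupp) hs
      (fun e he e' he' => ?_) hBm fun _ => measurableSet_Iic, ← hB, measureReal_candidate ht,
      measureReal_box hs fun _ => measurableSet_Iic, Finset.prod_singleton,
      unitMeasure_real_Iic D.p₂_nonneg D.le_one]
    obtain ⟨h1, h2⟩ := Finset.mem_product.1 (hsupp he)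
    rw [Finset.mem_singleton.1 he']
    exact sym2_ne_of_mem_disjoint D.disjoint_Y h1 h2 (Or.inr ⟨hy, hz⟩)
  rw [dirty, Set.inter_iUnion₂]
  refine (measureReal_biUnion_finset_le _ _).trans ?_
  rw [Finset.sum_congr rfl hterm, Finset.sum_const, nsmul_eq_mul]
  have hcard : ((((D.Y₁ ∪ D.Y₂).erase y).card : ℕ) : ℝ) ≤ (D.Y₁.card : ℝ) + D.Y₂.card := by
    exact_mod_cast (Finset.card_erase_le).trans (Finset.card_union_le _ _)
  calc _ ≤ ((D.Y₁.card : ℝ) + D.Y₂.card) * (D.r₀ * D.p₂) :=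
        mul_le_mul_of_nonneg_right hcard (mul_nonneg hr D.p₂_nonneg)
    _ = _ := by ring

theorem measureReal_candidate_inter_bad_le {s : V} (hs : s ∈ D.Q) {t : ℕ × (V × V) × (V × V)}
    (ht : t ∈ D.indices) {C : ℝ} (hC : 1 ≤ C) (hq : C ≤ D.Q.card)
    (hp : D.p₁ = C / D.Q.card) (hρ : Real.exp 1 * C * Real.exp (-C / 2) ≤ 1 / 2) :
    (labelMeasure V).real (D.candidate t ∩ D.bad s t) ≤
      D.r₀ * (6 * (Real.exp 1 * C * Real.exp (-C / 2)) +
        2 * (((D.Y₁.card : ℝ) + D.Y₂.card) * D.p₂)) := by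
  obtain ⟨-, ⟨ha1, ha2⟩, hb1, hb2⟩ := mem_indices.1 ht
  simp only [bad, Set.inter_union_distrib_left]
  have h1 := measureReal_candidate_inter_smallCluster_le ht hs hC hq hp hρ
  have h2 := measureReal_candidate_inter_smallCluster_le ht ha1 hC hq hp hρ
  have h3 := measureReal_candidate_inter_smallCluster_le ht hb1 hC hq hp hρ
  have h4 := measureReal_candidate_inter_dirty_le ht (Finset.mem_union_left D.Y₂ ha2)
  have h5 := measureReal_candidate_inter_dirty_le ht (Finset.mem_union_right D.Y₁ hb2)
  refine (measureReal_union_le _ _).trans ((add_le_add ((measureReal_union_le _ _).trans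
    (add_le_add (measureReal_union_le _ _) le_rfl)) (measureReal_union_le _ _)).trans ?_)
  linarith

/-! ### Good candidates are rival pairs -/

/-- Two clusters that each contain more than half of the core intersect. -/
theorem reachable_of_large {u : EdgeLabels V} {v w : V} (hv : v ∈ D.Q) (hw : w ∈ D.Q)
    (hlv : u ∉ D.smallCluster v) (hlw : u ∉ D.smallCluster w) :
    (coreGraph D.Q D.p₁ u).Reachable v w := by
  have h1 : D.Q.card < 2 * (coreCluster D.Q D.p₁ u v).card := not_le.1 hlv
  have h2 : D.Q.card < 2 * (coreCluster D.Q D.p₁ u w).card := not_le.1 hlw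
  have h3 := Finset.card_union_add_card_inter (coreCluster D.Q D.p₁ u v)
    (coreCluster D.Q D.p₁ u w)
  have h4 := Finset.card_le_card (Finset.union_subset (coreCluster_subset (p := D.p₁) (u := u) hv)
    (coreCluster_subset (p := D.p₁) (u := u) hw))
  obtain ⟨z, hz⟩ := Finset.card_pos.1
    (show 0 < (coreCluster D.Q D.p₁ u v ∩ coreCluster D.Q D.p₁ u w).card by omega)
  obtain ⟨hz1, hz2⟩ := Finset.mem_inter.1 hz
  exact (mem_coreCluster.1 hz1).trans (mem_coreCluster.1 hz2).symm

/-- The inner end is joined to `s` through core labels at most `p₁ < τ`. The outer end is isolated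
below `τ`: its edges to the core other than `a` have labels above `p₂` by the column event, those to
other outer vertices because it is not dirty, and `a` itself has a label of at least `τ`. -/
theorem mem_exitSteps_lowCluster {s : V} (hs : s ∈ D.Q) {a : V × V} (ha1 : a.1 ∈ D.Q)
    (ha2 : a.2 ∈ D.Y₁ ∪ D.Y₂) {i : ℕ} {u : EdgeLabels V} (hu : u ∈ D.column i a)
    (hls : u ∉ D.smallCluster s) (hla : u ∉ D.smallCluster a.1) (hd : u ∉ D.dirty a.2) {τ : ℝ}
    (hτ1 : D.p₁ < τ) (hτ2 : τ ≤ D.p₂) (hτa : τ ≤ pairLabel u a.1 a.2) :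
    a ∈ exitSteps (lowCluster u s τ) := by
  rw [mem_exitSteps, mem_lowCluster, mem_lowCluster]
  have hle : coreGraph D.Q D.p₁ u ≤ labelGraph u (· < τ) := fun v w h =>
    ⟨h.1, h.2.2.2.trans_lt hτ1⟩
  refine ⟨(reachable_of_large hs ha1 hls hla).mono hle, fun hreach => ?_⟩
  have hne : a.2 ≠ s := fun h => Finset.disjoint_left.1 D.disjoint_Y hs (h ▸ ha2)
  obtain ⟨z, hz, -⟩ := exists_adj_dist_lt hreach hne
  have hlt : pairLabel u a.2 z < τ := hz.2
  rcases Finset.mem_union.1 (D.cover ▸ Finset.mem_univ z) with hzQ | hzY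
  · rw [pairLabel_symm] at hlt
    by_cases hza : z = a.1
    · rw [hza] at hlt
      exact absurd hτa (not_le.2 hlt)
    · exact absurd (hlt.trans_le hτ2) (not_lt.2 (lt_label_of_column hzQ hza hu).le)
  · exact absurd (hlt.trans_le hτ2)
      (not_lt.2 (lt_label_of_notMem_dirty hzY hz.ne.symm hd).le)

theorem notMem_bad {s : V} {t : ℕ × (V × V) × (V × V)} {u : EdgeLabels V} :
    u ∉ D.bad s t ↔ (u ∉ D.smallCluster s ∧ u ∉ D.smallCluster t.2.1.1 ∧
      u ∉ D.smallCluster t.2.2.1) ∧ u ∉ D.dirty t.2.1.2 ∧ u ∉ D.dirty t.2.2.2 := by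
  simp only [bad, Set.mem_union]
  tauto

theorem isRivalPair_of_good {s : V} (hs : s ∈ D.Q) {t : ℕ × (V × V) × (V × V)}
    (ht : t ∈ D.indices) {u : EdgeLabels V} (hu : u ∈ D.good s t) :
    IsRivalPair s t.2.1 t.2.2 u ∧
      |pairLabel u t.2.1.1 t.2.1.2 - pairLabel u t.2.2.1 t.2.2.2| ≤ D.δ := by
  obtain ⟨hi, ⟨ha1, ha2⟩, hb1, hb2⟩ := mem_indices.1 ht
  obtain ⟨⟨⟨hca, hcb⟩, hbad⟩, hinj⟩ := hu
  obtain ⟨⟨hls, hla, hlb⟩, hda, hdb⟩ := notMem_bad.1 hbad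
  have hba := label_mem_bin_of_column ha1 hca
  have hbb := label_mem_bin_of_column hb1 hcb
  have hτ1 := lt_min (p₁_lt_of_mem_bin hba) (p₁_lt_of_mem_bin hbb)
  have hτ2 := (min_le_left (pairLabel u t.2.1.1 t.2.1.2) (pairLabel u t.2.2.1 t.2.2.2)).trans
    (le_p₂_of_mem_bin hi hba)
  refine ⟨⟨hinj, fun h => ne_of_mem_indices ht ht (by rw [h]), ?_, ?_⟩,
    abs_sub_le_of_mem_bin hba hbb⟩
  · exact mem_exitSteps_lowCluster hs ha1 (Finset.mem_union_left _ ha2) hca hls hla hda hτ1 hτ2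
      (min_le_left _ _)
  · exact mem_exitSteps_lowCluster hs hb1 (Finset.mem_union_right _ hb2) hcb hls hlb hdb hτ1 hτ2
      (min_le_right _ _)

section Swap

variable {a b : V × V} (ha : a.1 ≠ a.2) (hb : b.1 ≠ b.2)

theorem pairLabel_swapLabels_of_core_or_not (ha1 : a.1 ∈ D.Q) (ha2 : a.2 ∈ D.Y₁ ∪ D.Y₂)
    (hb1 : b.1 ∈ D.Q) (hb2 : b.2 ∈ D.Y₁ ∪ D.Y₂) (u : EdgeLabels V) {x y : V}
    (h : (x ∈ D.Q ∧ y ∈ D.Q) ∨ (x ∈ D.Y₁ ∪ D.Y₂ ∧ y ∈ D.Y₁ ∪ D.Y₂)) :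
    pairLabel (swapLabels ha hb u) x y = pairLabel u x y :=
  pairLabel_swapLabels_of_ne ha hb u
    (sym2_ne_of_mem_disjoint D.disjoint_Y ha1 ha2 (e' := (x, y)) h).symm
    (sym2_ne_of_mem_disjoint D.disjoint_Y hb1 hb2 (e' := (x, y)) h).symm

theorem pairLabel_swapLabels_of_column (ha1 : a.1 ∈ D.Q) (ha2 : a.2 ∈ D.Y₁ ∪ D.Y₂)
    (hb1 : b.1 ∈ D.Q) (hb2 : b.2 ∈ D.Y₁ ∪ D.Y₂) (u : EdgeLabels V) {e : V × V}
    (he : e ∈ D.Q ×ˢ (D.Y₁ ∪ D.Y₂)) (hea : e ≠ a) (heb : e ≠ b) :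
    pairLabel (swapLabels ha hb u) e.1 e.2 = pairLabel u e.1 e.2 := by
  have hs : IsSimple (D.Q ×ˢ (D.Y₁ ∪ D.Y₂)) :=
    isSimple_of_subset_product D.disjoint_Y subset_rfl
  exact pairLabel_swapLabels_of_ne ha hb u
    (fun h => hea (hs.2 he (Finset.mem_coe.2 (Finset.mem_product.2 ⟨ha1, ha2⟩)) h))
    (fun h => heb (hs.2 he (Finset.mem_coe.2 (Finset.mem_product.2 ⟨hb1, hb2⟩)) h))

end Swap

/-- The two exchanged labels lie in the same bin, so both columns keep their form, and no label
inside the core or outside of it is touched. -/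
theorem swapLabels_mem_good {s : V} {t : ℕ × (V × V) × (V × V)} (ht : t ∈ D.indices)
    (ha : t.2.1.1 ≠ t.2.1.2) (hb : t.2.2.1 ≠ t.2.2.2) {u : EdgeLabels V} (hu : u ∈ D.good s t) :
    swapLabels ha hb u ∈ D.good s t := by
  obtain ⟨hi, ⟨ha1, ha2⟩, hb1, hb2⟩ := mem_indices.1 ht
  replace ha2 := Finset.mem_union_left D.Y₂ ha2
  replace hb2 := Finset.mem_union_right D.Y₁ hb2
  have hne := ne_of_mem_indices ht ht
  obtain ⟨⟨⟨hca, hcb⟩, hbad⟩, hinj⟩ := hu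
  have hba := label_mem_bin_of_column ha1 hca
  have hbb := label_mem_bin_of_column hb1 hcb
  have hkeep : ∀ {x y : V}, (x ∈ D.Q ∧ y ∈ D.Q) ∨ (x ∈ D.Y₁ ∪ D.Y₂ ∧ y ∈ D.Y₁ ∪ D.Y₂) →
      pairLabel (swapLabels ha hb u) x y = pairLabel u x y := fun h =>
    pairLabel_swapLabels_of_core_or_not ha hb ha1 ha2 hb1 hb2 u h
  have hG : coreGraph D.Q D.p₁ (swapLabels ha hb u) = coreGraph D.Q D.p₁ u := by
    ext x y
    refine and_congr_right fun _ => and_congr_right fun hx => and_congr_right fun hy => ?_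
    rw [hkeep (Or.inl ⟨hx, hy⟩)]
  have hsmall : ∀ v, swapLabels ha hb u ∈ D.smallCluster v ↔ u ∈ D.smallCluster v := fun v => by
    have : coreCluster D.Q D.p₁ (swapLabels ha hb u) v = coreCluster D.Q D.p₁ u v := by
      ext w
      rw [mem_coreCluster, mem_coreCluster, hG]
    simp only [smallCluster, this, Set.mem_ofPred_eq]
  have hdirty : ∀ y ∈ D.Y₁ ∪ D.Y₂, swapLabels ha hb u ∈ D.dirty y ↔ u ∈ D.dirty y := by
    intro y hy
    rw [mem_dirty, mem_dirty]
    refine exists_congr fun z => and_congr_right fun hz => ?_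
    rw [hkeep (Or.inr ⟨hy, Finset.mem_of_mem_erase hz⟩)]
  refine ⟨⟨⟨?_, ?_⟩, ?_⟩, swapLabels_injective ha hb hinj⟩
  · intro e he
    have he2 : e.2 = t.2.1.2 := Finset.mem_singleton.1 (Finset.mem_product.1 he).2
    by_cases hea : e = t.2.1
    · simp only [hea, if_true]
      rwa [pairLabel_swapLabels_left]
    · rw [pairLabel_swapLabels_of_column ha hb ha1 ha2 hb1 hb2 u (column_subset_product ha2 he) hea
        fun h => hne (by rw [← he2, h])]
      exact hca e he
  · intro e he
    have he2 : e.2 = t.2.2.2 := Finset.mem_singleton.1 (Finset.mem_product.1 he).2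
    by_cases heb : e = t.2.2
    · simp only [heb, if_true]
      rwa [pairLabel_swapLabels_right]
    · rw [pairLabel_swapLabels_of_column ha hb ha1 ha2 hb1 hb2 u (column_subset_product hb2 he)
        (fun h => hne (by rw [← he2, h])) heb]
      exact hcb e he
  · rw [notMem_bad] at hbad ⊢
    simpa only [hsmall, hdirty _ ha2, hdirty _ hb2] using hbad

theorem good_unique {s : V} {t t' : ℕ × (V × V) × (V × V)} (ht : t ∈ D.indices)
    {u : EdgeLabels V} (hu : u ∈ D.good s t) (hu' : u ∈ D.good s t') (h1 : t.2.1 = t'.2.1)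
    (h2 : t.2.2 = t'.2.2) : t = t' := by
  have ha1 := (mem_indices.1 ht).2.1.1
  have hb := label_mem_bin_of_column ha1 hu.1.1.1
  have hb' := label_mem_bin_of_column (h1 ▸ ha1) hu'.1.1.1
  rw [← h1] at hb'
  exact Prod.ext (bin_inj hb hb') (Prod.ext h1 h2)

end RivalSetup

/-! ### Upper bound for the probability of agreement -/

/-- Markov's inequality for the number of events that occur. -/
theorem mul_measureReal_sum_indicator_ge_le {α ι : Type*} [MeasurableSpace α] (ν : Measure α)
    [IsFiniteMeasure ν] (I : Finset ι) {E : ι → Set α} (hE : ∀ i ∈ I, MeasurableSet (E i)) (c : ℝ) :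
    c * ν.real {x | c ≤ ∑ i ∈ I, (E i).indicator (1 : α → ℝ) x} ≤ ∑ i ∈ I, ν.real (E i) := by
  have hint : ∀ i ∈ I, Integrable ((E i).indicator (1 : α → ℝ)) ν := fun i hi =>
    (integrable_const (1 : ℝ)).indicator (hE i hi)
  refine (mul_meas_ge_le_integral_of_nonneg (ae_of_all _ fun x => Finset.sum_nonneg fun i _ =>
    Set.indicator_nonneg (f := 1) (fun _ _ => zero_le_one) x)
    (integrable_finsetSum _ hint) c).trans
    (le_of_eq ?_)
  rw [integral_finsetSum _ hint]
  exact Finset.sum_congr rfl fun i hi => integral_indicator_one (hE i hi)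

namespace IsLabelledWalk

variable {Ω : Type*} [MeasurableSpace Ω] {P : Measure Ω} {β : ℝ} {s : V}
  {U : (⊤ : SimpleGraph V).edgeSet → Ω → ℝ} {X : ℕ → Ω → V}

theorem measureReal_labels (h : IsLabelledWalk P β s U X) {E : Set (EdgeLabels V)}
    (hE : MeasurableSet E) :
    P.real {ω | (fun e => U e ω) ∈ E} = (labelMeasure V).real E := by
  rw [← h.map_labels, measureReal_def, measureReal_def, Measure.map_apply h.measurable_labels hE]
  rfl

theorem sum_measureReal_agreement_good_le (h : IsLabelledWalk P β s U X)
    (hV : 2 ≤ Fintype.card V) (hβ : 0 ≤ β) (D : RivalSetup V) (hs : s ∈ D.Q) {η : ℝ}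
    (hη : β * D.δ ≤ η) :
    ∑ t ∈ D.indices, P.real ({ω | (fun e => U e ω) ∈ D.good s t} ∩ agreementEvent s U X) ≤
      Real.exp η * (1 + (Real.exp η - 1) * D.mean) := by
  have := h.isProbabilityMeasure
  have hη0 : 0 ≤ η := (mul_nonneg hβ D.δ_pos.le).trans hη
  have hθ : 0 ≤ Real.exp η - 1 := by linarith [Real.add_one_le_exp η]
  have hne : ∀ {a : V × V}, a.1 ∈ D.Q → a.2 ∈ D.Y₁ ∪ D.Y₂ → a.1 ≠ a.2 := fun h1 h2 heq =>
    Finset.disjoint_left.1 D.disjoint_Y h1 (heq ▸ h2)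
  have ha : ∀ t : D.indices, t.1.2.1.1 ≠ t.1.2.1.2 := fun t =>
    hne (RivalSetup.mem_indices.1 t.2).2.1.1
      (Finset.mem_union_left _ (RivalSetup.mem_indices.1 t.2).2.1.2)
  have hb : ∀ t : D.indices, t.1.2.2.1 ≠ t.1.2.2.2 := fun t =>
    hne (RivalSetup.mem_indices.1 t.2).2.2.1
      (Finset.mem_union_right _ (RivalSetup.mem_indices.1 t.2).2.2.2)
  have key := sum_measure_agreement_le (Finset.univ : Finset D.indices) h hV hβ (η := η)
    (fun t => t.1.2.1) (fun t => t.1.2.2) (fun t => D.good s t.1)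
    (fun t _ => RivalSetup.measurableSet_good s t.1) ha hb
    (fun t _ u hu => by
      obtain ⟨h1, h2⟩ := RivalSetup.isRivalPair_of_good hs t.2 hu
      exact ⟨h1, (mul_le_mul_of_nonneg_left h2 hβ).trans hη⟩)
    (fun t _ u hu => RivalSetup.swapLabels_mem_good t.2 (ha t) (hb t) hu)
    (fun t t' heq => RivalSetup.ne_of_mem_indices t.2 t'.2 (congrArg Prod.snd heq))
    (fun t _ t' _ u hu hu' h1 h2 => Subtype.ext (RivalSetup.good_unique t.2 hu hu' h1 h2))
  have hr : 0 ≤ D.r₀ := sq_nonneg _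
  have hsum : ∑ t : D.indices, labelMeasure V (D.good s t.1) ≤ ENNReal.ofReal D.mean := by
    rw [Finset.sum_coe_sort D.indices fun t => labelMeasure V (D.good s t), RivalSetup.mean,
      ← nsmul_eq_mul, ← Finset.sum_const, ENNReal.ofReal_sum_of_nonneg fun _ _ => hr]
    refine Finset.sum_le_sum fun t ht => ?_
    rw [← RivalSetup.measureReal_candidate ht, ofReal_measureReal]
    exact measure_mono fun u hu => hu.1.1
  have hm : 0 ≤ D.mean := mul_nonneg (Nat.cast_nonneg _) (sq_nonneg _)
  have key2 := key.trans (mul_le_mul_right (add_le_add_right (mul_le_mul_right hsum _) _) _)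
  rw [Finset.sum_coe_sort D.indices fun t => P (agreementEvent s U X ∩
      {ω | (fun e => U e ω) ∈ D.good s t}), ← ENNReal.ofReal_mul hθ, ← ENNReal.ofReal_one,
    ← ENNReal.ofReal_add zero_le_one (mul_nonneg hθ hm),
    ← ENNReal.ofReal_mul (Real.exp_pos _).le] at key2
  have h3 := ENNReal.toReal_mono ENNReal.ofReal_ne_top key2
  rw [ENNReal.toReal_sum fun _ _ => measure_ne_top _ _,
    ENNReal.toReal_ofReal (mul_nonneg (Real.exp_pos _).le
      (add_nonneg zero_le_one (mul_nonneg hθ hm)))] at h3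
  refine le_trans (le_of_eq (Finset.sum_congr rfl fun t _ => ?_)) h3
  rw [Set.inter_comm, measureReal_def]

/-- An upper bound for the probability that the two algorithms agree. -/
theorem agreementEvent_le (h : IsLabelledWalk P β s U X) (hV : 2 ≤ Fintype.card V) (hβ : 0 ≤ β)
    (D : RivalSetup V) (hs : s ∈ D.Q) {C : ℝ} (hC : 1 ≤ C) (hq : C ≤ D.Q.card)
    (hp : D.p₁ = C / D.Q.card) (hρ : Real.exp 1 * C * Real.exp (-C / 2) ≤ 1 / 2)
    (hm : 0 < D.mean) {η : ℝ} (hη : β * D.δ ≤ η) :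
    P.real (agreementEvent s U X) ≤
      4 / D.mean ^ 2 * (D.mean +
        D.L * D.δ ^ 3 * ((D.Q.card * D.Y₁.card) * (D.Q.card * D.Y₂.card) ^ 2 +
          (D.Q.card * D.Y₁.card) ^ 2 * (D.Q.card * D.Y₂.card))) +
      4 * (6 * (Real.exp 1 * C * Real.exp (-C / 2)) +
        2 * (((D.Y₁.card : ℝ) + D.Y₂.card) * D.p₂)) +
      4 * Real.exp η * (1 / D.mean + (Real.exp η - 1)) := by
  have hprob := h.isProbabilityMeasure
  set m := D.mean with hmdef
  set A := agreementEvent s U X with hA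
  set lab : Ω → EdgeLabels V := fun ω e => U e ω with hlab
  let N : EdgeLabels V → ℝ := fun u => ∑ t ∈ D.indices,
    (D.candidate t ∩ D.bad s t).indicator (1 : EdgeLabels V → ℝ) u
  have hNm : ∀ t ∈ D.indices, MeasurableSet (D.candidate t ∩ D.bad s t) := fun t _ =>
    (RivalSetup.measurableSet_candidate t).inter (RivalSetup.measurableSet_bad s t)
  let G : Ω → ℝ := fun ω => ∑ t ∈ D.indices,
    {ω | lab ω ∈ D.good s t}.indicator (1 : Ω → ℝ) ω
  have hGm : ∀ t ∈ D.indices, MeasurableSet {ω | lab ω ∈ D.good s t} := fun t _ =>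
    h.measurable_labels (RivalSetup.measurableSet_good s t)
  have e1 : P.real {ω | lab ω ∈ {u | D.count u ≤ m / 2}} ≤ _ :=
    (h.measureReal_labels (measurableSet_le D.measurable_count measurable_const)).trans_le
      (D.measureReal_count_le hm)
  have e2 : P.real {ω | lab ω ∈ {u | m / 4 ≤ N u}} ≤
      4 * (6 * (Real.exp 1 * C * Real.exp (-C / 2)) +
        2 * (((D.Y₁.card : ℝ) + D.Y₂.card) * D.p₂)) := by
    rw [h.measureReal_labels (measurableSet_le measurable_const
      (Finset.measurable_fun_sum _ fun t ht => measurable_one.indicator (hNm t ht)))]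
    have h1 := mul_measureReal_sum_indicator_ge_le (labelMeasure V) D.indices hNm (m / 4)
    have h2 := h1.trans (Finset.sum_le_sum fun t ht =>
      RivalSetup.measureReal_candidate_inter_bad_le hs ht hC hq hp hρ)
    rw [Finset.sum_const, nsmul_eq_mul, ← mul_assoc] at h2
    change _ ≤ m * _ at h2
    refine le_of_mul_le_mul_left (a := m / 4) ?_ (by positivity)
    exact h2.trans (le_of_eq (by ring))
  have e3 : P.real ({ω | m / 4 ≤ G ω} ∩ A) ≤
      4 * Real.exp η * (1 / m + (Real.exp η - 1)) := by
    -- Markov's inequality for the number of good candidates under the restriction of `P` to the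
    -- agreement event, where its expectation is controlled by the exchange argument.
    have h1 := mul_measureReal_sum_indicator_ge_le (P.restrict A) D.indices hGm (m / 4)
    have h2 : ∀ E, MeasurableSet E → (P.restrict A).real E = P.real (E ∩ A) := fun E hE => by
      rw [measureReal_def, measureReal_def, Measure.restrict_apply hE]
    rw [h2 _ (measurableSet_le measurable_const (Finset.measurable_fun_sum _ fun t ht =>
      measurable_one.indicator (hGm t ht))), Finset.sum_congr rfl fun t ht => h2 _ (hGm t ht)] at h1
    have h3 := h1.trans (h.sum_measureReal_agreement_good_le hV hβ D hs hη)
    refine le_of_mul_le_mul_left (a := m / 4) ?_ (by positivity)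
    refine h3.trans (le_of_eq ?_)
    rw [← hmdef]
    field_simp
  have e4 : P.real {ω | lab ω ∈ {u | Function.Injective u}ᶜ} = 0 := by
    rw [h.measureReal_labels measurableSet_injective.compl, measureReal_def]
    have : labelMeasure V {u | Function.Injective u}ᶜ = 0 := ae_label_injective
    rw [this, ENNReal.toReal_zero]
  -- With more than `m/2` candidates of which fewer than `m/4` are spoiled, and distinct labels,
  -- more than `m/4` candidates are good.
  have hsub : A ⊆ (({ω | lab ω ∈ {u | D.count u ≤ m / 2}} ∪ {ω | lab ω ∈ {u | m / 4 ≤ N u}}) ∪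
      ({ω | m / 4 ≤ G ω} ∩ A)) ∪ {ω | lab ω ∈ {u | Function.Injective u}ᶜ} := by
    intro ω hω
    by_contra hn
    simp only [Set.mem_union, Set.mem_inter_iff, Set.mem_ofPred_eq, hω, and_true, not_or, not_le,
      Set.mem_compl_iff, not_not] at hn
    obtain ⟨⟨⟨h1, h2⟩, h3⟩, h4⟩ := hn
    have h5 : D.count (lab ω) ≤ N (lab ω) + G ω := by
      simp only [RivalSetup.count, N, G, ← Finset.sum_add_distrib]
      refine Finset.sum_le_sum fun t _ => ?_
      by_cases hc : lab ω ∈ D.candidate t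
      · by_cases hb : lab ω ∈ D.bad s t
        · simp only [Set.indicator, Set.mem_inter_iff, hc, hb, and_self, if_true, Pi.one_apply,
            le_add_iff_nonneg_right]
          split_ifs <;> norm_num
        · have hg : lab ω ∈ D.good s t := ⟨⟨hc, hb⟩, h4⟩
          simp [Set.indicator, hc, hb, hg]
      · have hg : lab ω ∉ D.good s t := fun hg => hc hg.1.1
        simp [Set.indicator, hc, hg]
    linarith
  have e5 := measureReal_mono hsub (measure_ne_top P _)
  have e6 := measureReal_union_le (μ := P) (({ω | lab ω ∈ {u | D.count u ≤ m / 2}} ∪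
    {ω | lab ω ∈ {u | m / 4 ≤ N u}}) ∪ ({ω | m / 4 ≤ G ω} ∩ A))
    {ω | lab ω ∈ {u | Function.Injective u}ᶜ}
  have e7 := measureReal_union_le (μ := P) ({ω | lab ω ∈ {u | D.count u ≤ m / 2}} ∪
    {ω | lab ω ∈ {u | m / 4 ≤ N u}}) ({ω | m / 4 ≤ G ω} ∩ A)
  have e8 := measureReal_union_le (μ := P) {ω | lab ω ∈ {u | D.count u ≤ m / 2}}
    {ω | lab ω ∈ {u | m / 4 ≤ N u}}
  linarith

end IsLabelledWalk

/-! ### Choice of parameters -/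

theorem exists_rivalSetup (s : V) {r : ℕ} (hr : 2 * r + 1 ≤ Fintype.card V) {p₁ δ : ℝ} {L : ℕ}
    (hp : 0 ≤ p₁) (hδ : 0 < δ) (hle : p₁ + L * δ ≤ 1) :
    ∃ D : RivalSetup V, s ∈ D.Q ∧ D.Q.card = Fintype.card V - 2 * r ∧ D.Y₁.card = r ∧
      D.Y₂.card = r ∧ D.p₁ = p₁ ∧ D.δ = δ ∧ D.L = L := by
  have hc : (Finset.univ.erase s).card = Fintype.card V - 1 := by
    rw [Finset.card_erase_of_mem (Finset.mem_univ s), Finset.card_univ]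
  obtain ⟨Y₁, h1, h1c⟩ := Finset.exists_subset_card_eq
    (show r ≤ (Finset.univ.erase s).card by omega)
  obtain ⟨Y₂, h2, h2c⟩ := Finset.exists_subset_card_eq
    (show r ≤ (Finset.univ.erase s \ Y₁).card by rw [Finset.card_sdiff_of_subset h1]; omega)
  have hd : Disjoint Y₁ Y₂ := Finset.disjoint_left.2 fun x hx hx' =>
    (Finset.mem_sdiff.1 (h2 hx')).2 hx
  refine ⟨⟨(Y₁ ∪ Y₂)ᶜ, Y₁, Y₂, p₁, δ, L, ?_, ?_, hd, ?_, hp, hδ, hle⟩, ?_, ?_, h1c, h2c,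
    rfl, rfl, rfl⟩
  · exact disjoint_compl_left.mono_right Finset.subset_union_left
  · exact disjoint_compl_left.mono_right Finset.subset_union_right
  · rw [Finset.union_comm]
    exact Finset.union_compl _
  · simp only [Finset.mem_compl, Finset.mem_union, not_or]
    exact ⟨fun h => Finset.notMem_erase s _ (h1 h),
      fun h => Finset.notMem_erase s _ (Finset.mem_sdiff.1 (h2 h)).1⟩
  · change (Y₁ ∪ Y₂)ᶜ.card = _
    rw [Finset.card_compl, Finset.card_union_of_disjoint hd]
    omega

theorem exp_neg_two_mul_le_one_sub {x : ℝ} (h0 : 0 ≤ x) (h1 : x ≤ 1 / 2) :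
    Real.exp (-(2 * x)) ≤ 1 - x := by
  rw [Real.exp_neg, inv_le_comm₀ (Real.exp_pos _) (by linarith)]
  have h2 : (1 - x)⁻¹ ≤ 2 * x + 1 := by
    rw [inv_le_iff_one_le_mul₀ (by linarith)]
    nlinarith
  exact h2.trans (Real.add_one_le_exp _)

namespace IsLabelledWalk

variable {Ω : Type*} [MeasurableSpace Ω] {P : Measure Ω} {β : ℝ} {s : V}
  {U : (⊤ : SimpleGraph V).edgeSet → Ω → ℝ} {X : ℕ → Ω → V}

-- Take `r = ⌊γn⌋` reserved vertices on each side, levels `p₁ = C/q` and `p₂ = 2C/q`, and `L =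
-- ⌊r²/K⌋` bins. Then `δ` is of order `n⁻³`, the mean number of candidates is at least `K C²
-- e^{-8C}`, and the correction to the variance is of order `1/n`.
set_option maxHeartbeats 800000 in
theorem agreementEvent_le_of_large (h : IsLabelledWalk P β s U X) (hV : 2 ≤ Fintype.card V)
    (hβ : 0 ≤ β) {n : ℝ} (hn : n = Fintype.card V) {C γ K : ℝ} (hC : 1 ≤ C)
    (hρ : Real.exp 1 * C * Real.exp (-C / 2) ≤ 1 / 2) (hγ0 : 0 < γ) (hγ : γ ≤ 1 / 4) (hK : 0 < K)
    (hnC : 8 * C ≤ n) (hnγ : 2 ≤ γ * n) (hnK : 8 * K ≤ (γ * n) ^ 2) :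
    P.real (agreementEvent s U X) ≤
      4 / (K * C ^ 2 * Real.exp (-(8 * C))) +
      4 / (K * C ^ 2 * Real.exp (-(8 * C))) ^ 2 * (16 * K ^ 2 * C ^ 3 / (γ * n)) +
      4 * (6 * (Real.exp 1 * C * Real.exp (-C / 2)) + 16 * γ * C) +
      4 * Real.exp (16 * C * K / γ ^ 2 * (β / n ^ 3)) *
        (1 / (K * C ^ 2 * Real.exp (-(8 * C))) +
          (Real.exp (16 * C * K / γ ^ 2 * (β / n ^ 3)) - 1)) := by
  have hn0 : 0 < n := by linarith
  set M := K * C ^ 2 * Real.exp (-(8 * C)) with hM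
  have hM0 : 0 < M := by positivity
  set r := ⌊γ * n⌋₊ with hr
  have hr1 : (r : ℝ) ≤ γ * n := Nat.floor_le (by positivity)
  have hr2 : γ * n < r + 1 := Nat.lt_floor_add_one _
  have hr3 : γ * n / 2 ≤ r := by linarith
  have hr0 : (0 : ℝ) < r := by linarith
  have hr4 : (2 : ℝ) * r ≤ n / 2 := by nlinarith
  have hrV : 2 * r + 1 ≤ Fintype.card V := by
    have : (2 * r + 1 : ℝ) ≤ Fintype.card V := by rw [← hn]; linarith
    exact_mod_cast this
  set q : ℝ := n - 2 * r with hq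
  have hq1 : n / 2 ≤ q := by linarith
  have hq0 : 0 < q := by linarith
  have hqC : 4 * C ≤ q := by linarith
  -- The mean number of candidates is proportional to `r² / L`, so `K` tunes it directly.
  set L := ⌊(r : ℝ) ^ 2 / K⌋₊ with hL
  have hL1 : (L : ℝ) ≤ (r : ℝ) ^ 2 / K := Nat.floor_le (by positivity)
  have hL2 : (r : ℝ) ^ 2 / K < L + 1 := Nat.lt_floor_add_one _
  have hrsq : (γ * n) ^ 2 ≤ 4 * (r : ℝ) ^ 2 := by
    calc (γ * n) ^ 2 ≤ (2 * (r : ℝ)) ^ 2 := pow_le_pow_left₀ (by positivity) (by linarith) 2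
      _ = _ := by ring
  have hrK : 2 ≤ (r : ℝ) ^ 2 / K := by
    rw [le_div_iff₀ hK]
    linarith
  have hL3 : (r : ℝ) ^ 2 / (2 * K) ≤ L := by
    have : (r : ℝ) ^ 2 / (2 * K) = (r : ℝ) ^ 2 / K / 2 := by field_simp
    rw [this]
    linarith
  have hL0 : (0 : ℝ) < L := by linarith
  set δ := C / (q * L) with hδ
  have hδ0 : 0 < δ := by positivity
  have hLδ : L * δ = C / q := by
    rw [hδ]; field_simp
  have hCq : C / q ≤ 1 / 4 := by
    rw [div_le_iff₀ hq0]; linarith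
  obtain ⟨D, hs, hQ, hY₁, hY₂, hp₁, hDδ, hDL⟩ := exists_rivalSetup s hrV (p₁ := C / q) (δ := δ)
    (L := L) (by positivity) hδ0 (by rw [hLδ]; linarith)
  have hQq : (D.Q.card : ℝ) = q := by
    rw [hQ, Nat.cast_sub (by omega), hq, hn]
    push_cast
    ring
  have hp₂ : D.p₂ = 2 * (C / q) := by
    rw [RivalSetup.p₂, hp₁, hDδ, hDL, hLδ]; ring
  -- From `1 - x ≥ e^{-2x}` at `x = p₂`, raised to a power of at most `2q`, with `q p₂ = 2C`.
  have hpow : Real.exp (-(8 * C)) ≤ ((1 - D.p₂) ^ (D.Q.card - 1)) ^ 2 := by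
    have h1 : Real.exp (-(2 * D.p₂)) ≤ 1 - D.p₂ :=
      exp_neg_two_mul_le_one_sub D.p₂_nonneg (by rw [hp₂]; linarith)
    calc Real.exp (-(8 * C)) ≤ (Real.exp (-(2 * D.p₂)) ^ (D.Q.card - 1)) ^ 2 := by
          rw [← Real.exp_nat_mul, ← Real.exp_nat_mul]
          refine Real.exp_le_exp.2 ?_
          have h2 : ((D.Q.card - 1 : ℕ) : ℝ) ≤ q := by
            rw [← hQq]; exact_mod_cast Nat.sub_le _ _
          have h3 := mul_le_mul_of_nonneg_right h2 D.p₂_nonneg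
          have h4 : q * D.p₂ = 2 * C := by rw [hp₂]; field_simp
          push_cast
          linarith
      _ ≤ _ := by
          have := (Real.exp_pos (-(2 * D.p₂))).le
          gcongr
  have hmean : M ≤ D.mean := by
    have h1 : D.mean = (r : ℝ) ^ 2 / L * C ^ 2 * ((1 - D.p₂) ^ (D.Q.card - 1)) ^ 2 := by
      rw [RivalSetup.mean, RivalSetup.card_indices, RivalSetup.r₀, hQq, hY₁, hY₂, hDL, hDδ, hδ]
      field_simp
    have h2 : K ≤ (r : ℝ) ^ 2 / L := by
      rw [le_div_iff₀ hL0]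
      rw [le_div_iff₀ hK] at hL1
      linarith
    rw [h1, hM]
    gcongr
  have hm0 : 0 < D.mean := hM0.trans_le hmean
  have hη : β * D.δ ≤ 16 * C * K / γ ^ 2 * (β / n ^ 3) := by
    have h1 : (γ * n) ^ 2 / (8 * K) ≤ L := by
      refine le_trans ?_ hL3
      rw [div_le_div_iff₀ (by positivity) (by positivity)]
      calc (γ * n) ^ 2 * (2 * K) ≤ 4 * (r : ℝ) ^ 2 * (2 * K) := by gcongr
        _ = _ := by ring
    have h2 : δ ≤ C / (n / 2 * ((γ * n) ^ 2 / (8 * K))) := by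
      rw [hδ]
      gcongr
    rw [hDδ]
    refine (mul_le_mul_of_nonneg_left h2 hβ).trans (le_of_eq ?_)
    field_simp
    ring
  -- Inserting `δ = C/(qL)` leaves `2 C³ r³ / L²`, which is of order `1/r` because `L` is of order
  -- `r²`.
  have hR : (D.L : ℝ) * D.δ ^ 3 * ((D.Q.card * D.Y₁.card) * (D.Q.card * D.Y₂.card) ^ 2 +
      (D.Q.card * D.Y₁.card) ^ 2 * (D.Q.card * D.Y₂.card)) ≤ 16 * K ^ 2 * C ^ 3 / (γ * n) := by
    rw [hQq, hY₁, hY₂, hDL, hDδ]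
    have h1 : (L : ℝ) * δ ^ 3 * ((q * r) * (q * r) ^ 2 + (q * r) ^ 2 * (q * r)) =
        2 * C ^ 3 * r ^ 3 / (L : ℝ) ^ 2 := by
      rw [hδ]
      field_simp
      ring
    rw [h1]
    calc 2 * C ^ 3 * r ^ 3 / (L : ℝ) ^ 2 ≤ 2 * C ^ 3 * r ^ 3 / ((r : ℝ) ^ 2 / (2 * K)) ^ 2 := by
          gcongr
      _ = 8 * K ^ 2 * C ^ 3 / r := by
          field_simp
          ring
      _ ≤ 8 * K ^ 2 * C ^ 3 / (γ * n / 2) := by gcongr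
      _ = _ := by
          field_simp
          ring
  have hdirty : 2 * (((D.Y₁.card : ℝ) + D.Y₂.card) * D.p₂) ≤ 16 * γ * C := by
    rw [hY₁, hY₂, hp₂]
    calc 2 * (((r : ℝ) + r) * (2 * (C / q))) = 8 * r * C / q := by ring
      _ ≤ 8 * (γ * n) * C / (n / 2) := by gcongr
      _ = _ := by
          field_simp
          ring
  have key := h.agreementEvent_le hV hβ D hs hC (by rw [hQq]; linarith) (by rw [hp₁, hQq]) hρ
    hm0 hη
  set R := (D.L : ℝ) * D.δ ^ 3 * ((D.Q.card * D.Y₁.card) * (D.Q.card * D.Y₂.card) ^ 2 +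
      (D.Q.card * D.Y₁.card) ^ 2 * (D.Q.card * D.Y₂.card)) with hRdef
  have hR0 : 0 ≤ R := by
    have := D.δ_pos
    positivity
  have t1 : 4 / D.mean ^ 2 * (D.mean + R) ≤
      4 / M + 4 / M ^ 2 * (16 * K ^ 2 * C ^ 3 / (γ * n)) := by
    have : 4 / D.mean ^ 2 * (D.mean + R) = 4 / D.mean + 4 / D.mean ^ 2 * R := by
      field_simp
    rw [this]
    gcongr
  have t2 : 1 / D.mean ≤ 1 / M := by gcongr
  refine key.trans (add_le_add (add_le_add t1 ?_) ?_)
  · linarith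
  · gcongr

end IsLabelledWalk

/-! ### The two limits -/

theorem tendsto_agreementEvent_one {β : ℕ → ℝ} (hβ : ∀ n, 0 ≤ β n)
    {V : ℕ → Type*} [∀ n, Fintype (V n)] [∀ n, DecidableEq (V n)]
    (hV : ∀ n, 2 ≤ n → Fintype.card (V n) = n) {s : ∀ n, V n}
    {Ω : ℕ → Type*} [∀ n, MeasurableSpace (Ω n)] {P : ∀ n, Measure (Ω n)}
    {U : ∀ n, (⊤ : SimpleGraph (V n)).edgeSet → Ω n → ℝ} {X : ∀ n, ℕ → Ω n → V n}
    (hUX : ∀ n, 2 ≤ n → IsLabelledWalk (P n) (β n) (s n) (U n) (X n))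
    (h : (fun n : ℕ => (n : ℝ) ^ 3 * Real.log n) =o[atTop] β) :
    Tendsto (fun n => (P n).real (agreementEvent (s n) (U n) (X n))) atTop (nhds 1) := by
  have hlim := h.tendsto_div_nhds_zero
  have hinv := tendsto_inv_atTop_nhds_zero_nat (𝕜 := ℝ)
  have hlow : Tendsto (fun n : ℕ => 1 - (n : ℝ)⁻¹ - 8 * ((n : ℝ) ^ 3 * Real.log n / β n)) atTop
      (nhds 1) := by
    simpa using (hinv.const_sub 1).sub (hlim.const_mul 8)
  refine tendsto_of_tendsto_of_tendsto_of_le_of_le' hlow tendsto_const_nhds ?_ ?_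
  · filter_upwards [eventually_ge_atTop 2, h.bound one_pos] with n hn hb
    have hn' : (2 : ℝ) ≤ n := by exact_mod_cast hn
    have hlog : 0 < Real.log n := Real.log_pos (by linarith)
    have hβn : 0 < β n := by
      rw [one_mul, Real.norm_of_nonneg (by positivity), Real.norm_of_nonneg (hβ n)] at hb
      exact lt_of_lt_of_le (by positivity) hb
    -- This `δ` gives `e^{-βδ/2} = n⁻⁴`, so the errors are `1/n` and `8 n³ log n / β`.
    have key := (hUX n hn).agreementEvent_ge (by rw [hV n hn]; exact hn) (hβ n)
      (δ := 8 * Real.log n / β n) (by positivity)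
    rw [hV n hn] at key
    refine le_trans (le_of_eq ?_) key
    have e1 : -β n * (8 * Real.log n / β n) / 2 = -((4 : ℕ) * Real.log n) := by
      field_simp
      norm_num
    rw [e1, Real.exp_neg, Real.exp_nat_mul, Real.exp_log (by linarith)]
    field_simp
  · filter_upwards [eventually_ge_atTop 2] with n hn
    have := (hUX n hn).isProbabilityMeasure
    exact measureReal_le_one

theorem tendsto_agreementEvent_zero {β : ℕ → ℝ} (hβ : ∀ n, 0 ≤ β n)
    {V : ℕ → Type*} [∀ n, Fintype (V n)] [∀ n, DecidableEq (V n)]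
    (hV : ∀ n, 2 ≤ n → Fintype.card (V n) = n) {s : ∀ n, V n}
    {Ω : ℕ → Type*} [∀ n, MeasurableSpace (Ω n)] {P : ∀ n, Measure (Ω n)}
    {U : ∀ n, (⊤ : SimpleGraph (V n)).edgeSet → Ω n → ℝ} {X : ∀ n, ℕ → Ω n → V n}
    (hUX : ∀ n, 2 ≤ n → IsLabelledWalk (P n) (β n) (s n) (U n) (X n))
    (h : β =o[atTop] (fun n : ℕ => (n : ℝ) ^ 3)) :
    Tendsto (fun n => (P n).real (agreementEvent (s n) (U n) (X n))) atTop (nhds 0) := by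
  refine (tendsto_order.2 ⟨fun ε hε => Eventually.of_forall fun n =>
    hε.trans_le measureReal_nonneg, fun ε hε => ?_⟩)
  -- Order of choices: `C` large makes small clusters rare, then `γ` small makes dirty vertices
  -- rare, then `K` large makes the mean number of candidates at least `M = 80/ε`; finally `n` tends
  -- to infinity.
  have hρlim : Tendsto (fun C : ℝ => Real.exp 1 * C * Real.exp (-C / 2)) atTop (nhds 0) := by
    have h1 := (Real.tendsto_pow_mul_exp_neg_atTop_nhds_zero 1).comp
      (tendsto_id.atTop_div_const (two_pos : (0 : ℝ) < 2))
    have h2 := h1.const_mul (2 * Real.exp 1)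
    rw [mul_zero] at h2
    refine h2.congr fun C => ?_
    simp only [Function.comp_apply, id_eq, pow_one, neg_div]
    ring
  obtain ⟨C, hρ1, hρ2, hC⟩ := ((hρlim.eventually_le_const (by norm_num : (0 : ℝ) < 1 / 2)).and
    ((hρlim.eventually_le_const (by positivity : 0 < ε / 240)).and (eventually_ge_atTop 1))).exists
  have hC0 : 0 < C := by linarith
  set γ := min (1 / 4) (ε / (640 * C)) with hγdef
  have hγ0 : 0 < γ := by positivity
  have hγ2 : 64 * γ * C ≤ ε / 10 := by
    have : γ ≤ ε / (640 * C) := min_le_right _ _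
    rw [le_div_iff₀ (by positivity)] at this
    linarith
  set M := 80 / ε with hMdef
  have hM0 : 0 < M := by positivity
  set K := M / (C ^ 2 * Real.exp (-(8 * C))) with hKdef
  have hK0 : 0 < K := by positivity
  have hKM : K * C ^ 2 * Real.exp (-(8 * C)) = M := by
    rw [hKdef]; field_simp
  have hcast := tendsto_natCast_atTop_atTop (R := ℝ)
  have hγn : Tendsto (fun n : ℕ => γ * (n : ℝ)) atTop atTop := hcast.const_mul_atTop hγ0
  have hη : Tendsto (fun n : ℕ => Real.exp (16 * C * K / γ ^ 2 * (β n / (n : ℝ) ^ 3))) atTop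
      (nhds 1) := by
    have := h.tendsto_div_nhds_zero.const_mul (16 * C * K / γ ^ 2)
    rw [mul_zero] at this
    have h0 := (Real.continuous_exp.tendsto 0).comp this
    rwa [Real.exp_zero] at h0
  have hbound : Tendsto (fun n : ℕ => 4 / M + 4 / M ^ 2 * (16 * K ^ 2 * C ^ 3 / (γ * n)) +
      4 * (6 * (Real.exp 1 * C * Real.exp (-C / 2)) + 16 * γ * C) +
      4 * Real.exp (16 * C * K / γ ^ 2 * (β n / (n : ℝ) ^ 3)) *
        (1 / M + (Real.exp (16 * C * K / γ ^ 2 * (β n / (n : ℝ) ^ 3)) - 1))) atTop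
      (nhds (4 / M + 4 / M ^ 2 * 0 +
        4 * (6 * (Real.exp 1 * C * Real.exp (-C / 2)) + 16 * γ * C) +
        4 * 1 * (1 / M + (1 - 1)))) :=
    ((((tendsto_const_nhds.div_atTop hγn).const_mul _).const_add _).add_const _).add
      ((hη.const_mul 4).mul ((hη.sub_const 1).const_add _))
  -- The limiting bound is at most `ε/20 + ε/10 + ε/10 + ε/20`: Chebyshev, small clusters, dirty
  -- vertices, exchange.
  have hlt : 4 / M + 4 / M ^ 2 * 0 +
        4 * (6 * (Real.exp 1 * C * Real.exp (-C / 2)) + 16 * γ * C) +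
        4 * 1 * (1 / M + (1 - 1)) < ε := by
    have : 1 / M = ε / 80 := by rw [hMdef]; field_simp
    have h4 : 4 / M = ε / 20 := by rw [hMdef]; field_simp; norm_num
    rw [this, h4]
    linarith
  filter_upwards [hbound.eventually_lt_const hlt, eventually_ge_atTop 2,
    hcast.eventually_ge_atTop (8 * C), hγn.eventually_ge_atTop 2,
    ((tendsto_pow_atTop two_ne_zero).comp hγn).eventually_ge_atTop (8 * K)] with n h1 h2 h3 h4 h5
  have key := (hUX n h2).agreementEvent_le_of_large (by rw [hV n h2]; exact h2) (hβ n) (n := n)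
    (by rw [hV n h2]) hC hρ1 hγ0 (min_le_left _ _) hK0 h3 h4 h5
  rw [hKM] at key
  exact key.trans_lt h1

end SpanningTreeAlgorithms

end

theorem mainTheorem3 (β : ℕ → ℝ) (hβ : ∀ n, 0 ≤ β n)
    (V : ℕ → Type*) [∀ n, Fintype (V n)] [∀ n, DecidableEq (V n)]
    (hV : ∀ n, 2 ≤ n → Fintype.card (V n) = n)
    (s : ∀ n, V n)
    (Ω : ℕ → Type*) [∀ n, MeasurableSpace (Ω n)] (P : ∀ n, Measure (Ω n))
    (U : ∀ n, (⊤ : SimpleGraph (V n)).edgeSet → Ω n → ℝ)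
    (X : ∀ n, ℕ → Ω n → V n)
    (hUX : ∀ n, 2 ≤ n →
      SpanningTreeAlgorithms.IsLabelledWalk (P n) (β n) (s n) (U n) (X n)) :
    ((fun n : ℕ => (n : ℝ) ^ 3 * Real.log n) =o[atTop] β →
      Tendsto (fun n => (P n).real
        (SpanningTreeAlgorithms.agreementEvent (s n) (U n) (X n))) atTop (nhds 1)) ∧
    (β =o[atTop] (fun n : ℕ => (n : ℝ) ^ 3) →
      Tendsto (fun n => (P n).real
        (SpanningTreeAlgorithms.agreementEvent (s n) (U n) (X n))) atTop (nhds 0)) :=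
  ⟨SpanningTreeAlgorithms.tendsto_agreementEvent_one hβ hV hUX,
    SpanningTreeAlgorithms.tendsto_agreementEvent_zero hβ hV hUX⟩
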